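/- **Setting.** Let $M$ be a compact connected (smooth, boundaryless) Riemannian manifold with distance $d$, and let $\{f_t\}_{t\in\mathbb R}$ be a $C^{1+\varepsilon}$ Anosov flow on $M$ ($\varepsilon>0$): $(t,x)\mapsto f_t(x)$ is of class $C^{1+\varepsilon}$, $f$ has no fixed points, and $T_xM=E^{\rm u}_x\oplus E^{\rm s}_x\oplus\mathbb R X_f(x)$ with $E^{\rm u},E^{\rm s}$ continuous $Df_t$-invariant subbundles such that, for some $C,\kappa>0$ and all $t\ge0$, $\|Df_t v\|\le Ce^{-\kappa t}\|v\|$ for $v\in E^{\rm s}$ and $\|Df_{-t}v\|\le Ce^{-\kappa t}\|v\|$ for $v\in E^{\rm u}$. Assume $\dim E^{\rm u}_x=1$ for all $x$, and put $W^{\rm u}(x)=\{y\in M\mid\lim_{t\to-\infty}d(f_t(x),f_t(y))=0\}$. Let $\{\phi_s\}_{s\in\mathbb R}$ be a continuous minimal flow on $M$ whose orbits are the sets $W^{\rm u}(x)$, and let $\mu$ be a $\phi$-invariant Borel probability measure on $M$ (it is known that there is exactly one). Let $s^*:\mathbb R\times\mathbb R\times M\to\mathbb R$ satisfy $f_t(\phi_s(x))=\phi_{s^*(t,s,x)}(f_t(x))$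 for all $s,t,x$. Let $\{\widetilde\phi_s\}_{s\in\mathbb R}$ be a uniformly expanding parametrisation of the unstable manifolds: a continuous flow with orbits $W^{\rm u}(x)$ such that $f_t\circ\widetilde\phi_s=\widetilde\phi_{\lambda^ts}\circ f_t$ for some $\lambda>1$ and all $s,t\in\mathbb R$. For a flow $g$ on $M$, $X_g$ denotes its vector field, and $X_g(h)(x)=\frac{d}{dt}\big|_{t=0}h(g_t(x))$ for a function $h$ on $M$. **Assumptions.** 1. $\phi$ is a $C^1$ flow and $\widetilde\phi$ is a $C^1$ reparametrisation of $\phi$: $\phi$ and $\widetilde\phi$ are $C^1$ flows and there is $\tau\in C^1(M\times\mathbb R;\mathbb R)$ with $\phi_s(x)=\widetilde\phi_{\tau(x,s)}(x)$, $\tau(x,0)=0$, $\tau(x,\cdot)$ strictly increasing, and $\tau(x,s+t)=\tau(x,s)+\tau(\phi_s(x),t)$. Put $\rho(x)=1/(\partial_2\tau)(x,0)$. 2. The derivative $(\partial_1\partial_2s^*)(t,s,x)$ exists and is continuous in $(t,s,x)\in\mathbb R\times\mathbb R\times M$. 3. The vector fields $X_f$ and $X_\phi$ are of class $C^1$, $X_f(\rho)$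 exists and belongs to $C(M)$, and $\rho^{-1}X_f(\rho)\in C^1(M)$. **Proposition (conjugate operator).** Let $U^\phi_s\varphi=\varphi\circ\phi_s$, and let $C^1(M)$ denote the complex-valued $C^1$ functions. Then, for every $t>0$, the formula $$A_t\varphi:=\frac1t\int_0^t U^\phi_s\big(2iX_f+i\rho^{-1}X_f(\rho)\big)U^\phi_{-s}\varphi\,ds,\qquad\varphi\in C^1(M),$$ (an integral in $L^2(M,\mu)$) gives a well-defined linear operator in $L^2(M,\mu)$ with domain $C^1(M)$, and this operator is essentially self-adjoint, that is, it is densely defined and symmetric and its closure is self-adjoint. -/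

import Mathlib

open Set Filter Topology MeasureTheory Bundle Manifold
open scoped NNReal ENNReal ContDiff

noncomputable section

namespace AnosovFlow

/-! ## Flows on a manifold -/

section Flows

variable (E : Type*) [NormedAddCommGroup E] [NormedSpace ℝ E]
variable {M : Type*}

/-- The flow `(t, x) ↦ f t x` is (jointly) of class `C^1`. -/
def IsC1Flow [TopologicalSpace M] [ChartedSpace E M] (f : Flow ℝ M) : Prop :=
  ContMDiff (𝓘(ℝ, ℝ).prod 𝓘(ℝ, E)) 𝓘(ℝ, E) 1 (fun p : ℝ × M => f p.1 p.2)

/-- The flow `(t, x) ↦ f t x` read in the preferred charts at `x₀` and `f t₀ x₀`. -/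
def flowInCharts [TopologicalSpace M] [ChartedSpace E M] (f : Flow ℝ M) (t₀ : ℝ) (x₀ : M) :
    ℝ × E → E :=
  fun p => extChartAt 𝓘(ℝ, E) (f t₀ x₀) (f p.1 ((extChartAt 𝓘(ℝ, E) x₀).symm p.2))

/-- The flow `f` is of class `C^{1+ε}` for some `ε > 0`: it is of class `C^1` and, in charts, its
first derivative is locally Hölder continuous with exponent `ε`.  (On bounded sets an exponent may
be lowered, so taking `ε ≤ 1` is no restriction.) -/
def IsC1HolderFlow [TopologicalSpace M] [ChartedSpace E M] (f : Flow ℝ M) : Prop :=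
  IsC1Flow E f ∧
    ∃ ε : ℝ≥0, 0 < ε ∧ ε ≤ 1 ∧ ∀ (t₀ : ℝ) (x₀ : M),
      ∃ U ∈ 𝓝 ((t₀, extChartAt 𝓘(ℝ, E) x₀ x₀) : ℝ × E), ∃ C : ℝ≥0,
        HolderOnWith C ε (fderiv ℝ (flowInCharts E f t₀ x₀)) U

/-- The vector field `X_f` of a flow: the velocity at time `0` of the orbit through `x`. -/
def vectorField [TopologicalSpace M] [ChartedSpace E M] (f : Flow ℝ M) (x : M) :
    TangentSpace 𝓘(ℝ, E) x :=
  (mfderiv 𝓘(ℝ, ℝ) 𝓘(ℝ, E) (fun t : ℝ => f t x) 0 (1 : ℝ) : E)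

/-- The vector field `X_f` is of class `C^1` (as a section of the tangent bundle). -/
def HasC1VectorField [TopologicalSpace M] [ChartedSpace E M] [IsManifold 𝓘(ℝ, E) ∞ M]
    (f : Flow ℝ M) : Prop :=
  ContMDiff 𝓘(ℝ, E) 𝓘(ℝ, E).tangent 1
    (fun x : M => (⟨x, vectorField E f x⟩ : TangentBundle 𝓘(ℝ, E) M))

/-- The derivative `X_f(g)` of a function along a flow, `x ↦ d/dt|_{t=0} g(f_t(x))`. -/
def flowDeriv [TopologicalSpace M] {F : Type*} [NormedAddCommGroup F] [NormedSpace ℝ F]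
    (f : Flow ℝ M) (g : M → F) (x : M) : F :=
  deriv (fun t : ℝ => g (f t x)) 0

/-- A family of subspaces of the tangent spaces is a continuous subbundle: it has a constant rank
and, locally, a frame of continuous vector fields. -/
def IsContinuousSubbundle [TopologicalSpace M] [ChartedSpace E M] [IsManifold 𝓘(ℝ, E) ∞ M]
    (V : (x : M) → Submodule ℝ (TangentSpace 𝓘(ℝ, E) x)) : Prop :=
  ∃ k : ℕ, ∀ x₀ : M, ∃ U ∈ 𝓝 x₀, ∃ e : Fin k → (x : M) → TangentSpace 𝓘(ℝ, E) x,
    (∀ i, ContinuousOn (fun x : M => (⟨x, e i x⟩ : TangentBundle 𝓘(ℝ, E) M)) U) ∧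
    ∀ x ∈ U, LinearIndependent ℝ (fun i => e i x) ∧ Submodule.span ℝ (range fun i => e i x) = V x

end Flows

/-! ## Anosov flows and minimal `W^u` flows -/

section Anosov

variable (E : Type*) [NormedAddCommGroup E] [NormedSpace ℝ E]
variable {M : Type*}

/-- `Eu`, `Es` are the unstable and stable bundles of an Anosov splitting of `f`:
`f` has no fixed point, `T_xM = Eu x ⊕ Es x ⊕ ℝ X_f(x)`, the bundles `Eu` and `Es` are continuous
and invariant under `f`, `Es` is exponentially contracted in the future, and `Eu` is exponentially
contracted in the past. -/
structure IsAnosovSplitting [MetricSpace M] [ChartedSpace E M] [IsManifold 𝓘(ℝ, E) ∞ M]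
    [RiemannianBundle (fun x : M => TangentSpace 𝓘(ℝ, E) x)]
    (f : Flow ℝ M) (Eu Es : (x : M) → Submodule ℝ (TangentSpace 𝓘(ℝ, E) x)) : Prop where
  vectorField_ne_zero : ∀ x, vectorField E f x ≠ 0
  isInternal : ∀ x, DirectSum.IsInternal
    (![Eu x, Es x, Submodule.span ℝ {vectorField E f x}] :
      Fin 3 → Submodule ℝ (TangentSpace 𝓘(ℝ, E) x))
  continuous_unstable : IsContinuousSubbundle E Eu
  continuous_stable : IsContinuousSubbundle E Es
  map_unstable : ∀ (t : ℝ) (x : M),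
    (Eu x).map (mfderiv 𝓘(ℝ, E) 𝓘(ℝ, E) (f t) x).toLinearMap = Eu (f t x)
  map_stable : ∀ (t : ℝ) (x : M),
    (Es x).map (mfderiv 𝓘(ℝ, E) 𝓘(ℝ, E) (f t) x).toLinearMap = Es (f t x)
  contraction : ∃ C κ : ℝ, 0 < C ∧ 0 < κ ∧ ∀ t : ℝ, 0 ≤ t → ∀ x : M,
    (∀ v ∈ Es x, ‖mfderiv 𝓘(ℝ, E) 𝓘(ℝ, E) (f t) x v‖ ≤ C * Real.exp (-κ * t) * ‖v‖) ∧
    (∀ v ∈ Eu x, ‖mfderiv 𝓘(ℝ, E) 𝓘(ℝ, E) (f (-t)) x v‖ ≤ C * Real.exp (-κ * t) * ‖v‖)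

/-- `f` is a `C^{1+ε}` Anosov flow whose unstable bundle is one-dimensional. -/
def IsCodimensionOneAnosovFlow [MetricSpace M] [ChartedSpace E M] [IsManifold 𝓘(ℝ, E) ∞ M]
    [RiemannianBundle (fun x : M => TangentSpace 𝓘(ℝ, E) x)] (f : Flow ℝ M) : Prop :=
  IsC1HolderFlow E f ∧
    ∃ Eu Es : (x : M) → Submodule ℝ (TangentSpace 𝓘(ℝ, E) x),
      IsAnosovSplitting E f Eu Es ∧ ∀ x, Module.finrank ℝ (Eu x) = 1

/-- The unstable manifold `W^u(x)` of a flow. -/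
def unstableManifold [MetricSpace M] (f : Flow ℝ M) (x : M) : Set M :=
  {y | Tendsto (fun t : ℝ => dist (f t x) (f t y)) atBot (𝓝 0)}

/-- `φ` is a minimal `W^u` flow: a continuous minimal flow whose orbits are the unstable manifolds
of `f`. -/
structure IsMinimalUnstableFlow [MetricSpace M] (f φ : Flow ℝ M) : Prop where
  orbit_eq : ∀ x, φ.orbit x = unstableManifold f x
  dense_orbit : ∀ x, Dense (φ.orbit x)

/-- `φ'` is a uniformly expanding parametrisation of the unstable manifolds of `f`, with
constant `lam`. -/
structure IsUniformlyExpanding [MetricSpace M] (f φ' : Flow ℝ M) (lam : ℝ) : Prop where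
  one_lt : 1 < lam
  orbit_eq : ∀ x, φ'.orbit x = unstableManifold f x
  commutation : ∀ (t s : ℝ) (x : M), f t (φ' s x) = φ' (lam ^ t * s) (f t x)

/-- `φ` and `φ'` are `C^1` flows that are `C^1` reparametrisations of each other:
`φ_s(x) = φ'_{τ(x,s)}(x)` with a `C^1` function `τ` such that `τ(x,0) = 0`, `τ(x,·)` is strictly
increasing, and the cocycle relation holds. -/
structure IsC1Reparametrisation [TopologicalSpace M] [ChartedSpace E M]
    (φ φ' : Flow ℝ M) (τ : M → ℝ → ℝ) : Prop where
  c1 : IsC1Flow E φ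
  c1' : IsC1Flow E φ'
  contMDiff : ContMDiff (𝓘(ℝ, E).prod 𝓘(ℝ, ℝ)) 𝓘(ℝ, ℝ) 1 (fun p : M × ℝ => τ p.1 p.2)
  eq : ∀ (s : ℝ) (x : M), φ s x = φ' (τ x s) x
  zero : ∀ x, τ x 0 = 0
  strictMono : ∀ x, StrictMono (τ x)
  cocycle : ∀ (x : M) (s t : ℝ), τ x (s + t) = τ x s + τ (φ s x) t

/-- The function `ρ(x) = 1 / (∂₂τ)(x,0)`. -/
def rho (τ : M → ℝ → ℝ) (x : M) : ℝ := 1 / deriv (τ x) 0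

/-- `u = ∂₁∂₂ s*` exists everywhere and is continuous on `ℝ × ℝ × M`. -/
structure HasContinuousMixedDeriv [TopologicalSpace M] (sStar : ℝ → ℝ → M → ℝ) : Prop where
  differentiable_snd : ∀ (t s : ℝ) (x : M), DifferentiableAt ℝ (fun s' => sStar t s' x) s
  differentiable_fst : ∀ (t s : ℝ) (x : M),
    DifferentiableAt ℝ (fun t' => deriv (fun s' => sStar t' s' x) s) t
  continuous : Continuous (fun p : ℝ × ℝ × M =>
    deriv (fun t' => deriv (fun s' => sStar t' s' p.2.2) p.2.1) p.1)

/-- The vector fields `X_f` and `X_φ` are of class `C^1`, the derivative `X_f(ρ)` exists and is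
continuous, and `ρ⁻¹ X_f(ρ)` is of class `C^1`. -/
structure HasC1Data [TopologicalSpace M] [ChartedSpace E M] [IsManifold 𝓘(ℝ, E) ∞ M]
    (f φ : Flow ℝ M) (ρ : M → ℝ) : Prop where
  c1_vectorField : HasC1VectorField E f
  c1_vectorField' : HasC1VectorField E φ
  differentiable : ∀ x, DifferentiableAt ℝ (fun t : ℝ => ρ (f t x)) 0
  continuous : Continuous (flowDeriv f ρ)
  contMDiff : ContMDiff 𝓘(ℝ, E) 𝓘(ℝ, ℝ) 1 (fun x => (ρ x)⁻¹ * flowDeriv f ρ x)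

end Anosov

/-! ## The conjugate operator -/

section Operator

/-- A densely defined symmetric operator whose closure is self-adjoint. -/
structure IsEssentiallySelfAdjoint {H : Type*} [NormedAddCommGroup H] [InnerProductSpace ℂ H]
    [CompleteSpace H] (A : H →ₗ.[ℂ] H) : Prop where
  dense_domain : Dense (A.domain : Set H)
  symmetric : A.IsFormalAdjoint A
  isSelfAdjoint_closure : IsSelfAdjoint A.closure

variable {M : Type*} [TopologicalSpace M]

/-- The pullback `U^φ_s ψ = ψ ∘ φ_s`. -/
def pullback (φ : Flow ℝ M) (s : ℝ) (ψ : M → ℂ) : M → ℂ := fun x => ψ (φ s x)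

/-- The first-order operator `2 i X_f + i ρ⁻¹ X_f(ρ)`. -/
def generatorSum (f : Flow ℝ M) (ρ : M → ℝ) (ψ : M → ℂ) : M → ℂ := fun x =>
  2 * Complex.I * flowDeriv f ψ x
    + Complex.I * (((ρ x)⁻¹ * flowDeriv f ρ x : ℝ) : ℂ) * ψ x

/-- `v = (1/t) ∫₀ᵗ U^φ_s (2 i X_f + i ρ⁻¹ X_f(ρ)) U^φ_{-s} ψ ds`, where the integrand `w` is a
function of `s` with values in `L²(M, μ)` that is Bochner integrable. -/
def IsBirkhoffAverage [MeasurableSpace M] (f φ : Flow ℝ M) (ρ : M → ℝ) (μ : Measure M) (t : ℝ)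
    (ψ : M → ℂ) (v : Lp ℂ 2 μ) : Prop :=
  ∃ w : ℝ → Lp ℂ 2 μ,
    (∀ s, w s =ᵐ[μ] pullback φ s (generatorSum f ρ (pullback φ (-s) ψ))) ∧
    IntervalIntegrable w volume 0 t ∧
    v = ((1 / t : ℝ) : ℂ) • ∫ s in (0 : ℝ)..t, w s

/-- `A` is the operator `A_t` in `L²(M, μ)`: its domain is `C^1(M)` (the complex-valued functions
of class `C^1`, seen in `L²(M, μ)`), on which it is given by the Birkhoff average. -/
structure IsConjugateOperator (E : Type*) [NormedAddCommGroup E] [NormedSpace ℝ E]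
    [ChartedSpace E M] [MeasurableSpace M] (f φ : Flow ℝ M) (ρ : M → ℝ) (μ : Measure M) (t : ℝ)
    (A : Lp ℂ 2 μ →ₗ.[ℂ] Lp ℂ 2 μ) : Prop where
  mem_domain_iff : ∀ u : Lp ℂ 2 μ,
    u ∈ A.domain ↔ ∃ ψ : M → ℂ, ContMDiff 𝓘(ℝ, E) 𝓘(ℝ, ℂ) 1 ψ ∧ u =ᵐ[μ] ψ
  apply_eq : ∀ (u : A.domain) (ψ : M → ℂ), ContMDiff 𝓘(ℝ, E) 𝓘(ℝ, ℂ) 1 ψ →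
    (u : Lp ℂ 2 μ) =ᵐ[μ] ψ → IsBirkhoffAverage f φ ρ μ t ψ (A u)

end Operator

end AnosovFlow

end

/-! ## A criterion for essential self-adjointness -/

namespace LinearPMap

open scoped InnerProductSpace

variable {H : Type*} [NormedAddCommGroup H] [InnerProductSpace ℂ H] [CompleteSpace H]

/-! Conjugation by φ changes X_f only along φ. Differentiating φ_{-s} f_r φ_s(x) =
φ_{s*(r,s,x)-s}(f_r x) at r = 0 gives U_s X_f U_{-s} = X_f + V_s X_φ with V_s = ∂₁s*(0,s,·)
(`flowDeriv_conj`). Since f_t multiplies the time of φ' by λ^t, one has τ(f_t x, s*(t,s,x)) = λ^t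
τ(x,s), and two differentiations turn this into V_s = ∫₀ˢ (log λ + ρ⁻¹X_f(ρ))∘φ_r dr. Hence A_t =
2i(Y + h/2) with Y = X_f + gX_φ, where g and h are the averages over s ∈ [0,t] of V_s and of
(ρ⁻¹X_f(ρ))∘φ_s. Because ρ⁻¹X_f(ρ) is C^1, so are g and h, and Y is a C^1 vector field, although ρ
itself is only known to be continuous.

Symmetry of A_t says that the divergence of Y with respect to μ is h. The field X_φ is divergence
free by invariance of μ, and X_φ(g) = h - ρ⁻¹X_f(ρ) (`flowDeriv_avgShift`). It remains to see that
X_f has divergence ρ⁻¹X_f(ρ), which is the f-invariance of the measure ρ⁻¹μ (`integral_comp_f`).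
That measure is φ'-invariant because X_φ' = ρX_φ. If the averages of every C^1 function along φ'
converge uniformly to a constant, this constant is the normalised integral against ρ⁻¹μ, and
composing the function with f_r does not change it since f_r only rescales φ'.

The uniform convergence is a renormalisation argument. Averages over φ'-segments of length λ^t, read
through f_t, are the functions y ↦ ∫₀¹ θ(f_t φ'_s y) ds. They are uniformly Lipschitz for t ≥ 0
(`exists_bound_dirDeriv_average`): the weak stable part of a tangent vector is not expanded by f_t,
and its unstable part a(s)X_φ' contributes a(s) times the s-derivative of θ(f_t φ'_s y), which is
integrated by parts because a is Lipschitz. Equicontinuity and density of the orbits then force a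
constant limit (`_root_.exists_uniform_average`).

For self-adjointness, Y has on the compact manifold M a global flow Φ which is C^1 in the initial
point; this regularity comes from the inverse function theorem applied to Picard's integral
equation. So u_r = exp(½∫₀ʳ h∘Φ_q dq) ψ∘Φ_r stays in C^1(M), solves ∂_r u = (Y + h/2)u and has
constant L² norm. If v is orthogonal to the range of A_t ∓ i, then r ↦ ⟨v, u_r⟩ is a bounded
solution of m' = ±½m, hence zero; so v is orthogonal to the dense domain, and both deficiency spaces
vanish. -/

theorem IsFormalAdjoint.isClosable_of_dense {A : H →ₗ.[ℂ] H} (hd : Dense (A.domain : Set H))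
    (hs : A.IsFormalAdjoint A) : A.IsClosable :=
  (adjoint_isClosed hd).isClosable.leIsClosable (hs.le_adjoint hd)

/-- If no nonzero vector is orthogonal to the range of `A - i` or to the range of `A + i`, then
the graph of the adjoint of `A` lies in the closure of the graph of `A`. -/
theorem adjoint_graph_le_topologicalClosure {A : H →ₗ.[ℂ] H}
    (hs : A.graph ≤ A.graph.adjoint)
    (hpos : ∀ v : H, (∀ x : A.domain, ⟪v, A x - Complex.I • (x : H)⟫_ℂ = 0) → v = 0)
    (hneg : ∀ v : H, (∀ x : A.domain, ⟪v, A x + Complex.I • (x : H)⟫_ℂ = 0) → v = 0) :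
    A.graph.adjoint ≤ A.graph.topologicalClosure := by
  rintro ⟨x, y⟩ hxy
  have hclosed : _root_.IsClosed (A.graph.adjoint : Set (H × H)) := by
    have : (A.graph.adjoint : Set (H × H)) = ⋂ a : A.domain,
        {p : H × H | ⟪A a, p.1⟫_ℂ - ⟪(a : H), p.2⟫_ℂ = 0} := by
      ext p
      simp
    rw [this]
    refine isClosed_iInter fun a => isClosed_eq ?_ continuous_const
    fun_prop
  have hcl : A.graph.topologicalClosure ≤ A.graph.adjoint :=
    Submodule.topologicalClosure_minimal _ hs hclosed
  -- The product `H × H` has the sup norm; orthogonal projection onto the closed graph needs its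
  -- Hilbert norm.
  let K : Submodule ℂ (WithLp 2 (H × H)) :=
    A.graph.topologicalClosure.comap (WithLp.linearEquiv 2 ℂ (H × H)).toLinearMap
  have hK : _root_.IsClosed (K : Set (WithLp 2 (H × H))) :=
    A.graph.isClosed_topologicalClosure.preimage (WithLp.prod_continuous_ofLp 2 H H)
  have : CompleteSpace K := hK.completeSpace_coe
  let P : WithLp 2 (H × H) := K.starProjection (WithLp.toLp 2 (x, y))
  have hPK : P ∈ K := K.starProjection_apply_mem _
  have hperp : WithLp.toLp 2 (x, y) - P ∈ Kᗮ := K.sub_starProjection_mem_orthogonal _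
  set z := x - P.fst with hz
  set w := y - P.snd with hw
  have hzw : ((z, w) : H × H) ∈ A.graph.adjoint := by
    have h := A.graph.adjoint.sub_mem hxy (hcl hPK)
    exact h
  have horth : ∀ a : A.domain, ⟪(a : H), z⟫_ℂ + ⟪A a, w⟫_ℂ = 0 := by
    intro a
    have ha : WithLp.toLp 2 ((a : H), A a) ∈ K :=
      A.graph.le_topologicalClosure (A.mem_graph a)
    have := (Submodule.mem_orthogonal _ _).1 hperp _ ha
    simpa [WithLp.prod_inner_apply] using this
  -- The two relations read A*w = -z and A*z = w. Hence z - iw and z + iw are eigenvectors of A* for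
  -- i and -i, and the assumptions kill both.
  have hadj : ∀ a : A.domain, ⟪A a, z⟫_ℂ - ⟪(a : H), w⟫_ℂ = 0 := fun a =>
    (Submodule.mem_adjoint_iff _ _).1 hzw _ _ (A.mem_graph a)
  have h1 : z - Complex.I • w = 0 := by
    refine hneg _ fun a => ?_
    have : ⟪A a + Complex.I • (a : H), z - Complex.I • w⟫_ℂ = 0 := by
      simp only [inner_add_left, inner_sub_right, inner_smul_left, inner_smul_right,
        Complex.conj_I]
      linear_combination hadj a - Complex.I * horth a + ⟪(a : H), w⟫_ℂ * Complex.I_sq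
    exact inner_eq_zero_symm.1 this
  have h2 : z + Complex.I • w = 0 := by
    refine hpos _ fun a => ?_
    have : ⟪A a - Complex.I • (a : H), z + Complex.I • w⟫_ℂ = 0 := by
      simp only [inner_sub_left, inner_add_right, inner_smul_left, inner_smul_right,
        Complex.conj_I]
      linear_combination hadj a + Complex.I * horth a + ⟪(a : H), w⟫_ℂ * Complex.I_sq
    exact inner_eq_zero_symm.1 this
  have hz0 : z = 0 := by
    have : (2 : ℂ) • z = 0 := by
      rw [two_smul]
      calc z + z = (z - Complex.I • w) + (z + Complex.I • w) := by abel
        _ = 0 := by rw [h1, h2, add_zero]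
    simpa using this
  have hw0 : w = 0 := by
    rw [hz0, zero_add] at h2
    simpa using h2
  have : ((x, y) : H × H) = WithLp.ofLp P := by
    refine Prod.ext ?_ ?_
    · exact sub_eq_zero.1 hz0
    · exact sub_eq_zero.1 hw0
  rw [this]
  exact hPK

/-- A densely defined symmetric operator such that no nonzero vector is orthogonal to the range of
`A - i` or to the range of `A + i` is essentially self-adjoint. -/
theorem isEssentiallySelfAdjoint_of_orthogonal_range_eq_zero {A : H →ₗ.[ℂ] H}
    (hd : Dense (A.domain : Set H)) (hs : A.IsFormalAdjoint A)
    (hpos : ∀ v : H, (∀ x : A.domain, ⟪v, A x - Complex.I • (x : H)⟫_ℂ = 0) → v = 0)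
    (hneg : ∀ v : H, (∀ x : A.domain, ⟪v, A x + Complex.I • (x : H)⟫_ℂ = 0) → v = 0) :
    AnosovFlow.IsEssentiallySelfAdjoint A := by
  have hcl := hs.isClosable_of_dense hd
  refine ⟨hd, hs, ?_⟩
  have hdc : Dense (A.closure.domain : Set H) := hd.mono A.le_closure.1
  have hle : A.graph ≤ A.graph.adjoint := by
    rw [← adjoint_graph_eq_graph_adjoint hd]
    exact le_graph_of_le (hs.le_adjoint hd)
  have hadj : A.graph.adjoint ≤ A.graph.topologicalClosure.adjoint := by
    rintro ⟨x, y⟩ hxy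
    rw [Submodule.mem_adjoint_iff] at hxy ⊢
    intro a b hab
    have hclosed : _root_.IsClosed {p : H × H | ⟪p.2, x⟫_ℂ - ⟪p.1, y⟫_ℂ = 0} :=
      isClosed_eq (by fun_prop) continuous_const
    exact closure_minimal (fun p hp => hxy p.1 p.2 hp) hclosed hab
  have hadj' : A.graph.topologicalClosure.adjoint ≤ A.graph.adjoint := by
    rintro ⟨x, y⟩ hxy
    rw [Submodule.mem_adjoint_iff] at hxy ⊢
    exact fun a b hab => hxy a b (A.graph.le_topologicalClosure hab)
  have hcl' : A.graph.topologicalClosure ≤ A.graph.adjoint := by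
    refine Submodule.topologicalClosure_minimal _ hle ?_
    rw [← adjoint_graph_eq_graph_adjoint hd]
    exact adjoint_isClosed hd
  rw [isSelfAdjoint_def]
  apply eq_of_eq_graph
  rw [adjoint_graph_eq_graph_adjoint hdc, ← hcl.graph_closure_eq_closure_graph]
  exact le_antisymm (hadj'.trans (adjoint_graph_le_topologicalClosure hle hpos hneg))
    (hcl'.trans hadj)

end LinearPMap

/-! ## Local flows of `C^1` vector fields -/

section LocalFlow

variable {K : Type*} [TopologicalSpace K] [CompactSpace K]
variable {E F : Type*} [NormedAddCommGroup E] [NormedSpace ℝ E]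
  [NormedAddCommGroup F] [NormedSpace ℝ F]

/-! ### Differentiability of composition operators on spaces of continuous functions -/

namespace ContinuousMap

variable {G : Type*} [NormedAddCommGroup G] [NormedSpace ℝ G]

variable (K) in
/-- The pointwise application of a continuous bilinear map to continuous functions. -/
noncomputable def bilinearCLM (B : G →L[ℝ] E →L[ℝ] F) : C(K, G) →L[ℝ] C(K, E) →L[ℝ] C(K, F) :=
  LinearMap.mkContinuous₂
    (LinearMap.mk₂ ℝ (fun (A : C(K, G)) (η : C(K, E)) =>
        (⟨fun k => B (A k) (η k), by fun_prop⟩ : C(K, F)))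
      (fun A B η => by ext k; simp) (fun c A η => by ext k; simp)
      (fun A η ξ => by ext k; simp) (fun c A η => by ext k; simp))
    ‖B‖ (fun A η => by
      refine (ContinuousMap.norm_le _ (by positivity)).2 fun k => ?_
      refine (B.le_opNorm₂ (A k) (η k)).trans ?_
      gcongr
      · exact A.norm_coe_le_norm k
      · exact η.norm_coe_le_norm k)

/-- The derivative at γ is pointwise application of the derivative of v along γ. The mean value
inequality at each point gives the remainder estimate, uniformly in the point because η ↦ v'∘η is
continuous for the sup norm. -/
theorem contDiff_one_postcomp_of_hasFDerivAt (B : G →L[ℝ] E →L[ℝ] F) (v : C(E, F)) (v' : C(E, G))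
    (hv : ∀ x, HasFDerivAt v (B (v' x)) x) :
    ContDiff ℝ 1 (fun η : C(K, E) => v.comp η) := by
  let D : C(K, E) → C(K, G) := fun η => v'.comp η
  have hD : Continuous D := ContinuousMap.continuous_postcomp _
  rw [contDiff_one_iff_hasFDerivAt]
  refine ⟨fun η => bilinearCLM K B (D η), (bilinearCLM K B).continuous.comp hD, fun γ => ?_⟩
  rw [hasFDerivAt_iff_isLittleO_nhds_zero, Asymptotics.isLittleO_iff]
  intro c hc
  obtain ⟨δ, hδ, hball⟩ := Metric.continuous_iff.1 hD γ (c / (‖B‖ + 1)) (by positivity)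
  filter_upwards [Metric.ball_mem_nhds (0 : C(K, E)) hδ] with η hη
  rw [mem_ball_zero_iff] at hη
  refine (ContinuousMap.norm_le _ (by positivity)).2 fun k => ?_
  have key : ∀ e ∈ Metric.ball (γ k) δ, ‖B (v' e) - B (v' (γ k))‖ ≤ c := by
    intro e he
    -- The displacement at the single point k is extended to a constant perturbation of γ, so that
    -- the continuity of η ↦ v'∘η can be tested on it. This stands in for uniform continuity of v'
    -- near the image of γ.
    have h1 : dist (γ + ContinuousMap.const K (e - γ k)) γ < δ := by
      rw [dist_eq_norm, add_sub_cancel_left]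
      refine lt_of_le_of_lt ((ContinuousMap.norm_le _ (norm_nonneg (e - γ k))).2 fun _ => le_rfl) ?_
      rwa [← dist_eq_norm]
    have h2 := (ContinuousMap.dist_apply_le_dist k).trans (hball _ h1).le
    have h3 : ‖v' e - v' (γ k)‖ ≤ c / (‖B‖ + 1) := by
      rw [dist_eq_norm] at h2
      simpa [D] using h2
    rw [← map_sub]
    refine (B.le_opNorm _).trans ?_
    calc ‖B‖ * ‖v' e - v' (γ k)‖ ≤ (‖B‖ + 1) * (c / (‖B‖ + 1)) := by gcongr; linarith
      _ = c := by field_simp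
  have hk : γ k + η k ∈ Metric.ball (γ k) δ := by
    rw [mem_ball_iff_norm, add_sub_cancel_left]
    exact (η.norm_coe_le_norm k).trans_lt hη
  have := (convex_ball (γ k) δ).norm_image_sub_le_of_norm_hasFDerivWithin_le'
    (fun e _ => (hv e).hasFDerivWithinAt) key (Metric.mem_ball_self hδ) hk
  rw [add_sub_cancel_left] at this
  exact this.trans (mul_le_mul_of_nonneg_left (η.norm_coe_le_norm k) hc.le)

/-- Composition with a `C^1` function is a `C^1` operation on continuous functions. -/
theorem contDiff_one_postcomp {v : E → F} (hv : ContDiff ℝ 1 v) :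
    ContDiff ℝ 1 (fun η : C(K, E) => (⟨v, hv.continuous⟩ : C(E, F)).comp η) :=
  contDiff_one_postcomp_of_hasFDerivAt (ContinuousLinearMap.id ℝ (E →L[ℝ] F))
    ⟨v, hv.continuous⟩ ⟨fderiv ℝ v, hv.continuous_fderiv (by norm_num)⟩
    fun x => (hv.differentiable (by norm_num) x).hasFDerivAt

end ContinuousMap

/-- The primitive vanishing at `0` of a continuous function on `[-1, 1]`. -/
noncomputable def primitiveCLM (E : Type*) [NormedAddCommGroup E] [NormedSpace ℝ E] :
    C(Icc (-1 : ℝ) 1, E) →L[ℝ] C(Icc (-1 : ℝ) 1, E) :=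
  LinearMap.mkContinuous
    { toFun := fun η => ⟨fun t => ∫ τ in (0 : ℝ)..t, η (projIcc (-1) 1 (by norm_num) τ), by
        have hc : Continuous fun τ : ℝ => η (projIcc (-1 : ℝ) 1 (by norm_num) τ) :=
          η.continuous.comp continuous_projIcc
        exact (intervalIntegral.continuous_primitive
          (fun a b => hc.intervalIntegrable a b) 0).comp continuous_subtype_val⟩
      map_add' := fun η ξ => by
        ext t
        have hη : Continuous fun τ : ℝ => η (projIcc (-1 : ℝ) 1 (by norm_num) τ) :=
          η.continuous.comp continuous_projIcc
        have hξ : Continuous fun τ : ℝ => ξ (projIcc (-1 : ℝ) 1 (by norm_num) τ) :=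
          ξ.continuous.comp continuous_projIcc
        exact intervalIntegral.integral_add (hη.intervalIntegrable _ _)
          (hξ.intervalIntegrable _ _)
      map_smul' := fun c η => by
        ext t
        exact intervalIntegral.integral_smul c _ }
    1 (fun η => by
      refine (ContinuousMap.norm_le _ (by positivity)).2 fun t => ?_
      have := intervalIntegral.norm_integral_le_of_norm_le_const (a := 0) (b := t)
        (f := fun τ => η (projIcc (-1 : ℝ) 1 (by norm_num) τ)) (C := ‖η‖)
        (fun τ _ => η.norm_coe_le_norm _)
      refine this.trans ?_
      rw [sub_zero, mul_comm]
      exact mul_le_mul_of_nonneg_right (abs_le.2 t.2) (norm_nonneg _))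

/-- A cutoff. A globally defined field is needed because the composition operator acts on all
continuous curves. -/
theorem exists_contDiff_eventuallyEq [FiniteDimensional ℝ E] {v : E → F} {x₀ : E}
    (hv : ContDiffAt ℝ 1 v x₀) : ∃ w : E → F, ContDiff ℝ 1 w ∧ w =ᶠ[𝓝 x₀] v := by
  obtain ⟨r, hr, hball⟩ := Metric.eventually_nhds_iff_ball.1 (hv.eventually (by simp))
  let χ : ContDiffBump x₀ := ⟨r / 4, r / 2, by linarith, by linarith⟩
  refine ⟨fun x => χ x • v x, ?_, ?_⟩
  · rw [contDiff_iff_contDiffAt]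
    intro x
    by_cases hx : x ∈ Metric.ball x₀ r
    · exact χ.contDiffAt.smul (hball x hx)
    · have hx' : x ∉ tsupport χ := by
        rw [χ.tsupport_eq]
        intro h
        exact hx (Metric.closedBall_subset_ball (by change r / 2 < r; linarith) h)
      have h0 : (fun x => χ x • v x) =ᶠ[𝓝 x] fun _ => 0 := by
        filter_upwards [notMem_tsupport_iff_eventuallyEq.1 hx'] with y hy
        simp [hy]
      exact contDiffAt_const.congr_of_eventuallyEq h0
  · filter_upwards [χ.eventuallyEq_one] with x hx
    simp [hx]

/-- A `C^1` vector field on a finite-dimensional space has, near each point, a local flow which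
is `C^1` in the initial condition and stays in a prescribed neighbourhood. -/
theorem ContDiffAt.exists_localFlow [FiniteDimensional ℝ E] {v : E → E} {x₀ : E}
    (hv : ContDiffAt ℝ 1 v x₀) {W : Set E} (hW : W ∈ 𝓝 x₀) :
    ∃ ε > 0, ∃ U ∈ 𝓝 x₀, ∃ α : E → ℝ → E,
      (∀ x ∈ U, α x 0 = x ∧ ∀ r ∈ Ioo (-ε) ε, α x r ∈ W ∧ HasDerivAt (α x) (v (α x r)) r) ∧
      ∀ r, ∀ x ∈ U, ContDiffAt ℝ 1 (fun x => α x r) x := by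
  obtain ⟨w, hw, hwv⟩ := exists_contDiff_eventuallyEq hv
  let X := C(Icc (-1 : ℝ) 1, E)
  let J := primitiveCLM E
  let N : X → X := fun η => (⟨w, hw.continuous⟩ : C(E, E)).comp η
  have hN : ContDiff ℝ 1 N := ContinuousMap.contDiff_one_postcomp hw
  -- Rescaling time to [-1,1] turns c' = w(c), c(0) = x into η = x + ε·J(N η). So the curve with
  -- initial value x is the preimage of (ε, const x) under T, and carrying ε along as a variable
  -- lets T be inverted near ε = 0.
  let T : ℝ × X → ℝ × X := fun p => (p.1, p.2 - p.1 • J (N p.2))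
  have hT : ContDiff ℝ 1 T :=
    contDiff_fst.prodMk (contDiff_snd.sub
      (contDiff_fst.smul (J.contDiff.comp (hN.comp contDiff_snd))))
  let c₀ : X := ContinuousMap.const _ x₀
  let y := J (N c₀)
  -- At ε = 0 the derivative of N is multiplied by 0, so the derivative of T is a shear and is
  -- invertible whatever the field.
  let e : (ℝ × X) ≃L[ℝ] (ℝ × X) :=
    ContinuousLinearEquiv.equivOfInverse
      ((ContinuousLinearMap.fst ℝ ℝ X).prod
        (ContinuousLinearMap.snd ℝ ℝ X - (ContinuousLinearMap.fst ℝ ℝ X).smulRight y))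
      ((ContinuousLinearMap.fst ℝ ℝ X).prod
        (ContinuousLinearMap.snd ℝ ℝ X + (ContinuousLinearMap.fst ℝ ℝ X).smulRight y))
      (fun p => by ext1 <;> simp) (fun p => by ext1 <;> simp)
  have hTd : HasFDerivAt T (e : (ℝ × X) →L[ℝ] (ℝ × X)) (0, c₀) := by
    have hNd : HasFDerivAt N (fderiv ℝ N c₀) ((0, c₀) : ℝ × X).2 :=
      ((hN.differentiable (by norm_num)) c₀).hasFDerivAt
    have h1 : HasFDerivAt (fun p : ℝ × X => J (N p.2))
        (J.comp ((fderiv ℝ N c₀).comp (ContinuousLinearMap.snd ℝ ℝ X))) (0, c₀) :=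
      J.hasFDerivAt.comp ((0, c₀) : ℝ × X) (hNd.comp ((0, c₀) : ℝ × X) hasFDerivAt_snd)
    have h2 := (hasFDerivAt_fst (𝕜 := ℝ) (p := ((0, c₀) : ℝ × X))).prodMk
      ((hasFDerivAt_snd (𝕜 := ℝ) (p := ((0, c₀) : ℝ × X))).sub
        ((hasFDerivAt_fst (𝕜 := ℝ) (p := ((0, c₀) : ℝ × X))).smul h1))
    refine h2.congr_fderiv ?_
    ext1 <;> ext1 <;> simp [e, y]
  have hTc : ContDiffAt ℝ 1 T (0, c₀) := hT.contDiffAt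
  let S := hTc.localInverse hTd (by norm_num)
  have hT0 : T (0, c₀) = (0, c₀) := by simp [T]
  have hS : ContDiffAt ℝ 1 S (0, c₀) := by
    have := hTc.to_localInverse hTd (by norm_num)
    rwa [hT0] at this
  have hS0 : S (0, c₀) = (0, c₀) := by
    have := hTc.localInverse_apply_image hTd (by norm_num)
    rwa [hT0] at this
  have hright : ∀ᶠ q in 𝓝 ((0, c₀) : ℝ × X), T (S q) = q := by
    have := hTc.hasStrictFDerivAt' hTd (by norm_num) |>.eventually_right_inverse
    rwa [hT0] at this
  have hSW : ∀ᶠ q in 𝓝 ((0, c₀) : ℝ × X), ∀ t, (S q).2 t ∈ W ∧ w ((S q).2 t) = v ((S q).2 t) := by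
    obtain ⟨δ, hδ, hball⟩ := Metric.mem_nhds_iff.1 (inter_mem hW hwv)
    have h1 : ContinuousAt (fun q => (S q).2) (0, c₀) := hS.continuousAt.snd
    have h2 := h1 (Metric.ball_mem_nhds _ hδ)
    filter_upwards [h2] with q hq t
    rw [mem_preimage, hS0] at hq
    have hm : (S q).2 t ∈ Metric.ball x₀ δ :=
      lt_of_le_of_lt (ContinuousMap.dist_apply_le_dist (g := c₀) t) hq
    exact hball hm
  have hι : Continuous fun p : ℝ × E => ((p.1, ContinuousMap.const _ p.2) : ℝ × X) :=
    continuous_fst.prodMk (ContinuousMap.continuous_const'.comp continuous_snd)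
  have hev : ∀ᶠ p in 𝓝 ((0, x₀) : ℝ × E),
      T (S (p.1, ContinuousMap.const _ p.2)) = (p.1, ContinuousMap.const _ p.2) ∧
      (∀ t, (S (p.1, ContinuousMap.const _ p.2)).2 t ∈ W ∧
        w ((S (p.1, ContinuousMap.const _ p.2)).2 t) =
          v ((S (p.1, ContinuousMap.const _ p.2)).2 t)) ∧
      ContDiffAt ℝ 1 S (p.1, ContinuousMap.const _ p.2) :=
    (hι.tendsto ((0, x₀) : ℝ × E)).eventually
      (hright.and (hSW.and (hS.eventually (by simp))))
  rw [nhds_prod_eq] at hev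
  obtain ⟨P, hP, Q, hQ, hPQ⟩ := Filter.eventually_prod_iff.1 hev
  obtain ⟨δ, hδ, hball⟩ := Metric.eventually_nhds_iff_ball.1 hP
  let ε := δ / 2
  have hε : 0 < ε := by positivity
  have hεP : P ε := hball ε (by
    rw [Metric.mem_ball, Real.dist_eq, sub_zero, abs_of_pos hε]
    exact half_lt_self hδ)
  -- Time is scaled back with one fixed ε. Beyond |r| = ε the projection freezes the curve, and
  -- nothing is claimed there about the differential equation.
  let α : E → ℝ → E := fun x r =>
    (S (ε, ContinuousMap.const _ x)).2 (projIcc (-1) 1 (by norm_num) (r / ε))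
  refine ⟨ε, hε, {x | Q x}, hQ, α, fun x hx => ?_, fun r x hx => ?_⟩
  · obtain ⟨h1, h2, -⟩ := hPQ hεP hx
    dsimp only at h1 h2
    set q := S (ε, ContinuousMap.const _ x) with hq
    have hfst : q.1 = ε := congrArg Prod.fst h1
    have heq : ∀ t : Icc (-1 : ℝ) 1,
        q.2 t = x + ε • ∫ τ in (0 : ℝ)..t, v (q.2 (projIcc (-1) 1 (by norm_num) τ)) := by
      intro t
      have h3 : q.2 - q.1 • J (N q.2) = ContinuousMap.const _ x := congrArg Prod.snd h1
      have h4 := DFunLike.congr_fun h3 t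
      rw [hfst] at h4
      have h5 : q.2 t - ε • J (N q.2) t = x := h4
      have h6 : J (N q.2) t = ∫ τ in (0 : ℝ)..t, v (q.2 (projIcc (-1) 1 (by norm_num) τ)) :=
        intervalIntegral.integral_congr fun τ _ => (h2 _).2
      rw [← h6]
      exact sub_eq_iff_eq_add.1 h5
    have hcont : Continuous fun τ : ℝ => v (q.2 (projIcc (-1 : ℝ) 1 (by norm_num) τ)) := by
      simp only [← (h2 _).2]
      exact hw.continuous.comp (q.2.continuous.comp continuous_projIcc)
    have hα : ∀ r ∈ Icc (-ε) ε, α x r =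
        x + ε • ∫ τ in (0 : ℝ)..(r / ε), v (q.2 (projIcc (-1) 1 (by norm_num) τ)) := by
      intro r hr
      have hr' : r / ε ∈ Icc (-1 : ℝ) 1 :=
        ⟨by rw [le_div_iff₀ hε]; linarith [hr.1], by rw [div_le_iff₀ hε]; linarith [hr.2]⟩
      change q.2 _ = _
      rw [heq, projIcc_of_mem _ hr']
    refine ⟨?_, fun r hr => ⟨(h2 _).1, ?_⟩⟩
    · rw [hα 0 ⟨by linarith, hε.le⟩]
      simp
    · have hd : HasDerivAt (fun r : ℝ => x + ε • ∫ τ in (0 : ℝ)..(r / ε),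
          v (q.2 (projIcc (-1) 1 (by norm_num) τ))) (ε • ((1 / ε) • v (α x r))) r := by
        refine HasDerivAt.const_add x (HasDerivAt.const_smul ε ?_)
        exact HasDerivAt.scomp r
          (intervalIntegral.integral_hasDerivAt_right (hcont.intervalIntegrable _ _)
            (hcont.stronglyMeasurableAtFilter _ _) hcont.continuousAt)
          ((hasDerivAt_id r).div_const ε)
      rw [smul_smul, mul_one_div_cancel hε.ne', one_smul] at hd
      refine hd.congr_of_eventuallyEq ?_
      filter_upwards [Icc_mem_nhds hr.1 hr.2] with s hs using hα s hs
  · obtain ⟨-, -, h3⟩ := hPQ hεP hx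
    have h4 : ContDiff ℝ 1 fun x : E => ((ε, ContinuousMap.const _ x) : ℝ × X) :=
      contDiff_const.prodMk (ContinuousLinearMap.contDiff
        { toFun := fun x : E => (ContinuousMap.const (Icc (-1 : ℝ) 1) x : X)
          map_add' := fun _ _ => rfl
          map_smul' := fun _ _ => rfl
          cont := ContinuousMap.continuous_const' })
    have h5 : ContDiffAt ℝ 1 (fun x => (S (ε, ContinuousMap.const _ x)).2) x :=
      (h3.comp x h4.contDiffAt).snd
    exact (ContinuousMap.evalCLM ℝ _).contDiff.contDiffAt.comp x h5

end LocalFlow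

/-! ## The flow of a `C^1` vector field on a compact manifold -/

section ManifoldFlow

variable {E : Type*} [NormedAddCommGroup E] [NormedSpace ℝ E]
variable {M : Type*} [TopologicalSpace M] [ChartedSpace E M] [IsManifold 𝓘(ℝ, E) ∞ M]

/-- The second component of a vector field read in the chart at `x₀`. -/
noncomputable def vectorFieldInChart (Y : (x : M) → TangentSpace 𝓘(ℝ, E) x) (x₀ : M) (z : E) : E :=
  ((extChartAt 𝓘(ℝ, E).tangent (⟨x₀, Y x₀⟩ : TangentBundle 𝓘(ℝ, E) M))
    ((fun x : M => (⟨x, Y x⟩ : TangentBundle 𝓘(ℝ, E) M)) ((extChartAt 𝓘(ℝ, E) x₀).symm z))).2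

theorem contDiffAt_vectorFieldInChart {Y : (x : M) → TangentSpace 𝓘(ℝ, E) x}
    (hY : ContMDiff 𝓘(ℝ, E) 𝓘(ℝ, E).tangent 1
      (fun x : M => (⟨x, Y x⟩ : TangentBundle 𝓘(ℝ, E) M))) (x₀ : M) :
    ContDiffAt ℝ 1 (vectorFieldInChart Y x₀) (extChartAt 𝓘(ℝ, E) x₀ x₀) := by
  have h := (contMDiffAt_iff.1 (hY.contMDiffAt (x := x₀))).2
  exact (h.contDiffAt (by simp)).snd

/-- A curve in the chart solving the differential equation of the vector field read in the chart
comes from an integral curve. -/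
theorem hasMFDerivAt_symm_comp_of_hasDerivAt {Y : (x : M) → TangentSpace 𝓘(ℝ, E) x} {x₀ : M}
    {c : ℝ → E} {t : ℝ} (ht : c t ∈ (extChartAt 𝓘(ℝ, E) x₀).target)
    (hc : HasDerivAt c (vectorFieldInChart Y x₀ (c t)) t) :
    HasMFDerivAt 𝓘(ℝ, ℝ) 𝓘(ℝ, E) (fun s => (extChartAt 𝓘(ℝ, E) x₀).symm (c s)) t
      ((1 : ℝ →L[ℝ] ℝ).smulRight (Y ((extChartAt 𝓘(ℝ, E) x₀).symm (c t)))) := by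
  let xₜ : M := (extChartAt 𝓘(ℝ, E) x₀).symm (c t)
  obtain ⟨v, hv⟩ : ∃ v : E, v = Y xₜ := ⟨_, rfl⟩
  have h : HasDerivAt c (tangentCoordChange 𝓘(ℝ, E) xₜ x₀ xₜ v) t := by
    rw [hv]
    exact hc
  have hft1 := mem_preimage.mp <|
    mem_of_mem_of_subset ht (extChartAt 𝓘(ℝ, E) x₀).target_subset_preimage_source
  have hft2 := mem_extChartAt_source (I := 𝓘(ℝ, E)) xₜ
  -- The manifold derivative at time t is read in the chart at the moving point xₜ; the chart change
  -- cancels the one hidden in the local expression of Y.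
  have key : HasDerivAt ((extChartAt 𝓘(ℝ, E) xₜ ∘ (extChartAt 𝓘(ℝ, E) x₀).symm) ∘ c) v t := by
    rw [← tangentCoordChange_self (I := 𝓘(ℝ, E)) (x := xₜ) (z := xₜ) (v := v) hft2,
      ← tangentCoordChange_comp (x := x₀) ⟨⟨hft2, hft1⟩, hft2⟩]
    apply HasFDerivAt.comp_hasDerivAt _ _ h
    have hd := hasFDerivWithinAt_tangentCoordChange (I := 𝓘(ℝ, E)) ⟨hft1, hft2⟩
    rw [(extChartAt 𝓘(ℝ, E) x₀).right_inv ht] at hd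
    exact hd.hasFDerivAt (by simp)
  rw [hv] at key
  refine ⟨(continuousAt_extChartAt_symm'' ht).comp h.continuousAt, ?_⟩
  have hL : ContinuousLinearMap.toSpanSingleton ℝ (Y xₜ : E) =
      (1 : ℝ →L[ℝ] ℝ).smulRight (Y xₜ : E) := by
    ext
    simp
  have key' := (key.hasFDerivAt.congr_fderiv hL).hasFDerivWithinAt (s := univ)
  rw [← range_id (α := ℝ)] at key'
  exact key'

/-- The local flow of a `C^1` vector field, together with the integrals of a `C^1` function along
it, is `C^1` in the initial condition. -/
theorem exists_localFlow_of_contMDiff [FiniteDimensional ℝ E]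
    {Y : (x : M) → TangentSpace 𝓘(ℝ, E) x}
    (hY : ContMDiff 𝓘(ℝ, E) 𝓘(ℝ, E).tangent 1
      (fun x : M => (⟨x, Y x⟩ : TangentBundle 𝓘(ℝ, E) M)))
    {h : M → ℝ} (hh : ContMDiff 𝓘(ℝ, E) 𝓘(ℝ, ℝ) 1 h) (x₀ : M) :
    ∃ ε > 0, ∃ U ∈ 𝓝 x₀, ∃ (γ : M → ℝ → M) (θ : M → ℝ → ℝ), ∀ x ∈ U,
      γ x 0 = x ∧ θ x 0 = 0 ∧ ∀ r ∈ Ioo (-ε) ε,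
        HasMFDerivAt 𝓘(ℝ, ℝ) 𝓘(ℝ, E) (γ x) r ((1 : ℝ →L[ℝ] ℝ).smulRight (Y (γ x r))) ∧
        HasDerivAt (θ x) (h (γ x r)) r ∧
        ContMDiffAt 𝓘(ℝ, E) 𝓘(ℝ, E) 1 (fun y => γ y r) x ∧
        ContMDiffAt 𝓘(ℝ, E) 𝓘(ℝ, ℝ) 1 (fun y => θ y r) x := by
  set ch := extChartAt 𝓘(ℝ, E) x₀ with hch
  let z₀ := ch x₀
  have htgt : ch.target ∈ 𝓝 z₀ := extChartAt_target_mem_nhds x₀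
  have hsymm : ContMDiffOn 𝓘(ℝ, E) 𝓘(ℝ, E) 1 ch.symm ch.target :=
    contMDiffOn_extChartAt_symm x₀
  have hopen : IsOpen ch.target := isOpen_extChartAt_target x₀
  -- Adding a coordinate with velocity h makes the integral of h along the orbit part of the flow of
  -- a single C^1 field, so both get their regularity from the same result.
  let v : E × ℝ → E × ℝ := fun p => (vectorFieldInChart Y x₀ p.1, h (ch.symm p.1))
  have hv : ContDiffAt ℝ 1 v (z₀, 0) := by
    refine ContDiffAt.prodMk ?_ ?_
    · exact ContDiffAt.comp (g := vectorFieldInChart Y x₀) (f := Prod.fst) (z₀, (0 : ℝ))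
        (contDiffAt_vectorFieldInChart hY x₀) contDiffAt_fst
    · have h1 : ContDiffAt ℝ 1 (fun z => h (ch.symm z)) z₀ :=
        (hh.contMDiffAt.comp z₀ (hsymm.contMDiffAt htgt)).contDiffAt
      exact ContDiffAt.comp (g := fun z => h (ch.symm z)) (f := Prod.fst) (z₀, (0 : ℝ))
        h1 contDiffAt_fst
  have hW : Prod.fst ⁻¹' ch.target ∈ 𝓝 ((z₀, 0) : E × ℝ) := continuousAt_fst htgt
  obtain ⟨ε, hε, U, hU, α, hα, hαC⟩ := hv.exists_localFlow hW
  have hι : ContinuousAt (fun x => ((ch x, 0) : E × ℝ)) x₀ :=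
    (continuousAt_extChartAt x₀).prodMk continuousAt_const
  refine ⟨ε, hε, (fun x => ((ch x, 0) : E × ℝ)) ⁻¹' U ∩ ch.source,
    inter_mem (hι hU) (extChartAt_source_mem_nhds x₀),
    fun x r => ch.symm (α (ch x, 0) r).1, fun x r => (α (ch x, 0) r).2, ?_⟩
  rintro x ⟨hxU, hxs⟩
  obtain ⟨h0, hr⟩ := hα _ hxU
  dsimp only at h0 hr
  refine ⟨?_, ?_, fun r hrε => ?_⟩
  · dsimp only
    rw [h0]
    exact ch.left_inv hxs
  · dsimp only
    rw [h0]
  · obtain ⟨hm, hd⟩ := hr r hrε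
    have hc : ContMDiffAt 𝓘(ℝ, E) 𝓘(ℝ, E × ℝ) 1 (fun y => α (ch y, 0) r) x := by
      have h1 : ContMDiffAt 𝓘(ℝ, E) 𝓘(ℝ, E × ℝ) 1 (fun y => ((ch y, 0) : E × ℝ)) x := by
        have h2 : ContMDiffAt 𝓘(ℝ, E) 𝓘(ℝ, E) 1 ch x :=
          contMDiffAt_extChartAt' (by simpa [hch] using hxs)
        exact h2.prodMk_space contMDiffAt_const
      exact (hαC r _ hxU).contMDiffAt.comp x h1
    refine ⟨hasMFDerivAt_symm_comp_of_hasDerivAt hm ?_, ?_, ?_, ?_⟩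
    · exact (hasFDerivAt_fst.comp_hasDerivAt r hd :)
    · exact (hasFDerivAt_snd.comp_hasDerivAt r hd :)
    · have h1 : ContMDiffAt 𝓘(ℝ, E) 𝓘(ℝ, E) 1 (fun y => (α (ch y, 0) r).1) x :=
        contDiff_fst.contMDiff.contMDiffAt.comp x hc
      exact (hsymm.contMDiffAt (hopen.mem_nhds hm)).comp x h1
    · exact contDiff_snd.contMDiff.contMDiffAt.comp x hc

/-- A `C^1` vector field `Y` on a compact manifold has a global flow `Φ`, which is `C^1` in the
initial condition, and so are the integrals `w` of a `C^1` function along the flow. -/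
theorem exists_globalFlow_of_contMDiff [FiniteDimensional ℝ E] [T2Space M] [CompactSpace M]
    {Y : (x : M) → TangentSpace 𝓘(ℝ, E) x}
    (hY : ContMDiff 𝓘(ℝ, E) 𝓘(ℝ, E).tangent 1
      (fun x : M => (⟨x, Y x⟩ : TangentBundle 𝓘(ℝ, E) M)))
    {h : M → ℝ} (hh : ContMDiff 𝓘(ℝ, E) 𝓘(ℝ, ℝ) 1 h) :
    ∃ (Φ : ℝ → M → M) (w : ℝ → M → ℝ),
      (∀ x, Φ 0 x = x) ∧ (∀ x, w 0 x = 0) ∧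
      (∀ r s x, Φ (r + s) x = Φ r (Φ s x)) ∧ (∀ r s x, w (r + s) x = w s x + w r (Φ s x)) ∧
      (∀ x, IsMIntegralCurve (fun r => Φ r x) Y) ∧
      (∀ r x, HasDerivAt (fun r => w r x) (h (Φ r x)) r) ∧
      (∀ r, ContMDiff 𝓘(ℝ, E) 𝓘(ℝ, E) 1 (Φ r)) ∧
      (∀ r, ContMDiff 𝓘(ℝ, E) 𝓘(ℝ, ℝ) 1 (w r)) := by
  choose ε hε U hU γ θ hloc using exists_localFlow_of_contMDiff hY hh
  obtain ⟨F, hF⟩ : ∃ F : Finset M, ⋃ x ∈ F, interior (U x) = univ := by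
    obtain ⟨F, -, hF⟩ := isCompact_univ.elim_nhds_subcover (fun x => interior (U x))
      fun x _ => interior_mem_nhds.2 (hU x)
    exact ⟨F, univ_subset_iff.1 hF⟩
  -- A finite cover gives one existence time for all initial points, and this is what makes integral
  -- curves global.
  obtain ⟨δ, hδ, hδF⟩ : ∃ δ > 0, ∀ x ∈ F, δ ≤ ε x := by
    rcases F.eq_empty_or_nonempty with rfl | hne
    · exact ⟨1, one_pos, by simp⟩
    · exact ⟨F.inf' hne ε, (Finset.lt_inf'_iff hne).2 fun x _ => hε x, fun x hx =>
        Finset.inf'_le _ hx⟩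
  have hcov : ∀ x, ∃ y ∈ F, U y ∈ 𝓝 x := fun x => by
    have : x ∈ ⋃ y ∈ F, interior (U y) := hF ▸ mem_univ x
    simpa [mem_interior_iff_mem_nhds] using this
  have hex : ∀ x, ∃ c : ℝ → M, c 0 = x ∧ IsMIntegralCurve c Y := by
    refine exists_isMIntegralCurve_of_isMIntegralCurveOn hY hδ fun x => ?_
    obtain ⟨y, hy, hxy⟩ := hcov x
    obtain ⟨h0, -, hr⟩ := hloc y x (mem_of_mem_nhds hxy)
    exact ⟨γ y x, h0, fun r hr' => ((hr r ⟨by linarith [hr'.1, hδF y hy],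
      hr'.2.trans_le (hδF y hy)⟩).1).hasMFDerivWithinAt⟩
  choose c hc0 hc using hex
  let Φ : ℝ → M → M := fun r x => c x r
  have hΦadd : ∀ r s x, Φ (r + s) x = Φ r (Φ s x) := by
    intro r s x
    have h1 : IsMIntegralCurve (c x ∘ (· + s)) Y := (hc x).comp_add s
    have h2 := isMIntegralCurve_Ioo_eq_of_contMDiff_boundaryless (t₀ := 0) hY h1 (hc (c x s))
      (by simp [hc0])
    exact congrFun h2 r
  have hcont : ∀ x, Continuous fun r => h (Φ r x) := fun x => hh.continuous.comp (hc x).continuous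
  let w : ℝ → M → ℝ := fun r x => ∫ s in (0 : ℝ)..r, h (Φ s x)
  have hw : ∀ r x, HasDerivAt (fun r => w r x) (h (Φ r x)) r := fun r x =>
    intervalIntegral.integral_hasDerivAt_right ((hcont x).intervalIntegrable _ _)
      ((hcont x).stronglyMeasurableAtFilter _ _) (hcont x).continuousAt
  have hwadd : ∀ r s x, w (r + s) x = w s x + w r (Φ s x) := by
    intro r s x
    have h1 : w r (Φ s x) = ∫ u in s..(r + s), h (Φ u x) := by
      have : w r (Φ s x) = ∫ u in (0 : ℝ)..r, h (Φ (u + s) x) := by simp only [w, hΦadd]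
      rw [this, intervalIntegral.integral_comp_add_right (fun u => h (Φ u x)) s, zero_add]
    rw [h1]
    exact (intervalIntegral.integral_add_adjacent_intervals ((hcont x).intervalIntegrable _ _)
      ((hcont x).intervalIntegrable _ _)).symm
  -- Uniqueness of integral curves identifies the global flow with the local ones for short times,
  -- so the C^1 dependence passes to Φ and w.
  have heq : ∀ y ∈ F, ∀ x ∈ U y, ∀ r ∈ Ioo (-δ) δ, Φ r x = γ y x r ∧ w r x = θ y x r := by
    intro y hy x hx
    obtain ⟨h0, h0', hr⟩ := hloc y x hx
    have hsub : Ioo (-δ) δ ⊆ Ioo (-ε y) (ε y) :=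
      Ioo_subset_Ioo (neg_le_neg (hδF y hy)) (hδF y hy)
    have hm0 : (0 : ℝ) ∈ Ioo (-δ) δ := ⟨by linarith, hδ⟩
    have h1 : EqOn (c x) (γ y x) (Ioo (-δ) δ) :=
      isMIntegralCurveOn_Ioo_eqOn_of_contMDiff_boundaryless hm0 hY
        ((hc x).isMIntegralCurveOn _) (fun r hr' => (hr r (hsub hr')).1.hasMFDerivWithinAt)
        (by rw [hc0, h0])
    refine fun r hr' => ⟨h1 hr', ?_⟩
    have h2 := (isOpen_Ioo (a := -δ) (b := δ)).eqOn_of_deriv_eq isPreconnected_Ioo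
      (f := fun r => w r x) (g := θ y x)
      (fun s _ => (hw s x).differentiableAt.differentiableWithinAt)
      (fun s hs => (hr s (hsub hs)).2.1.differentiableAt.differentiableWithinAt)
      (fun s hs => by
        rw [(hw s x).deriv, (hr s (hsub hs)).2.1.deriv]
        exact congrArg h (h1 hs)) hm0 (by simp [w, h0'])
    exact h2 hr'
  have hsmall : ∀ r ∈ Ioo (-δ) δ, ContMDiff 𝓘(ℝ, E) 𝓘(ℝ, E) 1 (Φ r) ∧
      ContMDiff 𝓘(ℝ, E) 𝓘(ℝ, ℝ) 1 (w r) := by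
    intro r hr
    have key : ∀ x, ContMDiffAt 𝓘(ℝ, E) 𝓘(ℝ, E) 1 (Φ r) x ∧
        ContMDiffAt 𝓘(ℝ, E) 𝓘(ℝ, ℝ) 1 (w r) x := by
      intro x
      obtain ⟨y, hy, hxy⟩ := hcov x
      obtain ⟨-, -, h1⟩ := hloc y x (mem_of_mem_nhds hxy)
      obtain ⟨-, -, h2, h3⟩ := h1 r ⟨by linarith [hr.1, hδF y hy], hr.2.trans_le (hδF y hy)⟩
      refine ⟨h2.congr_of_eventuallyEq ?_, h3.congr_of_eventuallyEq ?_⟩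
      · filter_upwards [hxy] with z hz using (heq y hy z hz r hr).1
      · filter_upwards [hxy] with z hz using (heq y hy z hz r hr).2
    exact ⟨fun x => (key x).1, fun x => (key x).2⟩
  -- An arbitrary time is n times a short one, and the flow and cocycle laws propagate the
  -- regularity.
  have hall : ∀ (n : ℕ), ∀ r ∈ Ioo (-δ) δ, ContMDiff 𝓘(ℝ, E) 𝓘(ℝ, E) 1 (Φ (n * r)) ∧
      ContMDiff 𝓘(ℝ, E) 𝓘(ℝ, ℝ) 1 (w (n * r)) := by
    intro n r hr
    induction n with
    | zero => simpa using hsmall 0 ⟨by linarith, hδ⟩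
    | succ n ih =>
      have h1 : ((n + 1 : ℕ) : ℝ) * r = n * r + r := by push_cast; ring
      have h2 : Φ (n * r + r) = Φ (n * r) ∘ Φ r := funext fun x => hΦadd _ _ x
      have h3 : w (n * r + r) = fun x => w r x + w (n * r) (Φ r x) := funext fun x => hwadd _ _ x
      rw [h1, h2, h3]
      exact ⟨ih.1.comp (hsmall r hr).1, (hsmall r hr).2.add (ih.2.comp (hsmall r hr).1)⟩
  have hfin : ∀ r, ContMDiff 𝓘(ℝ, E) 𝓘(ℝ, E) 1 (Φ r) ∧ ContMDiff 𝓘(ℝ, E) 𝓘(ℝ, ℝ) 1 (w r) := by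
    intro r
    obtain ⟨n, hn⟩ := exists_nat_gt (|r| / δ)
    have hn0 : (0 : ℝ) < n := lt_of_le_of_lt (by positivity) hn
    have h1 : r / n ∈ Ioo (-δ) δ := by
      rw [mem_Ioo, ← abs_lt, abs_div, abs_of_pos hn0, div_lt_iff₀ hn0]
      rwa [div_lt_iff₀ hδ, mul_comm] at hn
    have := hall n _ h1
    rwa [mul_div_cancel₀ _ hn0.ne'] at this
  exact ⟨Φ, w, hc0, fun x => by simp [w], hΦadd, hwadd, hc, hw, fun r => (hfin r).1,
    fun r => (hfin r).2⟩

end ManifoldFlow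

/-! ## Velocities of curves and derivatives of functions -/

section Velocity

variable {E : Type*} [NormedAddCommGroup E] [NormedSpace ℝ E]
variable {F : Type*} [NormedAddCommGroup F] [NormedSpace ℝ F]
variable {M : Type*} [TopologicalSpace M] [ChartedSpace E M]

/-- The curve `γ` has velocity `v` at time `t`. -/
def HasVelocityAt (γ : ℝ → M) (t : ℝ) (v : E) : Prop :=
  HasMFDerivAt 𝓘(ℝ, ℝ) 𝓘(ℝ, E) γ t ((1 : ℝ →L[ℝ] ℝ).smulRight v : ℝ →L[ℝ] E)

variable (E) in
/-- The derivative of a vector-valued function on a manifold. -/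
noncomputable def dirDeriv (ψ : M → F) (x : M) : E →L[ℝ] F :=
  mfderiv 𝓘(ℝ, E) 𝓘(ℝ, F) ψ x

variable (E) in
/-- The tangent map of a self-map of a manifold at a point. -/
noncomputable def tmap (Φ : M → M) (x : M) : E →L[ℝ] E :=
  mfderiv 𝓘(ℝ, E) 𝓘(ℝ, E) Φ x

variable (E) in
/-- The velocity of a curve. -/
noncomputable def velocity (γ : ℝ → M) (t : ℝ) : E :=
  mfderiv 𝓘(ℝ, ℝ) 𝓘(ℝ, E) γ t (1 : ℝ)

theorem dirDeriv_comp {ψ : M → F} {Φ : M → M} {x : M}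
    (hψ : MDifferentiableAt 𝓘(ℝ, E) 𝓘(ℝ, F) ψ (Φ x))
    (hΦ : MDifferentiableAt 𝓘(ℝ, E) 𝓘(ℝ, E) Φ x) (v : E) :
    dirDeriv E (fun y => ψ (Φ y)) x v = dirDeriv E ψ (Φ x) (tmap E Φ x v) :=
  mfderiv_comp_apply x hψ hΦ v

theorem tmap_comp {Ψ Φ : M → M} {x : M}
    (hΨ : MDifferentiableAt 𝓘(ℝ, E) 𝓘(ℝ, E) Ψ (Φ x))
    (hΦ : MDifferentiableAt 𝓘(ℝ, E) 𝓘(ℝ, E) Φ x) (v : E) :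
    tmap E (fun y => Ψ (Φ y)) x v = tmap E Ψ (Φ x) (tmap E Φ x v) :=
  mfderiv_comp_apply x hΨ hΦ v

theorem tmap_id (x : M) (v : E) : tmap E (id : M → M) x v = v := by
  have : tmap E (id : M → M) x = ContinuousLinearMap.id ℝ E := mfderiv_id
  rw [this]
  rfl

namespace HasVelocityAt

variable {γ : ℝ → M} {t : ℝ} {v w : E}

theorem unique (hv : HasVelocityAt γ t v) (hw : HasVelocityAt γ t w) : v = w := by
  have h : ((1 : ℝ →L[ℝ] ℝ).smulRight v : ℝ →L[ℝ] E) = (1 : ℝ →L[ℝ] ℝ).smulRight w :=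
    hasMFDerivAt_unique hv hw
  have h1 := congrArg (fun L : ℝ →L[ℝ] E => L 1) h
  simpa using h1

theorem hasDerivAt (hv : HasVelocityAt γ t v) {ψ : M → F}
    (hψ : MDifferentiableAt 𝓘(ℝ, E) 𝓘(ℝ, F) ψ (γ t)) :
    HasDerivAt (fun s => ψ (γ s)) (dirDeriv E ψ (γ t) v) t := by
  have h : HasFDerivAt (fun s => ψ (γ s))
      ((dirDeriv E ψ (γ t)).comp ((1 : ℝ →L[ℝ] ℝ).smulRight v)) t :=
    (hψ.hasMFDerivAt.comp t hv).hasFDerivAt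
  simpa using h.hasDerivAt

theorem comp (hv : HasVelocityAt γ t v) {Φ : M → M}
    (hΦ : MDifferentiableAt 𝓘(ℝ, E) 𝓘(ℝ, E) Φ (γ t)) :
    HasVelocityAt (fun s => Φ (γ s)) t (tmap E Φ (γ t) v) := by
  refine HasMFDerivAt.congr_mfderiv (hΦ.hasMFDerivAt.comp t hv) ?_
  change (tmap E Φ (γ t)).comp ((1 : ℝ →L[ℝ] ℝ).smulRight v) = _
  ext
  simp

theorem scomp {κ : ℝ → ℝ} {c : ℝ} (hv : HasVelocityAt γ (κ t) v) (hκ : HasDerivAt κ c t) :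
    HasVelocityAt (fun s => γ (κ s)) t (c • v) := by
  have h : HasMFDerivAt 𝓘(ℝ, ℝ) 𝓘(ℝ, ℝ) κ t (ContinuousLinearMap.toSpanSingleton ℝ c) :=
    hκ.hasFDerivAt.hasMFDerivAt
  refine HasMFDerivAt.congr_mfderiv (HasMFDerivAt.comp t hv h) ?_
  change ((1 : ℝ →L[ℝ] ℝ).smulRight v : ℝ →L[ℝ] E).comp
    (ContinuousLinearMap.toSpanSingleton ℝ c) = _
  ext
  simp

end HasVelocityAt

theorem hasVelocityAt_velocity {γ : ℝ → M} {t : ℝ}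
    (h : MDifferentiableAt 𝓘(ℝ, ℝ) 𝓘(ℝ, E) γ t) : HasVelocityAt γ t (velocity E γ t) := by
  refine HasMFDerivAt.congr_mfderiv h.hasMFDerivAt ?_
  refine ContinuousLinearMap.ext_ring (M₁ := E) ?_
  exact (one_smul ℝ (velocity E γ t)).symm

end Velocity

/-! ## Calculus of `C^1` flows -/

namespace AnosovFlow

section FlowCalculus

variable {E : Type*} [NormedAddCommGroup E] [NormedSpace ℝ E]
variable {F : Type*} [NormedAddCommGroup F] [NormedSpace ℝ F]
variable {M : Type*} [TopologicalSpace M] [ChartedSpace E M]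

variable (E) in
/-- The vector field of a flow, as a function with values in the model space. -/
noncomputable def vel (f : Flow ℝ M) (x : M) : E := vectorField E f x

namespace IsC1Flow

variable {f : Flow ℝ M}

theorem contMDiff_apply (hf : IsC1Flow E f) (t : ℝ) : ContMDiff 𝓘(ℝ, E) 𝓘(ℝ, E) 1 (f t) :=
  ContMDiff.comp (I' := 𝓘(ℝ, ℝ).prod 𝓘(ℝ, E)) (g := fun p : ℝ × M => f p.1 p.2) hf
    (contMDiff_const.prodMk contMDiff_id)

theorem mdifferentiableAt (hf : IsC1Flow E f) (t : ℝ) (x : M) :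
    MDifferentiableAt 𝓘(ℝ, E) 𝓘(ℝ, E) (f t) x :=
  (hf.contMDiff_apply t).mdifferentiable (by norm_num) x

theorem contMDiff_orbit (hf : IsC1Flow E f) (x : M) :
    ContMDiff 𝓘(ℝ, ℝ) 𝓘(ℝ, E) 1 (fun t => f t x) :=
  ContMDiff.comp (I' := 𝓘(ℝ, ℝ).prod 𝓘(ℝ, E)) (g := fun p : ℝ × M => f p.1 p.2) hf
    (contMDiff_id.prodMk contMDiff_const)

theorem hasVelocityAt_zero (hf : IsC1Flow E f) (x : M) :
    HasVelocityAt (fun t => f t x) 0 (vel E f x) :=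
  hasVelocityAt_velocity ((hf.contMDiff_orbit x).mdifferentiable (by norm_num) 0)

theorem hasVelocityAt (hf : IsC1Flow E f) (x : M) (t : ℝ) :
    HasVelocityAt (fun t => f t x) t (vel E f (f t x)) := by
  have h0 : HasVelocityAt (fun s => f s (f t x)) (t - t) (vel E f (f t x)) := by
    rw [sub_self]
    exact hf.hasVelocityAt_zero (f t x)
  have h := HasVelocityAt.scomp (κ := fun s => s - t) h0 ((hasDerivAt_id t).sub_const t)
  have h1 : (fun s => f (s - t) (f t x)) = fun s => f s x := by
    ext s
    rw [← f.map_add, sub_add_cancel]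
  rw [one_smul] at h
  exact h1 ▸ h

/-- The velocity of a curve of the form `r ↦ f (q r) (γ r)`. -/
theorem hasVelocityAt_comp (hf : IsC1Flow E f) {γ : ℝ → M} {q : ℝ → ℝ} {c t : ℝ} {v : E}
    (hq : HasDerivAt q c t) (hγ : HasVelocityAt γ t v) :
    HasVelocityAt (fun r => f (q r) (γ r)) t
      (c • vel E f (f (q t) (γ t)) + tmap E (f (q t)) (γ t) v) := by
  have hP : MDifferentiableAt (𝓘(ℝ, ℝ).prod 𝓘(ℝ, E)) 𝓘(ℝ, E) (fun p : ℝ × M => f p.1 p.2)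
      (q t, γ t) := ContMDiff.mdifferentiable hf (by norm_num) _
  have hq' : HasMFDerivAt 𝓘(ℝ, ℝ) 𝓘(ℝ, ℝ) q t (ContinuousLinearMap.toSpanSingleton ℝ c) :=
    hq.hasFDerivAt.hasMFDerivAt
  have h := hP.hasMFDerivAt.comp t (hq'.prodMk hγ)
  refine HasMFDerivAt.congr_mfderiv h ?_
  rw [mfderiv_prod_eq_add_comp hP]
  refine ContinuousLinearMap.ext_ring (M₁ := E) ?_
  let L : ℝ →L[ℝ] E := mfderiv 𝓘(ℝ, ℝ) 𝓘(ℝ, E) (fun s => f s (γ t)) (q t)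
  have h1 : L 1 = vel E f (f (q t) (γ t)) :=
    (hasVelocityAt_velocity ((hf.contMDiff_orbit (γ t)).mdifferentiable (by norm_num) (q t))).unique
      (hf.hasVelocityAt (γ t) (q t))
  have h2 : L ((1 : ℝ) • c) + tmap E (f (q t)) (γ t) ((1 : ℝ) • v) =
      (1 : ℝ) • (c • vel E f (f (q t) (γ t)) + tmap E (f (q t)) (γ t) v) := by
    rw [one_smul, one_smul, one_smul, ← h1, ← map_smul, smul_eq_mul, mul_one]
  exact h2

theorem hasDerivAt_comp (hf : IsC1Flow E f) {ψ : M → F} (hψ : ContMDiff 𝓘(ℝ, E) 𝓘(ℝ, F) 1 ψ)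
    (x : M) (t : ℝ) :
    HasDerivAt (fun s => ψ (f s x)) (dirDeriv E ψ (f t x) (vel E f (f t x))) t :=
  (hf.hasVelocityAt x t).hasDerivAt (hψ.mdifferentiable (by norm_num) _)

theorem flowDeriv_eq (hf : IsC1Flow E f) {ψ : M → F} (hψ : ContMDiff 𝓘(ℝ, E) 𝓘(ℝ, F) 1 ψ)
    (x : M) : flowDeriv f ψ x = dirDeriv E ψ x (vel E f x) := by
  have h := (hf.hasDerivAt_comp hψ x 0).deriv
  rwa [f.map_zero_apply] at h

/-- If `Φ (f s x) = g (κ s) (Φ x)`, then `Φ` maps the vector field of `f` at `x` to `κ'(0)` times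
the vector field of `g`. -/
theorem tmap_vel (hf : IsC1Flow E f) {g : Flow ℝ M} (hg : IsC1Flow E g) {Φ : M → M} {x : M}
    (hΦ : MDifferentiableAt 𝓘(ℝ, E) 𝓘(ℝ, E) Φ x) {κ : ℝ → ℝ} {c : ℝ} (hκ0 : κ 0 = 0)
    (hκ : HasDerivAt κ c 0) (h : ∀ s, Φ (f s x) = g (κ s) (Φ x)) :
    tmap E Φ x (vel E f x) = c • vel E g (Φ x) := by
  have h1 : HasVelocityAt (fun s => Φ (f s x)) 0 (tmap E Φ (f 0 x) (vel E f x)) :=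
    (hf.hasVelocityAt_zero x).comp (by rwa [f.map_zero_apply])
  have h2 : HasVelocityAt (fun s => g (κ s) (Φ x)) 0 (c • vel E g (Φ x)) := by
    have h3 : HasVelocityAt (fun s => g s (Φ x)) (κ 0) (vel E g (Φ x)) := by
      rw [hκ0]
      exact hg.hasVelocityAt_zero _
    exact h3.scomp hκ
  rw [f.map_zero_apply] at h1
  simp only [h] at h1
  exact h1.unique h2

theorem tmap_vel_self (hf : IsC1Flow E f) (t : ℝ) (x : M) :
    tmap E (f t) x (vel E f x) = vel E f (f t x) := by
  have := hf.tmap_vel hf (hf.mdifferentiableAt t x) (κ := id) rfl (hasDerivAt_id 0)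
    (fun s => by rw [id, ← f.map_add, ← f.map_add, add_comm])
  rwa [one_smul] at this

end IsC1Flow

end FlowCalculus

end AnosovFlow

/-! ## Integrals depending on a parameter -/

section ParametricIntegral

variable {E : Type*} [NormedAddCommGroup E] [NormedSpace ℝ E] [FiniteDimensional ℝ E]

theorem hasFDerivAt_intervalIntegral_of_contDiff {G : ℝ → E → ℝ}
    (hG : ContDiff ℝ 1 (fun p : ℝ × E => G p.1 p.2)) (a b : ℝ) (z : E) :
    HasFDerivAt (fun z => ∫ s in a..b, G s z) (∫ s in a..b, fderiv ℝ (G s) z) z := by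
  have hd : ∀ s z, HasFDerivAt (G s) (fderiv ℝ (G s) z) z := fun s z =>
    ((hG.comp (contDiff_const.prodMk contDiff_id)).differentiable (by norm_num) z).hasFDerivAt
  have hc : Continuous fun p : ℝ × E => fderiv ℝ (G p.1) p.2 :=
    Continuous.fderiv_one (f := fun (p : ℝ × E) y => G p.1 y) (g := Prod.snd)
      (hG.comp ((contDiff_fst.comp contDiff_fst).prodMk contDiff_snd)) continuous_snd
  obtain ⟨C, hC⟩ := (isCompact_uIcc (a := a) (b := b)).prod (isCompact_closedBall z 1)
    |>.exists_bound_of_continuousOn hc.continuousOn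
  refine intervalIntegral.hasFDerivAt_integral_of_dominated_of_fderiv_le
    (bound := fun _ => C) (F := fun z s => G s z) (F' := fun z s => fderiv ℝ (G s) z)
    (Metric.closedBall_mem_nhds z one_pos) (Eventually.of_forall fun y => ?_) ?_ ?_ ?_ ?_ ?_
  · exact (hG.continuous.comp (Continuous.prodMk continuous_id continuous_const)).aestronglyMeasurable
  · exact (hG.continuous.comp
      (Continuous.prodMk continuous_id continuous_const)).intervalIntegrable _ _
  · exact (hc.comp (Continuous.prodMk continuous_id continuous_const)).aestronglyMeasurable
  · exact Eventually.of_forall fun s hs y hy => hC (s, y) ⟨uIoc_subset_uIcc hs, hy⟩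
  · exact intervalIntegrable_const
  · exact Eventually.of_forall fun s _ y _ => hd s y

theorem contDiff_intervalIntegral {G : ℝ → E → ℝ}
    (hG : ContDiff ℝ 1 (fun p : ℝ × E => G p.1 p.2)) (a b : ℝ) :
    ContDiff ℝ 1 (fun z => ∫ s in a..b, G s z) := by
  rw [contDiff_one_iff_hasFDerivAt]
  refine ⟨_, ?_, hasFDerivAt_intervalIntegral_of_contDiff hG a b⟩
  have hc : Continuous fun p : E × ℝ => fderiv ℝ (G p.2) p.1 :=
    Continuous.fderiv_one (f := fun (p : E × ℝ) y => G p.2 y) (g := Prod.fst)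
      (hG.comp ((contDiff_snd.comp contDiff_fst).prodMk contDiff_snd)) continuous_fst
  exact intervalIntegral.continuous_parametric_intervalIntegral_of_continuous' hc a b

variable {M : Type*} [TopologicalSpace M] [ChartedSpace E M] [IsManifold 𝓘(ℝ, E) ∞ M]

/-- Near a point, a `C^1` family of functions on a manifold is a `C^1` family on the model space
read in the chart. -/
theorem exists_contDiff_family_in_chart {F : ℝ → M → ℝ}
    (hF : ContMDiff (𝓘(ℝ, ℝ).prod 𝓘(ℝ, E)) 𝓘(ℝ, ℝ) 1 (fun p : ℝ × M => F p.1 p.2)) (x₀ : M) :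
    ∃ G : ℝ → E → ℝ, ContDiff ℝ 1 (fun p : ℝ × E => G p.1 p.2) ∧
      ∀ᶠ x in 𝓝 x₀, ∀ s, F s x = G s (extChartAt 𝓘(ℝ, E) x₀ x) := by
  set ch := extChartAt 𝓘(ℝ, E) x₀ with hch
  have hopen : IsOpen ch.target := isOpen_extChartAt_target x₀
  have hsymm : ContMDiffOn 𝓘(ℝ, E) 𝓘(ℝ, E) 1 ch.symm ch.target :=
    contMDiffOn_extChartAt_symm x₀
  obtain ⟨r, hr, hball⟩ := Metric.mem_nhds_iff.1 (extChartAt_target_mem_nhds (I := 𝓘(ℝ, E)) x₀)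
  let χ : ContDiffBump (ch x₀) := ⟨r / 4, r / 2, by linarith, by linarith⟩
  -- The cutoff removes the dependence on the chart domain, so that results about parameter
  -- integrals on the whole vector space apply.
  refine ⟨fun s z => χ z * F s (ch.symm z), ?_, ?_⟩
  · rw [contDiff_iff_contDiffAt]
    rintro ⟨s, z⟩
    by_cases hz : z ∈ ch.target
    · have h1 : ContMDiffAt 𝓘(ℝ, ℝ × E) (𝓘(ℝ, ℝ).prod 𝓘(ℝ, E)) 1
          (fun p : ℝ × E => (p.1, ch.symm p.2)) (s, z) :=
        contDiff_fst.contMDiff.contMDiffAt.prodMk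
          (ContMDiffAt.comp (g := ch.symm) (f := Prod.snd) (s, z)
            (hsymm.contMDiffAt (hopen.mem_nhds hz)) contDiff_snd.contMDiff.contMDiffAt)
      have h2 : ContDiffAt ℝ 1 (fun p : ℝ × E => F p.1 (ch.symm p.2)) (s, z) :=
        (hF.contMDiffAt.comp (s, z) h1).contDiffAt
      exact (χ.contDiff.contDiffAt.comp (s, z) contDiffAt_snd).mul h2
    · have hx' : z ∉ tsupport χ := by
        rw [χ.tsupport_eq]
        intro h
        exact hz (hball (Metric.closedBall_subset_ball (by change r / 2 < r; linarith) h))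
      have h0 : (fun p : ℝ × E => χ p.2 * F p.1 (ch.symm p.2)) =ᶠ[𝓝 (s, z)] fun _ => 0 := by
        have := (continuous_snd.tendsto (s, z)).eventually
          (notMem_tsupport_iff_eventuallyEq.1 hx')
        filter_upwards [this] with y hy
        simp [hy]
      exact contDiffAt_const.congr_of_eventuallyEq h0
  · filter_upwards [(continuousAt_extChartAt (I := 𝓘(ℝ, E)) x₀).eventually χ.eventuallyEq_one,
      extChartAt_source_mem_nhds (I := 𝓘(ℝ, E)) x₀] with x hx hxs s
    have h1 : ch.symm (ch x) = x := ch.left_inv hxs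
    have h2 : χ (ch x) = 1 := hx
    rw [h2, h1, one_mul]

theorem contMDiff_intervalIntegral {F : ℝ → M → ℝ}
    (hF : ContMDiff (𝓘(ℝ, ℝ).prod 𝓘(ℝ, E)) 𝓘(ℝ, ℝ) 1 (fun p : ℝ × M => F p.1 p.2)) (a b : ℝ) :
    ContMDiff 𝓘(ℝ, E) 𝓘(ℝ, ℝ) 1 (fun x => ∫ s in a..b, F s x) := by
  intro x₀
  obtain ⟨G, hG, hev⟩ := exists_contDiff_family_in_chart hF x₀
  have h1 : ContMDiffAt 𝓘(ℝ, E) 𝓘(ℝ, ℝ) 1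
      (fun x => ∫ s in a..b, G s (extChartAt 𝓘(ℝ, E) x₀ x)) x₀ :=
    (contDiff_intervalIntegral hG a b).contMDiff.contMDiffAt.comp x₀ contMDiffAt_extChartAt
  refine h1.congr_of_eventuallyEq ?_
  filter_upwards [hev] with x hx
  exact intervalIntegral.integral_congr fun s _ => hx s

theorem dirDeriv_intervalIntegral {F : ℝ → M → ℝ}
    (hF : ContMDiff (𝓘(ℝ, ℝ).prod 𝓘(ℝ, E)) 𝓘(ℝ, ℝ) 1 (fun p : ℝ × M => F p.1 p.2)) (a b : ℝ)
    (x₀ : M) (v : E) :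
    dirDeriv E (fun x => ∫ s in a..b, F s x) x₀ v = ∫ s in a..b, dirDeriv E (F s) x₀ v := by
  obtain ⟨G, hG, hev⟩ := exists_contDiff_family_in_chart hF x₀
  have hch : MDifferentiableAt 𝓘(ℝ, E) 𝓘(ℝ, E) (extChartAt 𝓘(ℝ, E) x₀) x₀ :=
    (contMDiffAt_extChartAt (n := 1)).mdifferentiableAt (by norm_num)
  set z₀ := extChartAt 𝓘(ℝ, E) x₀ x₀ with hz₀
  let w : E := (mfderiv 𝓘(ℝ, E) 𝓘(ℝ, E) (extChartAt 𝓘(ℝ, E) x₀) x₀ : E →L[ℝ] E) v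
  have key : ∀ (ψ : M → ℝ) (g : E → ℝ) (g' : E →L[ℝ] ℝ),
      (∀ᶠ x in 𝓝 x₀, ψ x = g (extChartAt 𝓘(ℝ, E) x₀ x)) → HasFDerivAt g g' z₀ →
        dirDeriv E ψ x₀ v = g' w := by
    intro ψ g g' hψ hg
    have h1 := (hg.hasMFDerivAt.comp x₀ hch.hasMFDerivAt).congr_of_eventuallyEq hψ
    have h2 := h1.mfderiv
    rw [dirDeriv, h2]
    rfl
  have hc : Continuous fun s => fderiv ℝ (G s) z₀ :=
    Continuous.fderiv_one (f := G) (g := fun _ => z₀) hG continuous_const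
  rw [key _ _ _ ?_ (hasFDerivAt_intervalIntegral_of_contDiff hG a b z₀),
    ContinuousLinearMap.intervalIntegral_apply (hc.intervalIntegrable _ _)]
  · refine intervalIntegral.integral_congr fun s _ => (key (F s) (G s) _ ?_ ?_).symm
    · filter_upwards [hev] with x hx using hx s
    · exact ((hG.comp (contDiff_const.prodMk contDiff_id)).differentiable
        (by norm_num) z₀).hasFDerivAt
  · filter_upwards [hev] with x hx
    exact intervalIntegral.integral_congr fun s _ => hx s

end ParametricIntegral

/-! ## Time changes of unstable flows -/

namespace AnosovFlow

section TimeChange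

variable {E : Type*} [NormedAddCommGroup E] [NormedSpace ℝ E]
section Orbits

variable {M : Type*} [MetricSpace M]

theorem subsingleton_of_dense_orbit_of_fixed {φ : Flow ℝ M} {x : M} (hd : Dense (φ.orbit x))
    (hx : ∀ s, φ s x = x) : Subsingleton M := by
  have h1 : φ.orbit x ⊆ {x} := by
    rintro y ⟨s, rfl⟩
    exact hx s
  have h2 : (univ : Set M) ⊆ {x} := by
    rw [← hd.closure_eq]
    exact closure_minimal h1 isClosed_singleton
  exact ⟨fun a b => (h2 (mem_univ a)).trans (h2 (mem_univ b)).symm⟩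

variable [ChartedSpace E M]

theorem not_subsingleton_of_vel_ne_zero {f : Flow ℝ M} (hf : IsC1Flow E f) {x : M}
    (hx : vel E f x ≠ 0) : ¬ Subsingleton M := by
  intro h
  apply hx
  have h1 : HasVelocityAt (fun t => f t x) 0 (0 : E) := by
    have : (fun t => f t x) = fun _ => x := funext fun t => Subsingleton.elim _ _
    rw [this]
    refine HasMFDerivAt.congr_mfderiv (hasMFDerivAt_const x (0 : ℝ)) ?_
    refine ContinuousLinearMap.ext_ring (M₁ := E) ?_
    exact (smul_zero (A := E) (1 : ℝ)).symm
  exact (hf.hasVelocityAt_zero x).unique h1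

end Orbits

variable {M : Type*} [MetricSpace M] [ChartedSpace E M] [IsManifold 𝓘(ℝ, E) ∞ M]

/-- The part of the standing assumptions which concerns the flow `f` and the two parametrisations
`φ` and `φ'` of its unstable manifolds. -/
structure TimeChangeData (E : Type*) [NormedAddCommGroup E] [NormedSpace ℝ E]
    {M : Type*} [MetricSpace M] [ChartedSpace E M] [IsManifold 𝓘(ℝ, E) ∞ M]
    (f φ φ' : Flow ℝ M) (lam : ℝ) (τ : M → ℝ → ℝ) (sStar : ℝ → ℝ → M → ℝ) : Prop where
  c1 : IsC1Flow E f
  vel_ne_zero : ∀ x, vel E f x ≠ 0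
  minimal : IsMinimalUnstableFlow f φ
  expanding : IsUniformlyExpanding f φ' lam
  reparam : IsC1Reparametrisation E φ φ' τ
  comm : ∀ (t s : ℝ) (x : M), f t (φ s x) = φ (sStar t s x) (f t x)
  mixed : HasContinuousMixedDeriv sStar
  data : HasC1Data E f φ (rho τ)

/-- The function `ρ⁻¹ X_f(ρ)`. -/
noncomputable def logDerivRho (f : Flow ℝ M) (τ : M → ℝ → ℝ) (x : M) : ℝ :=
  (rho τ x)⁻¹ * flowDeriv f (rho τ) x

/-- The function `∂₁ s*(0, s, x) = ∫₀ˢ (log λ + ρ⁻¹ X_f(ρ)) ∘ φ_r dr`. -/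
noncomputable def timeShift (f φ : Flow ℝ M) (lam : ℝ) (τ : M → ℝ → ℝ) (s : ℝ) (x : M) : ℝ :=
  ∫ r in (0 : ℝ)..s, (Real.log lam + logDerivRho f τ (φ r x))

/-! ### The density `ρ` and the cocycles `τ` and `s*` -/

namespace TimeChangeData

variable {f φ φ' : Flow ℝ M} {lam : ℝ} {τ : M → ℝ → ℝ} {sStar : ℝ → ℝ → M → ℝ}

/-- A fixed point has a one-point orbit, which is dense here, so M would be a point; but X_f does
not vanish. -/
theorem not_fixed (h : TimeChangeData E f φ φ' lam τ sStar) {ψ : Flow ℝ M}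
    (hψ : ∀ x, ψ.orbit x = unstableManifold f x) (x : M) : ¬ ∀ s, ψ s x = x := by
  intro hx
  have hd : Dense (ψ.orbit x) := by
    rw [hψ, ← h.minimal.orbit_eq]
    exact h.minimal.dense_orbit x
  exact not_subsingleton_of_vel_ne_zero h.c1 (h.vel_ne_zero x)
    (subsingleton_of_dense_orbit_of_fixed hd hx)

/-- As X_φ is C^1, integral curves are unique, and a zero of X_φ would be a fixed point of φ. -/
theorem vel_phi_ne_zero (h : TimeChangeData E f φ φ' lam τ sStar) (x : M) : vel E φ x ≠ 0 := by
  intro hx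
  have h1 : IsMIntegralCurve (fun s => φ s x) (vectorField E φ) := fun s =>
    h.reparam.c1.hasVelocityAt x s
  have h2 : IsMIntegralCurve (fun _ : ℝ => x) (vectorField E φ) := isMIntegralCurve_const hx
  have h3 := isMIntegralCurve_Ioo_eq_of_contMDiff_boundaryless (t₀ := 0)
    (h.data.c1_vectorField'.of_le le_rfl) h1 h2 (φ.map_zero_apply x)
  exact h.not_fixed h.minimal.orbit_eq x fun s => congrFun h3 s

theorem contMDiff_tau (h : TimeChangeData E f φ φ' lam τ sStar) :
    ContMDiff (𝓘(ℝ, ℝ).prod 𝓘(ℝ, E)) 𝓘(ℝ, ℝ) 1 (fun p : ℝ × M => τ p.2 p.1) :=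
  ContMDiff.comp (g := fun p : M × ℝ => τ p.1 p.2) (f := Prod.swap) h.reparam.contMDiff
    (contMDiff_snd.prodMk contMDiff_fst)

theorem differentiable_tau (h : TimeChangeData E f φ φ' lam τ sStar) (x : M) :
    Differentiable ℝ (τ x) := by
  have h1 : ContMDiff 𝓘(ℝ, ℝ) 𝓘(ℝ, ℝ) 1 (τ x) :=
    ContMDiff.comp (g := fun p : ℝ × M => τ p.2 p.1) h.contMDiff_tau
      (contMDiff_id.prodMk contMDiff_const)
  exact h1.contDiff.differentiable (by norm_num)

theorem vel_phi_eq (h : TimeChangeData E f φ φ' lam τ sStar) (x : M) :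
    vel E φ x = deriv (τ x) 0 • vel E φ' x := by
  have h1 := h.reparam.c1.tmap_vel h.reparam.c1' (Φ := id) mdifferentiableAt_id (κ := τ x)
    (h.reparam.zero x) (h.differentiable_tau x 0).hasDerivAt (fun s => h.reparam.eq s x)
  rwa [tmap_id] at h1

/-- Strict monotonicity only gives a nonnegative derivative; the derivative cannot be zero because
X_φ = τ'(0)X_φ' has no zeros. -/
theorem deriv_tau_pos (h : TimeChangeData E f φ φ' lam τ sStar) (x : M) :
    0 < deriv (τ x) 0 := by
  refine lt_of_le_of_ne ((h.reparam.strictMono x).monotone.deriv_nonneg) fun h0 => ?_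
  apply h.vel_phi_ne_zero x
  rw [h.vel_phi_eq, ← h0, zero_smul]

theorem rho_pos (h : TimeChangeData E f φ φ' lam τ sStar) (x : M) : 0 < rho τ x :=
  one_div_pos.2 (h.deriv_tau_pos x)

theorem vel_phi'_eq (h : TimeChangeData E f φ φ' lam τ sStar) (x : M) :
    vel E φ' x = rho τ x • vel E φ x := by
  rw [h.vel_phi_eq, smul_smul, rho, one_div_mul_cancel (h.deriv_tau_pos x).ne', one_smul]

theorem vel_phi'_ne_zero (h : TimeChangeData E f φ φ' lam τ sStar) (x : M) : vel E φ' x ≠ 0 := by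
  intro h0
  apply h.vel_phi_ne_zero x
  rw [h.vel_phi_eq, h0, smul_zero]

theorem hasDerivAt_tau (h : TimeChangeData E f φ φ' lam τ sStar) (x : M) (s : ℝ) :
    HasDerivAt (τ x) (rho τ (φ s x))⁻¹ s := by
  have h1 : HasDerivAt (τ (φ s x)) (rho τ (φ s x))⁻¹ (s - s) := by
    rw [sub_self, rho, one_div, inv_inv]
    exact (h.differentiable_tau _ 0).hasDerivAt
  refine ((h1.comp_sub_const s s).const_add (τ x s)).congr_of_eventuallyEq
    (Eventually.of_forall fun r => ?_)
  have := h.reparam.cocycle x s (r - s)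
  rwa [add_sub_cancel] at this

/-- Only continuity is available: ρ involves a derivative of τ, and τ is merely C^1. -/
theorem continuous_rho [FiniteDimensional ℝ E] (h : TimeChangeData E f φ φ' lam τ sStar) :
    Continuous (rho τ) := by
  have h1 : Continuous fun x => deriv (τ x) 0 := by
    rw [continuous_iff_continuousAt]
    intro x₀
    obtain ⟨G, hG, hev⟩ := exists_contDiff_family_in_chart (F := fun s x => τ x s) h.contMDiff_tau x₀
    have h2 : Continuous fun z => deriv (fun s => G s z) 0 := by
      have h3 : Continuous fun z => fderiv ℝ (fun s => G s z) 0 :=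
        Continuous.fderiv_one (f := fun z s => G s z) (g := fun _ => (0 : ℝ))
          (hG.comp (contDiff_snd.prodMk contDiff_fst)) continuous_const
      exact h3.clm_apply continuous_const
    have h4 : ContinuousAt (fun x => deriv (fun s => G s (extChartAt 𝓘(ℝ, E) x₀ x)) 0) x₀ :=
      ContinuousAt.comp (g := fun z => deriv (fun s => G s z) 0) h2.continuousAt
        (continuousAt_extChartAt x₀)
    refine h4.congr ?_
    filter_upwards [hev] with x hx
    have : τ x = fun s => G s (extChartAt 𝓘(ℝ, E) x₀ x) := funext fun s => hx s
    rw [this]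
  exact continuous_const.div h1 fun x => (h.deriv_tau_pos x).ne'

theorem lam_pos (h : TimeChangeData E f φ φ' lam τ sStar) : 0 < lam :=
  one_pos.trans h.expanding.one_lt

/-- The uniformly expanding flow has no periodic orbits. -/
theorem eq_zero_of_phi'_eq_self [CompactSpace M] (h : TimeChangeData E f φ φ' lam τ sStar)
    {x : M} {p : ℝ} (hp : φ' p x = x) : p = 0 := by
  by_contra hp0
  have hnat : ∀ (ψ : Flow ℝ M) (q : ℝ) (y : M), ψ q y = y → ∀ n : ℕ, ψ (n * q) y = y := by
    intro ψ q y hq n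
    induction n with
    | zero => simp
    | succ n ih =>
      push_cast
      rw [add_mul, one_mul, ψ.map_add, hq, ih]
  have hint : ∀ (q : ℝ) (y : M), φ' q y = y → ∀ n : ℤ, φ' (n * q) y = y := by
    intro q y hq n
    obtain ⟨m, rfl | rfl⟩ := n.eq_nat_or_neg
    · exact_mod_cast hnat φ' q y hq m
    · have h1 : φ' (-q) y = y := by
        conv_lhs => rw [← hq]
        rw [← φ'.map_add, neg_add_cancel, φ'.map_zero_apply]
      have := hnat φ' (-q) y h1 m
      push_cast
      rwa [neg_mul, ← mul_neg]
  -- Flowing back by f shrinks the period to λ^{-n}p. A limit point of these orbits will be fixed by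
  -- all of φ', which is impossible.
  have hper : ∀ n : ℕ, φ' (lam ^ (-(n : ℝ)) * p) (f (-(n : ℝ)) x) = f (-(n : ℝ)) x := fun n => by
    rw [← h.expanding.commutation, hp]
  obtain ⟨z, -, k, hk, hz⟩ := isCompact_univ.tendsto_subseq
    (x := fun n : ℕ => f (-(n : ℝ)) x) (fun n => mem_univ _)
  refine h.not_fixed h.expanding.orbit_eq z fun s => ?_
  let q : ℕ → ℝ := fun n => lam ^ (-(k n : ℝ)) * p
  have hq0 : Tendsto q atTop (𝓝 0) := by
    have h1 : Tendsto (fun n : ℕ => lam ^ (-(n : ℝ))) atTop (𝓝 0) := by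
      have h2 := tendsto_pow_atTop_nhds_zero_of_lt_one (inv_nonneg.2 h.lam_pos.le)
        (inv_lt_one_of_one_lt₀ h.expanding.one_lt)
      refine h2.congr fun n => ?_
      rw [Real.rpow_neg h.lam_pos.le, Real.rpow_natCast, inv_pow]
    have h3 := (h1.comp hk.tendsto_atTop).mul_const p
    rwa [zero_mul] at h3
  have hqne : ∀ n, q n ≠ 0 := fun n => mul_ne_zero (Real.rpow_pos_of_pos h.lam_pos _).ne' hp0
  -- Every real s is a limit of integer multiples of the shrinking periods, and each such multiple
  -- fixes the corresponding point.
  have hms : Tendsto (fun n => (⌊s / q n⌋ : ℝ) * q n) atTop (𝓝 s) := by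
    refine tendsto_iff_dist_tendsto_zero.2 (squeeze_zero (fun _ => dist_nonneg) (fun n => ?_)
      (tendsto_zero_iff_norm_tendsto_zero.1 hq0))
    have h1 : (⌊s / q n⌋ : ℝ) * q n - s = -(Int.fract (s / q n) * q n) := by
      have := Int.floor_add_fract (s / q n)
      have h2 : s = s / q n * q n := by rw [div_mul_cancel₀ _ (hqne n)]
      nth_rewrite 2 [h2]
      nth_rewrite 2 [← this]
      ring
    rw [Real.dist_eq, h1, abs_neg, abs_mul, Real.norm_eq_abs,
      abs_of_nonneg (Int.fract_nonneg _)]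
    exact mul_le_of_le_one_left (abs_nonneg _) (Int.fract_lt_one _).le
  have hlim : Tendsto (fun n => φ' ((⌊s / q n⌋ : ℝ) * q n) (f (-(k n : ℝ)) x)) atTop
      (𝓝 (φ' s z)) :=
    (φ'.cont'.tendsto (s, z)).comp (hms.prodMk_nhds hz)
  refine tendsto_nhds_unique (hlim.congr fun n => ?_) hz
  exact hint (q n) _ (hper (k n)) _

theorem phi'_injective [CompactSpace M] (h : TimeChangeData E f φ φ' lam τ sStar) (x : M) :
    Function.Injective fun s => φ' s x := by
  intro a b hab
  have : φ' (-b + a) x = x := by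
    have hab' : φ' a x = φ' b x := hab
    rw [φ'.map_add, hab', ← φ'.map_add, neg_add_cancel, φ'.map_zero_apply]
  linarith [h.eq_zero_of_phi'_eq_self this]

/-- Both sides are times that φ' takes to go from f_t(x) to f_t(φ_s x), and φ' has no periods. This
relation determines s* from τ and λ. -/
theorem tau_sStar [CompactSpace M] (h : TimeChangeData E f φ φ' lam τ sStar) (t s : ℝ) (x : M) :
    τ (f t x) (sStar t s x) = lam ^ t * τ x s := by
  apply h.phi'_injective (f t x)
  change φ' _ _ = φ' _ _
  rw [← h.reparam.eq, ← h.comm, h.reparam.eq, h.expanding.commutation]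

theorem sStar_zero [CompactSpace M] (h : TimeChangeData E f φ φ' lam τ sStar) (t : ℝ) (x : M) :
    sStar t 0 x = 0 := by
  apply (h.reparam.strictMono (f t x)).injective
  rw [h.tau_sStar, h.reparam.zero, h.reparam.zero, mul_zero]

/-- The chain rule in `tau_sStar`; existence of the derivative is part of the hypothesis on s*. -/
theorem hasDerivAt_sStar [CompactSpace M] (h : TimeChangeData E f φ φ' lam τ sStar)
    (t s : ℝ) (x : M) :
    HasDerivAt (fun s => sStar t s x)
      (lam ^ t * rho τ (f t (φ s x)) * (rho τ (φ s x))⁻¹) s := by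
  have h1 := (h.mixed.differentiable_snd t s x).hasDerivAt
  have h2 := (h.hasDerivAt_tau (f t x) (sStar t s x)).comp s h1
  have h3 := (h.hasDerivAt_tau x s).const_mul (lam ^ t)
  have h4 : (τ (f t x) ∘ fun s => sStar t s x) = fun s => lam ^ t * τ x s :=
    funext fun s => h.tau_sStar t s x
  rw [h4, ← h.comm] at h2
  have h5 := h2.unique h3
  have h6 := (h.rho_pos (f t (φ s x))).ne'
  have h7 : lam ^ t * rho τ (f t (φ s x)) * (rho τ (φ s x))⁻¹ =
      deriv (fun s' => sStar t s' x) s := by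
    rw [mul_right_comm, ← h5, inv_mul_eq_div, div_mul_cancel₀ _ h6]
  rw [h7]
  exact h1

/-- The hypotheses provide ∂₂s* and ∂₁∂₂s* but not ∂₁s*. The integral moves the dependence on t into
an integrand that is explicitly differentiable in t. -/
theorem sStar_eq [FiniteDimensional ℝ E] [CompactSpace M]
    (h : TimeChangeData E f φ φ' lam τ sStar) (t s : ℝ) (x : M) :
    sStar t s x = ∫ r in (0 : ℝ)..s, lam ^ t * rho τ (f t (φ r x)) * (rho τ (φ r x))⁻¹ := by
  have hc := h.continuous_rho
  have hcont : Continuous fun r => lam ^ t * rho τ (f t (φ r x)) * (rho τ (φ r x))⁻¹ := by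
    refine (continuous_const.mul (hc.comp ?_)).mul ((hc.comp ?_).inv₀ fun r => (h.rho_pos _).ne')
    · fun_prop
    · fun_prop
  rw [intervalIntegral.integral_eq_sub_of_hasDerivAt (fun r _ => h.hasDerivAt_sStar t r x)
    (hcont.intervalIntegrable _ _), h.sStar_zero, sub_zero]

theorem hasDerivAt_rho (h : TimeChangeData E f φ φ' lam τ sStar) (x : M) (t : ℝ) :
    HasDerivAt (fun t => rho τ (f t x)) (flowDeriv f (rho τ) (f t x)) t := by
  have h1 : HasDerivAt (fun r => rho τ (f r (f t x))) (flowDeriv f (rho τ) (f t x)) (t - t) := by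
    rw [sub_self]
    exact (h.data.differentiable (f t x)).hasDerivAt
  refine (h1.comp_sub_const t t).congr_of_eventuallyEq (Eventually.of_forall fun r => ?_)
  simp [← f.map_add]

theorem continuous_logDerivRho (h : TimeChangeData E f φ φ' lam τ sStar) :
    Continuous (logDerivRho f τ) :=
  h.data.contMDiff.continuous

/-- The derivative of `s*` with respect to its first variable at time `0`. -/
theorem hasDerivAt_sStar_zero [FiniteDimensional ℝ E] [CompactSpace M]
    (h : TimeChangeData E f φ φ' lam τ sStar) (s : ℝ) (x : M) :
    HasDerivAt (fun t => sStar t s x) (timeShift f φ lam τ s x) 0 := by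
  have hc := h.continuous_rho
  have hc' := h.data.continuous
  have hne : ∀ r, rho τ (φ r x) ≠ 0 := fun r => (h.rho_pos _).ne'
  have hinv : Continuous fun r => (rho τ (φ r x))⁻¹ :=
    (hc.comp (φ.continuous continuous_id continuous_const)).inv₀ hne
  let G : ℝ → ℝ → ℝ := fun t r => lam ^ t * rho τ (f t (φ r x)) * (rho τ (φ r x))⁻¹
  let G' : ℝ → ℝ → ℝ := fun t r => (lam ^ t * Real.log lam * rho τ (f t (φ r x)) +
    lam ^ t * flowDeriv f (rho τ) (f t (φ r x))) * (rho τ (φ r x))⁻¹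
  have hfφ : Continuous fun p : ℝ × ℝ => f p.1 (φ p.2 x) :=
    f.continuous continuous_fst (φ.continuous continuous_snd continuous_const)
  have hpow : Continuous fun p : ℝ × ℝ => lam ^ p.1 :=
    (Real.continuous_const_rpow h.lam_pos.ne').comp continuous_fst
  have hG : Continuous fun p : ℝ × ℝ => G p.1 p.2 :=
    (hpow.mul (hc.comp hfφ)).mul (hinv.comp continuous_snd)
  have hG' : Continuous fun p : ℝ × ℝ => G' p.1 p.2 :=
    (((hpow.mul continuous_const).mul (hc.comp hfφ)).add (hpow.mul (hc'.comp hfφ))).mul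
      (hinv.comp continuous_snd)
  have hd : ∀ t r, HasDerivAt (fun t => G t r) (G' t r) t := fun t r => by
    have h1 : HasDerivAt (fun t => lam ^ t) (lam ^ t * Real.log lam) t :=
      (Real.hasStrictDerivAt_const_rpow h.lam_pos t).hasDerivAt
    exact (h1.mul (h.hasDerivAt_rho (φ r x) t)).mul_const _
  obtain ⟨C, hC⟩ := ((isCompact_closedBall (0 : ℝ) 1).prod (isCompact_uIcc (a := (0 : ℝ)) (b := s)))
    |>.exists_bound_of_continuousOn hG'.continuousOn
  have key := (intervalIntegral.hasDerivAt_integral_of_dominated_loc_of_deriv_le (μ := volume)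
    (bound := fun _ => C) (F := G) (F' := G') (a := 0) (b := s)
    (Metric.closedBall_mem_nhds (0 : ℝ) one_pos)
    (Eventually.of_forall fun t =>
      (hG.comp (Continuous.prodMk continuous_const continuous_id)).aestronglyMeasurable)
    ((hG.comp (Continuous.prodMk continuous_const continuous_id)).intervalIntegrable _ _)
    (hG'.comp (Continuous.prodMk continuous_const continuous_id)).aestronglyMeasurable
    (Eventually.of_forall fun r hr t ht => hC (t, r) ⟨ht, uIoc_subset_uIcc hr⟩)
    intervalIntegrable_const (Eventually.of_forall fun r _ t _ => hd t r)).2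
  have h0 : ∀ r, G' 0 r = Real.log lam + logDerivRho f τ (φ r x) := fun r => by
    simp only [G', Real.rpow_zero, f.map_zero_apply, logDerivRho]
    have := hne r
    field_simp
  simp only [h0] at key
  exact key.congr_of_eventuallyEq (Eventually.of_forall fun t => h.sStar_eq t s x)

end TimeChangeData

end TimeChange

end AnosovFlow

/-! ## Norms of tangent vectors -/

theorem ContinuousAt.exists_eventually_norm_le {X G : Type*} [TopologicalSpace X]
    [SeminormedAddCommGroup G] {g : X → G} {x : X} (h : ContinuousAt g x) :
    ∃ C, ∀ᶠ y in 𝓝 x, ‖g y‖ ≤ C :=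
  ⟨‖g x‖ + 1, (h.norm.eventually_lt continuousAt_const (lt_add_one _)).mono fun _ hy => hy.le⟩

section RiemannianNorm

variable {E : Type*} [NormedAddCommGroup E] [NormedSpace ℝ E]
variable {M : Type*} [TopologicalSpace M] [ChartedSpace E M]
variable [RiemannianBundle (fun x : M => TangentSpace 𝓘(ℝ, E) x)]

/-- The Riemannian norm of a tangent vector. -/
noncomputable def rnorm (x : M) (v : E) : ℝ := @norm (TangentSpace 𝓘(ℝ, E) x) _ v

theorem rnorm_nonneg (x : M) (v : E) : 0 ≤ rnorm x v :=
  @norm_nonneg (TangentSpace 𝓘(ℝ, E) x) _ v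

theorem rnorm_add_le (x : M) (v w : E) : rnorm x (v + w) ≤ rnorm x v + rnorm x w :=
  @norm_add_le (TangentSpace 𝓘(ℝ, E) x) _ v w

theorem rnorm_smul (x : M) (c : ℝ) (v : E) : rnorm x (c • v) = |c| * rnorm x v :=
  @norm_smul ℝ (TangentSpace 𝓘(ℝ, E) x) _ _ _ _ c v

theorem rnorm_eq_zero {x : M} {v : E} : rnorm x v = 0 ↔ v = 0 :=
  @norm_eq_zero (TangentSpace 𝓘(ℝ, E) x) _ v

end RiemannianNorm

section TangentNorm

variable {E : Type*} [NormedAddCommGroup E] [NormedSpace ℝ E]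
variable {F : Type*} [NormedAddCommGroup F] [NormedSpace ℝ F]
variable {M : Type*} [TopologicalSpace M] [ChartedSpace E M] [IsManifold 𝓘(ℝ, E) ∞ M]

variable (E) in
/-- The coordinates of tangent vectors at `y` with respect to the preferred chart at `x₀`. -/
noncomputable def chartCoord (x₀ y : M) : E →L[ℝ] E :=
  (trivializationAt E (TangentSpace 𝓘(ℝ, E) : M → Type _) x₀).continuousLinearMapAt ℝ y

theorem eventually_mem_baseSet (x₀ : M) :
    ∀ᶠ y in 𝓝 x₀, y ∈ (trivializationAt E (TangentSpace 𝓘(ℝ, E) : M → Type _) x₀).baseSet :=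
  (trivializationAt E (TangentSpace 𝓘(ℝ, E) : M → Type _) x₀).open_baseSet.mem_nhds
    (FiberBundle.mem_baseSet_trivializationAt' x₀)

theorem eventually_injective_chartCoord (x₀ : M) :
    ∀ᶠ y in 𝓝 x₀, Function.Injective (chartCoord E x₀ y) := by
  filter_upwards [eventually_mem_baseSet (E := E) x₀] with y hy
  intro v w hvw
  have h1 := Trivialization.symmL_continuousLinearMapAt (R := ℝ)
    (trivializationAt E (TangentSpace 𝓘(ℝ, E) : M → Type _) x₀) hy
  exact (h1 v).symm.trans ((congrArg
    ((trivializationAt E (TangentSpace 𝓘(ℝ, E) : M → Type _) x₀).symmL ℝ y) hvw).trans (h1 w))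

theorem continuousWithinAt_chartCoord {X : M → E} {U : Set M} {x₀ : M}
    (hX : ContinuousWithinAt
      (fun x => (⟨x, X x⟩ : TangentBundle 𝓘(ℝ, E) M)) U x₀) :
    ContinuousWithinAt (fun y => chartCoord E x₀ y (X y)) U x₀ := by
  rw [FiberBundle.continuousWithinAt_totalSpace] at hX
  have h2 := hX.2
  have h0 : x₀ ∈ (trivializationAt E (TangentSpace 𝓘(ℝ, E) : M → Type _) x₀).baseSet :=
    FiberBundle.mem_baseSet_trivializationAt' x₀
  refine h2.congr_of_eventuallyEq ?_ ?_
  · filter_upwards [mem_nhdsWithin_of_mem_nhds (eventually_mem_baseSet (E := E) x₀)] with y hy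
    exact Trivialization.continuousLinearMapAt_apply_of_mem (R := ℝ) _ hy _
  · exact Trivialization.continuousLinearMapAt_apply_of_mem (R := ℝ) _ h0 _

/-- Continuity of the manifold derivative is expressed through `inCoordinates`; this makes it usable
on actual tangent vectors. -/
theorem inCoordinates_chartCoord {M' : Type*} [TopologicalSpace M']
    [ChartedSpace F M'] [IsManifold 𝓘(ℝ, F) ∞ M'] {x₀ x : M} {y₀ y : M'}
    (hx : x ∈ (trivializationAt E (TangentSpace 𝓘(ℝ, E) : M → Type _) x₀).baseSet)
    (L : E →L[ℝ] F) (v : E) :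
    ContinuousLinearMap.inCoordinates E (TangentSpace 𝓘(ℝ, E) : M → Type _)
      F (TangentSpace 𝓘(ℝ, F) : M' → Type _) x₀ x y₀ y L (chartCoord E x₀ x v) =
    chartCoord F y₀ y (L v) := by
  have h1 : (trivializationAt E (TangentSpace 𝓘(ℝ, E) : M → Type _) x₀).symmL ℝ x
      ((trivializationAt E (TangentSpace 𝓘(ℝ, E) : M → Type _) x₀).continuousLinearMapAt ℝ x v) = v :=
    Trivialization.symmL_continuousLinearMapAt _ hx v
  have h2 : chartCoord F y₀ y (L ((trivializationAt E (TangentSpace 𝓘(ℝ, E) : M → Type _) x₀).symmL ℝ x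
      ((trivializationAt E (TangentSpace 𝓘(ℝ, E) : M → Type _) x₀).continuousLinearMapAt ℝ x v))) =
      chartCoord F y₀ y (L v) :=
    congrArg (fun w => chartCoord F y₀ y (L w)) h1
  exact h2

/-- The tangent maps of a C^1 family depend continuously on time and point when read in coordinates,
hence are locally bounded. -/
theorem exists_bound_chartCoord_tmap {Φ : ℝ → M → M}
    (hΦ : ContMDiff (𝓘(ℝ, ℝ).prod 𝓘(ℝ, E)) 𝓘(ℝ, E) 1 (fun p : ℝ × M => Φ p.1 p.2))
    (s₀ : ℝ) (x₀ : M) : ∃ C : ℝ, ∀ᶠ p in 𝓝 (s₀, x₀), ∀ v : E,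
      ‖chartCoord E (Φ s₀ x₀) (Φ p.1 p.2) (tmap E (Φ p.1) p.2 v)‖ ≤ C * ‖chartCoord E x₀ p.2 v‖ := by
  have h1 := ContMDiffAt.mfderiv (m := 0) (I := 𝓘(ℝ, E)) (I' := 𝓘(ℝ, E))
    (J := 𝓘(ℝ, ℝ).prod 𝓘(ℝ, E)) (x₀ := ((s₀, x₀) : ℝ × M))
    (fun (p : ℝ × M) (y : M) => Φ p.1 y) (fun p => p.2)
    (ContMDiff.contMDiffAt (ContMDiff.comp (g := fun p : ℝ × M => Φ p.1 p.2) hΦ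
      (((contMDiff_fst (I := 𝓘(ℝ, ℝ)) (J := 𝓘(ℝ, E))).comp contMDiff_fst).prodMk
        contMDiff_snd)))
    contMDiff_snd.contMDiffAt (by norm_num)
  obtain ⟨C, h3⟩ := h1.continuousAt.exists_eventually_norm_le
  refine ⟨C, ?_⟩
  have h4 : ∀ᶠ p in 𝓝 (s₀, x₀), p.2 ∈
      (trivializationAt E (TangentSpace 𝓘(ℝ, E) : M → Type _) x₀).baseSet :=
    (continuous_snd.tendsto (s₀, x₀)).eventually (eventually_mem_baseSet x₀)
  filter_upwards [h3, h4] with p hp hp2 v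
  have h5 := inCoordinates_chartCoord (y₀ := Φ s₀ x₀) (y := Φ p.1 p.2) hp2 (tmap E (Φ p.1) p.2) v
  rw [← h5]
  refine (ContinuousLinearMap.le_opNorm _ _).trans ?_
  exact mul_le_mul_of_nonneg_right hp (norm_nonneg _)

theorem exists_bound_chartCoord_dirDeriv {θ : M → F} (hθ : ContMDiff 𝓘(ℝ, E) 𝓘(ℝ, F) 1 θ)
    (x₀ : M) : ∃ C : ℝ, ∀ᶠ x in 𝓝 x₀, ∀ v : E,
      ‖dirDeriv E θ x v‖ ≤ C * ‖chartCoord E x₀ x v‖ := by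
  have h1 := ContMDiffAt.mfderiv_const (m := 0) (hθ x₀) (by norm_num)
  obtain ⟨C, h3⟩ := h1.continuousAt.exists_eventually_norm_le
  refine ⟨C, ?_⟩
  filter_upwards [h3, eventually_mem_baseSet (E := E) x₀] with p hp hp2 v
  have h5 := inCoordinates_chartCoord (y₀ := θ x₀) (y := θ p) hp2 (dirDeriv E θ p) v
  have h6 : chartCoord F (θ x₀) (θ p) (dirDeriv E θ p v) = dirDeriv E θ p v := by
    rw [chartCoord, TangentBundle.continuousLinearMapAt_model_space]
    rfl
  rw [h6] at h5
  rw [← h5]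
  refine (ContinuousLinearMap.le_opNorm _ _).trans ?_
  exact mul_le_mul_of_nonneg_right hp (norm_nonneg _)

variable [RiemannianBundle (fun x : M => TangentSpace 𝓘(ℝ, E) x)]

variable [IsContMDiffRiemannianBundle 𝓘(ℝ, E) ∞ E (fun x : M => TangentSpace 𝓘(ℝ, E) x)]

theorem isContinuousRiemannianBundle_tangent :
    IsContinuousRiemannianBundle E (fun x : M => TangentSpace 𝓘(ℝ, E) x) := by
  obtain ⟨g, hg, h⟩ := IsContMDiffRiemannianBundle.exists_contMDiff (IB := 𝓘(ℝ, E)) (n := ∞) (F := E)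
    (E := fun x : M => TangentSpace 𝓘(ℝ, E) x)
  exact ⟨g, hg.continuous, h⟩

/-- With the reverse inequality below, this says that a continuous Riemannian metric is locally
comparable to the norm of the model space. -/
theorem exists_bound_chartCoord_le (x₀ : M) : ∃ C > 0, ∀ᶠ y in 𝓝 x₀, ∀ v : E,
    ‖chartCoord E x₀ y v‖ ≤ C * rnorm y v := by
  have := isContinuousRiemannianBundle_tangent (E := E) (M := M)
  obtain ⟨C, hC, h⟩ := eventually_norm_trivializationAt_lt E
    (fun x : M => TangentSpace 𝓘(ℝ, E) x) x₀
  refine ⟨C, hC, h.mono fun y hy v => ?_⟩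
  exact (ContinuousLinearMap.le_opNorm
    ((trivializationAt E (TangentSpace 𝓘(ℝ, E) : M → Type _) x₀).continuousLinearMapAt ℝ y) v).trans
    (mul_le_mul_of_nonneg_right hy.le (rnorm_nonneg y v))

theorem exists_bound_rnorm_le (x₀ : M) : ∃ C > 0, ∀ᶠ y in 𝓝 x₀, ∀ v : E,
    rnorm y v ≤ C * ‖chartCoord E x₀ y v‖ := by
  have := isContinuousRiemannianBundle_tangent (E := E) (M := M)
  obtain ⟨C, hC, h⟩ := eventually_norm_symmL_trivializationAt_lt E
    (fun x : M => TangentSpace 𝓘(ℝ, E) x) x₀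
  refine ⟨C, hC, ?_⟩
  filter_upwards [h, eventually_mem_baseSet (E := E) x₀] with y hy hy' v
  have h1 : (trivializationAt E (TangentSpace 𝓘(ℝ, E) : M → Type _) x₀).symmL ℝ y
      (chartCoord E x₀ y v) = v := Trivialization.symmL_continuousLinearMapAt _ hy' v
  have h2 := (ContinuousLinearMap.le_opNorm
    ((trivializationAt E (TangentSpace 𝓘(ℝ, E) : M → Type _) x₀).symmL ℝ y)
      (chartCoord E x₀ y v)).trans
    (mul_le_mul_of_nonneg_right hy.le (norm_nonneg _))
  rw [h1] at h2
  exact h2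

end TangentNorm

/-! ## Uniform bounds on compact Riemannian manifolds -/

/-- Monotonicity of `P` in the constant lets finitely many local constants be replaced by their
maximum, and by 0 if that is larger. -/
theorem exists_bound_of_eventually {X : Type*} [TopologicalSpace X] [CompactSpace X]
    {P : X → ℝ → Prop} (hP : ∀ x a b, a ≤ b → P x a → P x b)
    (h : ∀ x₀, ∃ C, ∀ᶠ x in 𝓝 x₀, P x C) : ∃ C, 0 ≤ C ∧ ∀ x, P x C := by
  choose C hC using h
  obtain ⟨t, ht⟩ := CompactSpace.elim_nhds_subcover (fun x₀ => {x | P x (C x₀)}) hC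
  obtain ⟨B, hB⟩ := (t.image C).bddAbove
  refine ⟨max B 0, le_max_right _ _, fun x => ?_⟩
  have hx : x ∈ ⋃ x₀ ∈ t, {x | P x (C x₀)} := ht ▸ mem_univ x
  simp only [mem_iUnion] at hx
  obtain ⟨x₀, hx₀, hx⟩ := hx
  exact hP _ _ _ ((hB (Finset.mem_image_of_mem C hx₀)).trans (le_max_left _ _)) hx

theorem exists_bound_of_continuous {X : Type*} [TopologicalSpace X] [CompactSpace X] {g : X → ℝ}
    (hg : Continuous g) : ∃ C, 0 ≤ C ∧ ∀ x, |g x| ≤ C :=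
  exists_bound_of_eventually (fun _ _ _ hab h => h.trans hab)
    fun _ => hg.continuousAt.exists_eventually_norm_le

section Lipschitz

variable {E : Type*} [NormedAddCommGroup E] [NormedSpace ℝ E]
variable {M : Type*} [MetricSpace M] [ChartedSpace E M]
  [RiemannianBundle (fun x : M => TangentSpace 𝓘(ℝ, E) x)]

/-- A `C^1` function whose derivative is bounded by `C` is `C`-Lipschitz. -/
theorem dist_le_of_dirDeriv_le [IsRiemannianManifold 𝓘(ℝ, E) M] {ψ : M → ℝ}
    (hψ : ContMDiff 𝓘(ℝ, E) 𝓘(ℝ, ℝ) 1 ψ) {C : ℝ} (hC : 0 ≤ C)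
    (h : ∀ x v, |dirDeriv E ψ x v| ≤ C * rnorm x v) (x y : M) :
    dist (ψ x) (ψ y) ≤ C * dist x y := by
  lift C to ℝ≥0 using hC
  have key : edist (ψ x) (ψ y) ≤ C * edist x y := by
    -- The Riemannian distance is an infimum of path lengths that need not be attained: a path
    -- shorter than r is mapped by ψ to a path of length at most C·r, and r then decreases to the
    -- distance.
    have key' : ∀ r, edist x y < r → edist (ψ x) (ψ y) ≤ C * r := by
      intro r hr
      rw [IsRiemannianManifold.out (I := 𝓘(ℝ, E))] at hr
      obtain ⟨γ, hγ0, hγ1, hγ, hlen, -⟩ :=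
        exists_lt_locally_constant_of_riemannianEDist_lt hr zero_lt_one
      rw [IsRiemannianManifold.out (I := 𝓘(ℝ, ℝ))]
      have h1 : ContMDiff 𝓘(ℝ, ℝ) 𝓘(ℝ, ℝ) 1 (fun s => ψ (γ s)) := hψ.comp hγ
      refine (riemannianEDist_le_pathELength (I := 𝓘(ℝ, ℝ)) h1.contMDiffOn (by rw [hγ0])
        (by rw [hγ1]) zero_le_one).trans ?_
      refine le_trans ?_ (mul_le_mul_right hlen.le _)
      rw [pathELength_eq_lintegral_mfderiv_Icc, pathELength_eq_lintegral_mfderiv_Icc,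
        ← lintegral_const_mul' _ _ ENNReal.coe_ne_top]
      refine lintegral_mono fun s => ?_
      have h2 : HasVelocityAt γ s (velocity E γ s) :=
        hasVelocityAt_velocity (hγ.mdifferentiable (by norm_num) s)
      have h3 : HasVelocityAt (fun s => ψ (γ s)) s (velocity ℝ (fun s => ψ (γ s)) s) :=
        hasVelocityAt_velocity (h1.mdifferentiable (by norm_num) s)
      have h4 : velocity ℝ (fun s => ψ (γ s)) s = dirDeriv E ψ (γ s) (velocity E γ s) :=
        h3.unique (HasMFDerivAt.congr_mfderiv
          (h2.hasDerivAt (hψ.mdifferentiable (by norm_num) _)).hasFDerivAt.hasMFDerivAt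
          (ContinuousLinearMap.ext_ring (M₁ := ℝ) (by simp)))
      have h5 := h (γ s) (velocity E γ s)
      rw [← h4] at h5
      refine (enorm_tangentSpace_vectorSpace (F := ℝ)).trans_le ?_
      have h6 : ENNReal.ofReal ‖velocity ℝ (fun s => ψ (γ s)) s‖ ≤
          C * ENNReal.ofReal (rnorm (γ s) (velocity E γ s)) := by
        rw [← ENNReal.ofReal_coe_nnreal, ← ENNReal.ofReal_mul C.coe_nonneg]
        exact ENNReal.ofReal_le_ofReal h5
      have h7 : ENNReal.ofReal (rnorm (γ s) (velocity E γ s)) =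
          @enorm (TangentSpace 𝓘(ℝ, E) (γ s)) _ (velocity E γ s) :=
        @ofReal_norm (TangentSpace 𝓘(ℝ, E) (γ s)) _ (velocity E γ s)
      rw [ofReal_norm, h7] at h6
      exact h6
    have h8 : Tendsto (fun n : ℕ => (C : ℝ≥0∞) * (edist x y + (n : ℝ≥0∞)⁻¹)) atTop
        (𝓝 (C * (edist x y + 0))) :=
      ENNReal.Tendsto.const_mul (tendsto_const_nhds.add ENNReal.tendsto_inv_nat_nhds_zero)
        (Or.inr ENNReal.coe_ne_top)
    rw [add_zero] at h8
    refine ge_of_tendsto' h8 fun n => key' _ ?_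
    exact ENNReal.lt_add_right (edist_ne_top x y) (by simp)
  rw [edist_dist, edist_dist, ← ENNReal.ofReal_coe_nnreal, ← ENNReal.ofReal_mul C.coe_nonneg] at key
  exact (ENNReal.ofReal_le_ofReal_iff (by positivity)).1 key

end Lipschitz

section UniformBounds

variable {E : Type*} [NormedAddCommGroup E] [NormedSpace ℝ E]
variable {M : Type*} [MetricSpace M] [ChartedSpace E M] [IsManifold 𝓘(ℝ, E) ∞ M]
  [RiemannianBundle (fun x : M => TangentSpace 𝓘(ℝ, E) x)]
  [IsContMDiffRiemannianBundle 𝓘(ℝ, E) ∞ E (fun x : M => TangentSpace 𝓘(ℝ, E) x)]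

theorem exists_bound_tmap [CompactSpace M] {Φ : ℝ → M → M}
    (hΦ : ContMDiff (𝓘(ℝ, ℝ).prod 𝓘(ℝ, E)) 𝓘(ℝ, E) 1 (fun p : ℝ × M => Φ p.1 p.2)) :
    ∃ C, 0 ≤ C ∧ ∀ s ∈ Icc (0 : ℝ) 1, ∀ (x : M) (v : E),
      rnorm (Φ s x) (tmap E (Φ s) x v) ≤ C * rnorm x v := by
  obtain ⟨C, hC, h⟩ := exists_bound_of_eventually (X := Icc (0 : ℝ) 1 × M)
    (P := fun p C => ∀ v : E, rnorm (Φ p.1 p.2) (tmap E (Φ p.1) p.2 v) ≤ C * rnorm p.2 v)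
    (fun p a b hab h v => (h v).trans (mul_le_mul_of_nonneg_right hab (rnorm_nonneg _ _)))
    (fun p₀ => by
      obtain ⟨C₁, h1⟩ := exists_bound_chartCoord_tmap hΦ p₀.1 p₀.2
      obtain ⟨C₂, h2, h2'⟩ := exists_bound_chartCoord_le (E := E) p₀.2
      obtain ⟨C₃, h3, h3'⟩ := exists_bound_rnorm_le (E := E) (Φ p₀.1 p₀.2)
      have ht : Tendsto (fun p : Icc (0 : ℝ) 1 × M => ((p.1 : ℝ), p.2)) (𝓝 p₀)
          (𝓝 ((p₀.1 : ℝ), p₀.2)) :=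
        (Continuous.tendsto (by fun_prop) p₀)
      have hΦc : Tendsto (fun p : ℝ × M => Φ p.1 p.2) (𝓝 ((p₀.1 : ℝ), p₀.2))
          (𝓝 (Φ p₀.1 p₀.2)) := hΦ.continuous.tendsto _
      refine ⟨C₃ * (|C₁| * C₂), ?_⟩
      filter_upwards [ht.eventually h1, (continuous_snd.tendsto p₀).eventually h2',
        (hΦc.comp ht).eventually h3'] with p hp1 hp2 hp3 v
      refine (hp3 _).trans ?_
      rw [mul_assoc, mul_assoc]
      refine mul_le_mul_of_nonneg_left ?_ h3.le
      refine (hp1 v).trans ?_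
      refine (mul_le_mul_of_nonneg_right (le_abs_self C₁) (norm_nonneg _)).trans ?_
      exact mul_le_mul_of_nonneg_left (hp2 v) (abs_nonneg _))
  exact ⟨C, hC, fun s hs x v => h (⟨s, hs⟩, x) v⟩

theorem exists_bound_dirDeriv [CompactSpace M] {θ : M → ℝ}
    (hθ : ContMDiff 𝓘(ℝ, E) 𝓘(ℝ, ℝ) 1 θ) :
    ∃ C, 0 ≤ C ∧ ∀ (x : M) (v : E), |dirDeriv E θ x v| ≤ C * rnorm x v := by
  refine exists_bound_of_eventually
    (fun p a b hab h v => (h v).trans (mul_le_mul_of_nonneg_right hab (rnorm_nonneg _ _)))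
    (fun x₀ => ?_)
  obtain ⟨C₁, h1⟩ := exists_bound_chartCoord_dirDeriv hθ x₀
  obtain ⟨C₂, h2, h2'⟩ := exists_bound_chartCoord_le (E := E) x₀
  refine ⟨|C₁| * C₂, ?_⟩
  filter_upwards [h1, h2'] with x h3 h4 v
  refine (h3 v).trans ((mul_le_mul_of_nonneg_right (le_abs_self C₁) (norm_nonneg _)).trans ?_)
  rw [mul_assoc]
  exact mul_le_mul_of_nonneg_left (h4 v) (abs_nonneg _)

theorem continuous_rnorm {X : M → E}
    (hX : Continuous (fun x => (⟨x, X x⟩ : TangentBundle 𝓘(ℝ, E) M))) :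
    Continuous fun x => rnorm x (X x) := by
  have := isContinuousRiemannianBundle_tangent (E := E) (M := M)
  have h1 := Continuous.inner_bundle (F := E) (E := fun x : M => TangentSpace 𝓘(ℝ, E) x)
    (b := fun x : M => x) (v := X) (w := X) hX hX
  have h2 : (fun x => rnorm x (X x)) = fun x =>
      √(@inner ℝ (TangentSpace 𝓘(ℝ, E) x) _ (X x) (X x)) :=
    funext fun x => @norm_eq_sqrt_real_inner (TangentSpace 𝓘(ℝ, E) x) _ _ (X x)
  rw [h2]
  exact h1.sqrt

/-- The coefficients of a tangent vector in a continuous local frame are bounded by its norm. -/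
theorem exists_bound_frame {ι : Type*} [Fintype ι] {b : ι → M → E} {x₀ : M}
    (hb : ∀ i, ContinuousAt (fun x => (⟨x, b i x⟩ : TangentBundle 𝓘(ℝ, E) M)) x₀)
    (hli : LinearIndependent ℝ fun i => b i x₀) :
    ∃ C, 0 ≤ C ∧ ∀ᶠ x in 𝓝 x₀, (∀ c : ι → ℝ, ‖c‖ ≤ C * rnorm x (∑ i, c i • b i x)) ∧
      ∀ i, rnorm x (b i x) ≤ C := by
  let L : M → (ι → ℝ) →L[ℝ] E := fun x =>
    ∑ i, (ContinuousLinearMap.proj i : (ι → ℝ) →L[ℝ] ℝ).smulRight (chartCoord E x₀ x (b i x))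
  have hbc : ∀ i, ContinuousAt (fun x => chartCoord E x₀ x (b i x)) x₀ := fun i => by
    have := continuousWithinAt_chartCoord ((hb i).continuousWithinAt (s := univ))
    rwa [continuousWithinAt_univ] at this
  have hL : ContinuousAt L x₀ := by
    refine tendsto_finsetSum _ fun i _ => ?_
    exact ((ContinuousLinearMap.smulRightL ℝ (ι → ℝ) E
      (ContinuousLinearMap.proj i)).continuous.continuousAt).comp (hbc i)
  have hLapp : ∀ x c, L x c = chartCoord E x₀ x (∑ i, c i • b i x) := fun x c => by
    simp [L]
  have hker : LinearMap.ker (L x₀).toLinearMap = ⊥ := by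
    rw [LinearMap.ker_eq_bot']
    intro c hc
    have h1 : chartCoord E x₀ x₀ (∑ i, c i • b i x₀) = 0 := by
      rw [← hLapp]
      exact hc
    have h2 := (eventually_injective_chartCoord (E := E) x₀).self_of_nhds
      (h1.trans (map_zero _).symm)
    exact funext (Fintype.linearIndependent_iff.1 hli c h2)
  obtain ⟨K, hK, hanti⟩ := (L x₀).toLinearMap.exists_antilipschitzWith hker
  have hbound : ∀ c, ‖c‖ ≤ K * ‖L x₀ c‖ := fun c => by
    have := hanti.le_mul_dist c 0
    simpa using this
  obtain ⟨C₁, h1, h1'⟩ := exists_bound_chartCoord_le (E := E) x₀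
  obtain ⟨C₂, h2, h2'⟩ := exists_bound_rnorm_le (E := E) x₀
  have h3 : ∀ i, ∃ D, ∀ᶠ x in 𝓝 x₀, ‖chartCoord E x₀ x (b i x)‖ ≤ D :=
    fun i => (hbc i).exists_eventually_norm_le
  choose D hD using h3
  have hD' : ∀ᶠ x in 𝓝 x₀, ∀ i, ‖chartCoord E x₀ x (b i x)‖ ≤ D i := eventually_all.2 hD
  -- The coordinate map of the frame is bounded below at x₀; at nearby points half of that bound
  -- survives, whence the factor 2 in the constant.
  have hclose : ∀ᶠ x in 𝓝 x₀, K * ‖L x₀ - L x‖ < 1 / 2 := by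
    have h4 : ContinuousAt (fun x => K * ‖L x₀ - L x‖) x₀ :=
      continuousAt_const.mul (continuousAt_const.sub hL).norm
    refine h4.eventually_lt continuousAt_const ?_
    simp
  refine ⟨2 * (K * C₁) + C₂ * ∑ i, |D i|, by positivity, ?_⟩
  filter_upwards [h1', h2', hD', hclose] with x hx1 hx2 hx3 hx4
  refine ⟨fun c => ?_, fun i => ?_⟩
  · have h5 : ‖L x₀ c‖ ≤ ‖L x c‖ + ‖L x₀ - L x‖ * ‖c‖ := by
      have h6 : L x₀ c = L x c + (L x₀ - L x) c := by simp
      rw [h6]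
      exact (norm_add_le _ _).trans (add_le_add_right ((L x₀ - L x).le_opNorm c) _)
    have h7 : ‖L x c‖ ≤ C₁ * rnorm x (∑ i, c i • b i x) := by
      rw [hLapp]
      exact hx1 _
    have h8 : 0 ≤ rnorm x (∑ i, c i • b i x) := rnorm_nonneg _ _
    have h9 : 0 ≤ C₂ * (∑ i, |D i|) * rnorm x (∑ i, c i • b i x) := by positivity
    have h10 := mul_le_mul_of_nonneg_left (h5.trans (add_le_add_left h7 _)) K.coe_nonneg
    have h11 := mul_le_mul_of_nonneg_right hx4.le (norm_nonneg c)
    linarith [hbound c]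
  · refine (hx2 _).trans ?_
    have h5 : ‖chartCoord E x₀ x (b i x)‖ ≤ ∑ i, |D i| :=
      ((hx3 i).trans (le_abs_self _)).trans
        (Finset.single_le_sum (f := fun i => |D i|) (fun _ _ => abs_nonneg _) (Finset.mem_univ i))
    have h6 : 0 ≤ 2 * (K * C₁) := by positivity
    linarith [mul_le_mul_of_nonneg_left h5 h2.le]

end UniformBounds

/-! ## Anosov splittings -/

namespace AnosovFlow

section Splitting

variable {E : Type*} [NormedAddCommGroup E] [NormedSpace ℝ E]
variable {M : Type*} [MetricSpace M] [ChartedSpace E M] [IsManifold 𝓘(ℝ, E) ∞ M]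

theorem IsContinuousSubbundle.exists_frame
    {V : (x : M) → Submodule ℝ (TangentSpace 𝓘(ℝ, E) x)} (hV : IsContinuousSubbundle E V) :
    ∃ k : ℕ, ∀ x₀ : M, ∃ U ∈ 𝓝 x₀, ∃ p : Fin k → M → E,
      (∀ i, ContinuousAt (fun x : M => (⟨x, p i x⟩ : TangentBundle 𝓘(ℝ, E) M)) x₀) ∧
      ∀ x ∈ U, LinearIndependent ℝ (fun i => p i x) ∧ (∀ c : Fin k → ℝ, ∑ i, c i • p i x ∈ V x) ∧
        ∀ v : E, v ∈ V x → ∃ c : Fin k → ℝ, ∑ i, c i • p i x = v := by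
  obtain ⟨k, hk⟩ := hV
  refine ⟨k, fun x₀ => ?_⟩
  obtain ⟨U, hU, p, hp, h⟩ := hk x₀
  refine ⟨U, hU, p, fun i => (hp i).continuousAt hU, fun x hx => ⟨(h x hx).1, fun c => ?_,
    fun v hv => ?_⟩⟩
  · rw [← (h x hx).2]
    exact Submodule.sum_mem (M := TangentSpace 𝓘(ℝ, E) x) _ fun i _ =>
      Submodule.smul_mem (M := TangentSpace 𝓘(ℝ, E) x) _ (c i) (Submodule.subset_span ⟨i, rfl⟩)
  · rw [← (h x hx).2] at hv
    exact (Submodule.mem_span_range_iff_exists_fun (M := TangentSpace 𝓘(ℝ, E) x) ℝ).1 hv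

variable [RiemannianBundle (fun x : M => TangentSpace 𝓘(ℝ, E) x)]

namespace IsAnosovSplitting

variable {f : Flow ℝ M} {Eu Es : (x : M) → Submodule ℝ (TangentSpace 𝓘(ℝ, E) x)}

theorem exists_decomposition (hA : IsAnosovSplitting E f Eu Es) (x : M) (v : E) :
    ∃ u e : E, ∃ b : ℝ, u ∈ Eu x ∧ e ∈ Es x ∧ v = u + e + b • vel E f x := by
  have h1 := (hA.isInternal x).submodule_iSup_eq_top
  have h2 : (⨆ i, (![Eu x, Es x, Submodule.span ℝ {vectorField E f x}] :
      Fin 3 → Submodule ℝ (TangentSpace 𝓘(ℝ, E) x)) i) ≤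
      Eu x ⊔ Es x ⊔ Submodule.span ℝ {vectorField E f x} := by
    refine iSup_le fun i => ?_
    fin_cases i
    · exact le_sup_left.trans le_sup_left
    · exact le_sup_right.trans le_sup_left
    · exact le_sup_right
  rw [h1] at h2
  obtain ⟨y, hy, z, hz, hyz⟩ := Submodule.mem_sup.1 (h2 (Submodule.mem_top (x := v)))
  obtain ⟨u, hu, e, he, rfl⟩ := Submodule.mem_sup.1 hy
  obtain ⟨b, rfl⟩ := Submodule.mem_span_singleton.1 hz
  exact ⟨u, e, b, hu, he, hyz.symm⟩

theorem eq_zero_of_add_eq_zero (hA : IsAnosovSplitting E f Eu Es) {x : M} {u e : E} {b : ℝ}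
    (hu : u ∈ Eu x) (he : e ∈ Es x) (h : u + e + b • vel E f x = 0) : u = 0 ∧ e = 0 ∧ b = 0 := by
  have h1 := (hA.isInternal x).submodule_iSupIndep
  have hb : b • vel E f x ∈ Submodule.span ℝ {vectorField E f x} :=
    Submodule.smul_mem _ b (Submodule.mem_span_singleton_self (vectorField E f x))
  let A : Fin 3 → Submodule ℝ (TangentSpace 𝓘(ℝ, E) x) :=
    ![Eu x, Es x, Submodule.span ℝ {vectorField E f x}]
  have hle : ∀ i j : Fin 3, j ≠ i → A j ≤ ⨆ k, ⨆ (_ : k ≠ i), A k := fun i j hij =>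
    le_iSup₂_of_le j hij le_rfl
  have hu0 : u = 0 := by
    have h2 : u ∈ ⨆ k, ⨆ (_ : k ≠ (0 : Fin 3)), A k := by
      have h3 : u = -(e + b • vel E f x) := by
        rw [eq_neg_iff_add_eq_zero, ← add_assoc, h]
      rw [h3]
      exact Submodule.neg_mem _ (Submodule.add_mem _ (hle 0 1 (by decide) he)
        (hle 0 2 (by decide) hb))
    exact Submodule.disjoint_def.1 (h1 0) u hu h2
  have he0 : e = 0 := by
    have h2 : e ∈ ⨆ k, ⨆ (_ : k ≠ (1 : Fin 3)), A k := by
      have h3 : e = -(u + b • vel E f x) := by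
        rw [eq_neg_iff_add_eq_zero, ← h]
        abel
      rw [h3]
      exact Submodule.neg_mem _ (Submodule.add_mem _ (hle 1 0 (by decide) hu)
        (hle 1 2 (by decide) hb))
    exact Submodule.disjoint_def.1 (h1 1) e he h2
  refine ⟨hu0, he0, ?_⟩
  rw [hu0, he0, zero_add, zero_add] at h
  exact (smul_eq_zero.1 h).resolve_right (hA.vectorField_ne_zero x)

theorem decomposition_unique (hA : IsAnosovSplitting E f Eu Es) {x : M} {u e u' e' : E} {b b' : ℝ}
    (hu : u ∈ Eu x) (he : e ∈ Es x) (hu' : u' ∈ Eu x) (he' : e' ∈ Es x)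
    (h : u + e + b • vel E f x = u' + e' + b' • vel E f x) : u = u' ∧ e = e' ∧ b = b' := by
  have h1 := hA.eq_zero_of_add_eq_zero (u := u - u') (e := e - e') (b := b - b')
    (Submodule.sub_mem _ hu hu') (Submodule.sub_mem _ he he') (by
      rw [sub_smul, ← sub_eq_zero.2 h]
      abel)
  exact ⟨sub_eq_zero.1 h1.1, sub_eq_zero.1 h1.2.1, sub_eq_zero.1 h1.2.2⟩

theorem tmap_mem_unstable (hA : IsAnosovSplitting E f Eu Es) (t : ℝ) {x : M} {u : E}
    (hu : u ∈ Eu x) : tmap E (f t) x u ∈ Eu (f t x) := by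
  rw [← hA.map_unstable t x]
  exact ⟨u, hu, rfl⟩

theorem tmap_mem_stable (hA : IsAnosovSplitting E f Eu Es) (t : ℝ) {x : M} {e : E}
    (he : e ∈ Es x) : tmap E (f t) x e ∈ Es (f t x) := by
  rw [← hA.map_stable t x]
  exact ⟨e, he, rfl⟩

/-- The stable bundle is uniformly contracted. -/
theorem exists_contraction (hA : IsAnosovSplitting E f Eu Es) : ∃ C, 0 ≤ C ∧
    ∀ t : ℝ, 0 ≤ t → ∀ (x : M) (e : E), e ∈ Es x →
      rnorm (f t x) (tmap E (f t) x e) ≤ C * rnorm x e := by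
  obtain ⟨C, κ, hC, hκ, h⟩ := hA.contraction
  refine ⟨C, hC.le, fun t ht x e he => ?_⟩
  refine le_trans ((h t ht x).1 e he) ?_
  refine mul_le_mul_of_nonneg_right ?_ (rnorm_nonneg x e)
  refine mul_le_of_le_one_right hC.le (Real.exp_le_one_iff.2 ?_)
  nlinarith

variable [IsContMDiffRiemannianBundle 𝓘(ℝ, E) ∞ E (fun x : M => TangentSpace 𝓘(ℝ, E) x)]

/-- The components of a tangent vector in an Anosov splitting are bounded by its norm. -/
theorem exists_bound [CompactSpace M] (hA : IsAnosovSplitting E f Eu Es)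
    (hX : HasC1VectorField E f) : ∃ C, 0 ≤ C ∧ ∀ (x : M) (u e : E) (b : ℝ), u ∈ Eu x → e ∈ Es x →
      rnorm x u ≤ C * rnorm x (u + e + b • vel E f x) ∧
      rnorm x e ≤ C * rnorm x (u + e + b • vel E f x) ∧
      |b| ≤ C * rnorm x (u + e + b • vel E f x) := by
  have hle : ∀ (x : M) (v : E) (y a b : ℝ), a ≤ b → y ≤ a * rnorm x v → y ≤ b * rnorm x v :=
    fun x v y a b hab h => h.trans (mul_le_mul_of_nonneg_right hab (rnorm_nonneg x v))
  refine exists_bound_of_eventually (fun x a b hab h u e c hu he => ?_) fun x₀ => ?_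
  · obtain ⟨h1, h2, h3⟩ := h u e c hu he
    exact ⟨hle _ _ _ _ _ hab h1, hle _ _ _ _ _ hab h2, hle _ _ _ _ _ hab h3⟩
  obtain ⟨k, hk⟩ := hA.continuous_unstable.exists_frame
  obtain ⟨l, hl⟩ := hA.continuous_stable.exists_frame
  obtain ⟨U, hU, p, hp, hpU⟩ := hk x₀
  obtain ⟨V, hV, q, hq, hqV⟩ := hl x₀
  let B : Fin k ⊕ Fin l ⊕ Unit → M → E :=
    Sum.elim (fun i x => p i x) (Sum.elim (fun i x => q i x) fun _ x => vel E f x)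
  have hsum : ∀ (c : Fin k ⊕ Fin l ⊕ Unit → ℝ) (x : M), ∑ i, c i • B i x =
      (∑ i, c (Sum.inl i) • p i x) + (∑ i, c (Sum.inr (Sum.inl i)) • q i x) +
        c (Sum.inr (Sum.inr ())) • vel E f x := fun c x => by
    simp [B, Fintype.sum_sum_type, add_assoc]
  have hB : ∀ i, ContinuousAt (fun x => (⟨x, B i x⟩ : TangentBundle 𝓘(ℝ, E) M)) x₀ := by
    rintro (i | i | i)
    · exact hp i
    · exact hq i
    · exact hX.continuous.continuousAt
  have hli : LinearIndependent ℝ fun i => B i x₀ := by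
    rw [Fintype.linearIndependent_iff]
    intro c hc
    rw [hsum] at hc
    obtain ⟨h1, h2, h3⟩ := hA.eq_zero_of_add_eq_zero ((hpU x₀ (mem_of_mem_nhds hU)).2.1 _)
      ((hqV x₀ (mem_of_mem_nhds hV)).2.1 _) hc
    rintro (i | i | i)
    · exact Fintype.linearIndependent_iff.1 (hpU x₀ (mem_of_mem_nhds hU)).1 _ h1 i
    · exact Fintype.linearIndependent_iff.1 (hqV x₀ (mem_of_mem_nhds hV)).1 _ h2 i
    · exact h3
  obtain ⟨C, hC, hev⟩ := exists_bound_frame hB hli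
  have hrsum : ∀ {ι : Type} (s : Finset ι) (x : M) (g : ι → E),
      rnorm x (∑ i ∈ s, g i) ≤ ∑ i ∈ s, rnorm x (g i) := fun s x g =>
    norm_sum_le (E := TangentSpace 𝓘(ℝ, E) x) s g
  -- C bounds the coefficients. A component is a sum of k or l terms, each a coefficient times a
  -- frame vector of norm at most C.
  refine ⟨C + (k + l) * C * C, ?_⟩
  filter_upwards [hev, hU, hV] with x hx hxU hxV u e b hu he
  obtain ⟨c, hc⟩ := (hpU x hxU).2.2 u hu
  obtain ⟨d, hd⟩ := (hqV x hxV).2.2 e he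
  let a : Fin k ⊕ Fin l ⊕ Unit → ℝ := Sum.elim c (Sum.elim d fun _ => b)
  have h1 := hx.1 a
  rw [hsum] at h1
  simp only [a, Sum.elim_inl, Sum.elim_inr, hc, hd] at h1
  change ‖a‖ ≤ _ at h1
  set N := rnorm x (u + e + b • vel E f x)
  have hN : 0 ≤ N := rnorm_nonneg _ _
  have hcoef : ∀ i, |a i| ≤ C * N := fun i => (norm_le_pi_norm a i).trans h1
  have hterm : ∀ i, rnorm x (a i • B i x) ≤ C * C * N := fun i => by
    rw [rnorm_smul]
    calc |a i| * rnorm x (B i x) ≤ (C * N) * C :=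
          mul_le_mul (hcoef i) (hx.2 i) (rnorm_nonneg _ _) (by positivity)
      _ = C * C * N := by ring
  have hCC : 0 ≤ C * C * N := by positivity
  have hCN : 0 ≤ C * N := by positivity
  have hk0 : (0 : ℝ) ≤ k := by positivity
  have hl0 : (0 : ℝ) ≤ l := by positivity
  have hkC := mul_nonneg hk0 hCC
  have hlC := mul_nonneg hl0 hCC
  refine ⟨?_, ?_, ?_⟩
  · rw [← hc]
    refine (hrsum _ _ _).trans ((Finset.sum_le_sum fun i _ => hterm (Sum.inl i)).trans ?_)
    simp only [Finset.sum_const, Finset.card_univ, Fintype.card_fin, nsmul_eq_mul]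
    linarith
  · rw [← hd]
    refine (hrsum _ _ _).trans ((Finset.sum_le_sum fun i _ => hterm (Sum.inr (Sum.inl i))).trans ?_)
    simp only [Finset.sum_const, Finset.card_univ, Fintype.card_fin, nsmul_eq_mul]
    linarith
  · have := hcoef (Sum.inr (Sum.inr ()))
    have h2 : a (Sum.inr (Sum.inr ())) = b := rfl
    rw [h2] at this
    linarith

end IsAnosovSplitting

end Splitting

end AnosovFlow

/-! ## The functional dual to the unstable direction -/

namespace AnosovFlow

namespace TimeChangeData

variable {E : Type*} [NormedAddCommGroup E] [NormedSpace ℝ E]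
variable {M : Type*} [MetricSpace M] [ChartedSpace E M] [IsManifold 𝓘(ℝ, E) ∞ M]
variable {f φ φ' : Flow ℝ M} {lam : ℝ} {τ : M → ℝ → ℝ} {sStar : ℝ → ℝ → M → ℝ}

theorem tmap_vel_phi' (h : TimeChangeData E f φ φ' lam τ sStar) (t : ℝ) (x : M) :
    tmap E (f t) x (vel E φ' x) = lam ^ t • vel E φ' (f t x) :=
  h.reparam.c1'.tmap_vel h.reparam.c1' (h.c1.mdifferentiableAt t x) (κ := fun s => lam ^ t * s)
    (mul_zero _) (by simpa using (hasDerivAt_id (0 : ℝ)).const_mul (lam ^ t))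
    (fun s => h.expanding.commutation t s x)

theorem tendsto_lam_rpow_neg (h : TimeChangeData E f φ φ' lam τ sStar) :
    Tendsto (fun t : ℝ => lam ^ (-t)) atTop (𝓝 0) := by
  have h1 : Tendsto (fun t : ℝ => Real.log lam * -t) atTop atBot :=
    tendsto_neg_atTop_atBot.const_mul_atBot (Real.log_pos h.expanding.one_lt)
  refine (Real.tendsto_exp_atBot.comp h1).congr fun t => ?_
  rw [Real.rpow_def_of_pos h.lam_pos]
  rfl

variable [RiemannianBundle (fun x : M => TangentSpace 𝓘(ℝ, E) x)]

theorem rnorm_vel_phi'_pos (h : TimeChangeData E f φ φ' lam τ sStar) (x : M) :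
    0 < rnorm x (vel E φ' x) :=
  lt_of_le_of_ne (rnorm_nonneg _ _) fun h0 => h.vel_phi'_ne_zero x (rnorm_eq_zero.1 h0.symm)

variable [IsContMDiffRiemannianBundle 𝓘(ℝ, E) ∞ E (fun x : M => TangentSpace 𝓘(ℝ, E) x)]

theorem continuous_rnorm_vel_phi' [FiniteDimensional ℝ E]
    (h : TimeChangeData E f φ φ' lam τ sStar) :
    Continuous fun x => rnorm x (vel E φ' x) := by
  have h1 : (fun x => rnorm x (vel E φ' x)) = fun x => rho τ x * rnorm x (vel E φ x) :=
    funext fun x => by rw [h.vel_phi'_eq, rnorm_smul, abs_of_pos (h.rho_pos x)]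
  rw [h1]
  exact h.continuous_rho.mul (continuous_rnorm h.data.c1_vectorField'.continuous)

variable [FiniteDimensional ℝ E] [CompactSpace M]
  {Eu Es : (x : M) → Submodule ℝ (TangentSpace 𝓘(ℝ, E) x)}

/-- Under f_{-t} the vector X_φ' shrinks like λ^{-t}. Its X_f-coefficient is invariant, and its
stable part is recovered from f_{-t} by a map bounded in t, so both must be zero. -/
theorem vel_phi'_mem (h : TimeChangeData E f φ φ' lam τ sStar) (hA : IsAnosovSplitting E f Eu Es)
    (x : M) : vel E φ' x ∈ Eu x := by
  obtain ⟨C, hC, hbound⟩ := hA.exists_bound h.data.c1_vectorField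
  obtain ⟨C', hC', hcontr⟩ := hA.exists_contraction
  obtain ⟨D, hD, hDb⟩ := exists_bound_of_continuous h.continuous_rnorm_vel_phi'
  obtain ⟨u, e, b, hu, he, hv⟩ := hA.exists_decomposition x (vel E φ' x)
  have hest : ∀ t : ℝ, 0 ≤ t → rnorm x e ≤ C' * (C * (lam ^ (-t) * D)) ∧
      |b| ≤ C * (lam ^ (-t) * D) := by
    intro t ht
    have h1 : tmap E (f (-t)) x u + tmap E (f (-t)) x e + b • vel E f (f (-t) x) =
        lam ^ (-t) • vel E φ' (f (-t) x) := by
      rw [← h.tmap_vel_phi', hv, map_add, map_add, map_smul, h.c1.tmap_vel_self]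
    obtain ⟨-, h2, h3⟩ := hbound (f (-t) x) _ _ b (hA.tmap_mem_unstable (-t) hu)
      (hA.tmap_mem_stable (-t) he)
    have h4 : rnorm (f (-t) x) (lam ^ (-t) • vel E φ' (f (-t) x)) ≤ lam ^ (-t) * D := by
      have hpos := Real.rpow_pos_of_pos h.lam_pos (-t)
      rw [rnorm_smul, abs_of_pos hpos]
      exact mul_le_mul_of_nonneg_left ((le_abs_self _).trans (hDb _)) hpos.le
    rw [h1] at h2 h3
    have h5 := mul_le_mul_of_nonneg_left h4 hC
    refine ⟨?_, h3.trans h5⟩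
    have h6 := hcontr t ht (f (-t) x) _ (hA.tmap_mem_stable (-t) he)
    have h7 : f t (f (-t) x) = x := by rw [← f.map_add, add_neg_cancel, f.map_zero_apply]
    have h8 : tmap E (f t) (f (-t) x) (tmap E (f (-t)) x e) = e := by
      rw [← tmap_comp (h.c1.mdifferentiableAt t _) (h.c1.mdifferentiableAt (-t) x)]
      have : (fun y => f t (f (-t) y)) = id := funext fun y => by
        rw [← f.map_add, add_neg_cancel, f.map_zero_apply, id]
      rw [this, tmap_id]
    rw [h8, h7] at h6
    exact h6.trans (mul_le_mul_of_nonneg_left (h2.trans h5) hC')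
  have hlim := (h.tendsto_lam_rpow_neg.mul_const D).const_mul C
  rw [zero_mul, mul_zero] at hlim
  have hb : b = 0 := by
    refine abs_nonpos_iff.1 (ge_of_tendsto hlim ?_)
    filter_upwards [eventually_ge_atTop 0] with t ht using (hest t ht).2
  have he0 : e = 0 := by
    have hlim' := hlim.const_mul C'
    rw [mul_zero] at hlim'
    refine (rnorm_eq_zero (x := x)).1 (le_antisymm (ge_of_tendsto hlim' ?_) (rnorm_nonneg _ _))
    filter_upwards [eventually_ge_atTop 0] with t ht using (hest t ht).1
  rw [hv, hb, he0, add_zero, zero_smul, add_zero]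
  exact hu

/-- The linear functional with value `1` on the velocity of `φ'` that vanishes on the weak stable
bundle. -/
theorem exists_unstable_functional (h : TimeChangeData E f φ φ' lam τ sStar)
    (hA : IsAnosovSplitting E f Eu Es) (hfin : ∀ x, Module.finrank ℝ (Eu x) = 1) :
    ∃ (α : M → E →ₗ[ℝ] ℝ) (C : ℝ), 0 ≤ C ∧ (∀ x v, |α x v| ≤ C * rnorm x v) ∧
      (∀ x, α x (vel E φ' x) = 1) ∧
      (∀ t x v, α (f t x) (tmap E (f t) x v) = lam ^ t * α x v) ∧
      ∀ t, 0 ≤ t → ∀ x v,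
        rnorm (f t x) (tmap E (f t) x (v - α x v • vel E φ' x)) ≤ C * rnorm x v := by
  obtain ⟨C, hC, hbound⟩ := hA.exists_bound h.data.c1_vectorField
  obtain ⟨C', hC', hcontr⟩ := hA.exists_contraction
  obtain ⟨D, hD, hDb⟩ := exists_bound_of_continuous
    (h.continuous_rnorm_vel_phi'.inv₀ fun x => (h.rnorm_vel_phi'_pos x).ne')
  obtain ⟨D', hD', hDb'⟩ := exists_bound_of_continuous
    (continuous_rnorm h.data.c1_vectorField.continuous)
  have hspan : ∀ (x : M) (u : E), u ∈ Eu x → ∃ a : ℝ, u = a • vel E φ' x := by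
    intro x u hu
    have h1 := (finrank_eq_one_iff_of_nonzero' (K := ℝ) (V := Eu x)
      ⟨vel E φ' x, h.vel_phi'_mem hA x⟩ (fun h0 => h.vel_phi'_ne_zero x
        (congrArg Subtype.val h0))).1 (hfin x) ⟨u, hu⟩
    obtain ⟨a, ha⟩ := h1
    exact ⟨a, (congrArg Subtype.val ha).symm⟩
  have hmem : ∀ (x : M) (a : ℝ), a • vel E φ' x ∈ Eu x := fun x a =>
    Submodule.smul_mem (M := TangentSpace 𝓘(ℝ, E) x) _ a (h.vel_phi'_mem hA x)
  -- As the unstable bundle is a line spanned by X_φ', the unstable component becomes a scalar;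
  -- uniqueness of the decomposition makes it linear in v and equivariant under f.
  have hdec : ∀ (x : M) (v : E), ∃ (a : ℝ) (e : E) (b : ℝ), e ∈ Es x ∧
      v = a • vel E φ' x + e + b • vel E f x := by
    intro x v
    obtain ⟨u, e, b, hu, he, hv⟩ := hA.exists_decomposition x v
    obtain ⟨a, rfl⟩ := hspan x u hu
    exact ⟨a, e, b, he, hv⟩
  choose a e b he hv using hdec
  have huniq : ∀ (x : M) (v : E) (a' : ℝ) (e' : E) (b' : ℝ), e' ∈ Es x →
      v = a' • vel E φ' x + e' + b' • vel E f x → a x v = a' := by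
    intro x v a' e' b' he' hv'
    have h1 := (hA.decomposition_unique (hmem x _) (he x v) (hmem x a') he'
      ((hv x v).symm.trans hv')).1
    exact smul_left_injective ℝ (h.vel_phi'_ne_zero x) h1
  have hlin : ∀ x, IsLinearMap ℝ (a x) := fun x =>
    { map_add := fun v w => huniq x _ _ (e x v + e x w) (b x v + b x w)
        (Submodule.add_mem (M := TangentSpace 𝓘(ℝ, E) x) _ (he x v) (he x w)) (by
          conv_lhs => rw [hv x v, hv x w]
          rw [add_smul, add_smul]
          abel)
      map_smul := fun c v => huniq x _ _ (c • e x v) (c * b x v)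
        (Submodule.smul_mem (M := TangentSpace 𝓘(ℝ, E) x) _ c (he x v)) (by
          conv_lhs => rw [hv x v]
          rw [smul_eq_mul, smul_add, smul_add, smul_smul, smul_smul]) }
  let α : M → E →ₗ[ℝ] ℝ := fun x => (hlin x).mk' (a x)
  have hN : ∀ x v, rnorm x (a x v • vel E φ' x) ≤ C * rnorm x v ∧
      rnorm x (e x v) ≤ C * rnorm x v ∧ |b x v| ≤ C * rnorm x v := fun x v => by
    have h1 := hbound x (a x v • vel E φ' x) (e x v) (b x v) (hmem x _) (he x v)
    rwa [← hv x v] at h1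
  -- C·D bounds the functional, D being a bound for 1/‖X_φ'‖. The other two terms bound the forward
  -- images of the stable component and of the X_f-component.
  refine ⟨α, C * D + (C' * C + C * D'), by positivity, fun x v => ?_, fun x => ?_, fun t x v => ?_,
    fun t ht x v => ?_⟩
  · change |a x v| ≤ _
    have h1 := (hN x v).1
    rw [rnorm_smul] at h1
    have h2 : |a x v| = |a x v| * rnorm x (vel E φ' x) * (rnorm x (vel E φ' x))⁻¹ := by
      rw [mul_assoc, mul_inv_cancel₀ (h.rnorm_vel_phi'_pos x).ne', mul_one]
    have h3 : (rnorm x (vel E φ' x))⁻¹ ≤ D := (le_abs_self _).trans (hDb x)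
    have h4 : |a x v| ≤ C * rnorm x v * D := by
      rw [h2]
      exact mul_le_mul h1 h3 (inv_nonneg.2 (rnorm_nonneg _ _))
        (mul_nonneg hC (rnorm_nonneg _ _))
    have h5 : 0 ≤ (C' * C + C * D') * rnorm x v := mul_nonneg (by positivity) (rnorm_nonneg _ _)
    linarith
  · exact huniq x _ 1 0 0 (Submodule.zero_mem (M := TangentSpace 𝓘(ℝ, E) x) _) (by simp)
  · refine huniq (f t x) _ _ (tmap E (f t) x (e x v)) (b x v) (hA.tmap_mem_stable t (he x v)) ?_
    conv_lhs => rw [hv x v]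
    rw [map_add, map_add, map_smul, map_smul, h.c1.tmap_vel_self, h.tmap_vel_phi', smul_smul,
      mul_comm]
    rfl
  · have h1 : v - α x v • vel E φ' x = e x v + b x v • vel E f x := by
      change v - a x v • vel E φ' x = _
      conv_lhs => enter [1]; rw [hv x v]
      abel
    rw [h1, map_add, map_smul, h.c1.tmap_vel_self]
    obtain ⟨h2, h3, h4⟩ := hN x v
    refine (rnorm_add_le _ _ _).trans ?_
    rw [rnorm_smul]
    have h5 := hcontr t ht x (e x v) (he x v)
    have h6 := mul_le_mul_of_nonneg_left h3 hC'
    have h7 : |b x v| * rnorm (f t x) (vel E f (f t x)) ≤ (C * rnorm x v) * D' :=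
      mul_le_mul h4 ((le_abs_self _).trans (hDb' _)) (rnorm_nonneg _ _)
        (mul_nonneg hC (rnorm_nonneg _ _))
    have h8 : 0 ≤ (C * D) * rnorm x v := mul_nonneg (by positivity) (rnorm_nonneg _ _)
    linarith

end TimeChangeData

end AnosovFlow

/-! ## Equicontinuity of averages along expanding orbits -/

/-- Integration by parts, in the absolutely continuous sense because a is only Lipschitz. The gain
is that only the size of g enters: 2A comes from the boundary terms and L from a'. Here g will have
an s-derivative that grows with t. -/
theorem abs_integral_mul_deriv_le {a g : ℝ → ℝ} {L A B : ℝ} (hL : 0 ≤ L)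
    (haA : ∀ s ∈ Icc (0 : ℝ) 1, |a s| ≤ A)
    (haL : ∀ s ∈ Icc (0 : ℝ) 1, ∀ r ∈ Icc (0 : ℝ) 1, s ≤ r → |a r - a s| ≤ L * (r - s))
    (hg : ContDiff ℝ 1 g) (hgB : ∀ s, |g s| ≤ B) :
    |∫ s in (0 : ℝ)..1, a s * deriv g s| ≤ (2 * A + L) * B := by
  lift L to ℝ≥0 using hL
  have hlip : LipschitzOnWith L a (uIcc 0 1) := by
    rw [uIcc_of_le zero_le_one]
    refine LipschitzOnWith.of_dist_le_mul fun s hs r hr => ?_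
    rcases le_total s r with hsr | hsr
    · rw [dist_comm, Real.dist_eq, dist_comm, Real.dist_eq, abs_of_nonneg (sub_nonneg.2 hsr)]
      exact haL s hs r hr hsr
    · rw [Real.dist_eq, Real.dist_eq, abs_of_nonneg (sub_nonneg.2 hsr)]
      exact haL r hr s hs hsr
  rw [hlip.absolutelyContinuousOnInterval.integral_mul_deriv_eq_deriv_mul
    hg.contDiffOn.absolutelyContinuousOnInterval]
  have hB : 0 ≤ B := (abs_nonneg _).trans (hgB 0)
  have h1 : ‖∫ s in (0 : ℝ)..1, deriv a s * g s‖ ≤ L * B * |1 - 0| := by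
    refine intervalIntegral.norm_integral_le_of_norm_le_const_ae ?_
    have hne : ∀ᵐ s : ℝ, s ≠ 1 := by simp [ae_iff]
    filter_upwards [hne] with s hs1 hs
    rw [uIoc_of_le zero_le_one] at hs
    have h2 : ‖deriv a s‖ ≤ L := by
      refine norm_deriv_le_of_lipschitzOn (s := uIcc 0 1) ?_ hlip
      rw [uIcc_of_le zero_le_one]
      exact Icc_mem_nhds hs.1 (lt_of_le_of_ne hs.2 hs1)
    rw [norm_mul]
    exact mul_le_mul h2 (hgB s) (norm_nonneg _) L.coe_nonneg
  rw [sub_zero, abs_one, mul_one, Real.norm_eq_abs] at h1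
  have h2 : ∀ s ∈ Icc (0 : ℝ) 1, |a s * g s| ≤ A * B := fun s hs => by
    rw [abs_mul]
    exact mul_le_mul (haA s hs) (hgB s) (abs_nonneg _) ((abs_nonneg _).trans (haA s hs))
  have h3 := h2 0 (left_mem_Icc.2 zero_le_one)
  have h4 := h2 1 (right_mem_Icc.2 zero_le_one)
  rw [abs_le] at h1 h3 h4 ⊢
  constructor <;> linarith [h1.1, h1.2, h3.1, h3.2, h4.1, h4.2]

namespace AnosovFlow

namespace TimeChangeData

variable {E : Type*} [NormedAddCommGroup E] [NormedSpace ℝ E]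
variable {M : Type*} [MetricSpace M] [ChartedSpace E M] [IsManifold 𝓘(ℝ, E) ∞ M]
variable {f φ φ' : Flow ℝ M} {lam : ℝ} {τ : M → ℝ → ℝ} {sStar : ℝ → ℝ → M → ℝ}

theorem contMDiff_comp_flow_phi' (h : TimeChangeData E f φ φ' lam τ sStar) {θ : M → ℝ}
    (hθ : ContMDiff 𝓘(ℝ, E) 𝓘(ℝ, ℝ) 1 θ) (t : ℝ) :
    ContMDiff (𝓘(ℝ, ℝ).prod 𝓘(ℝ, E)) 𝓘(ℝ, ℝ) 1 (fun p : ℝ × M => θ (f t (φ' p.1 p.2))) :=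
  hθ.comp ((h.c1.contMDiff_apply t).comp h.reparam.c1')

variable [RiemannianBundle (fun x : M => TangentSpace 𝓘(ℝ, E) x)]

/-- Along the flow `φ'`, the functional dual to the unstable direction is Lipschitz. -/
theorem abs_functional_sub_le (h : TimeChangeData E f φ φ' lam τ sStar)
    {α : M → E →ₗ[ℝ] ℝ} {C B : ℝ} (hC : 0 ≤ C) (hB : 0 ≤ B)
    (hα : ∀ x v, |α x v| ≤ C * rnorm x v) (hα1 : ∀ x, α x (vel E φ' x) = 1)
    (hαf : ∀ t x v, α (f t x) (tmap E (f t) x v) = lam ^ t * α x v)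
    (hcontr : ∀ t, 0 ≤ t → ∀ x v,
      rnorm (f t x) (tmap E (f t) x (v - α x v • vel E φ' x)) ≤ C * rnorm x v)
    (hφ' : ∀ (x : M) (v : E), rnorm (φ' 1 x) (tmap E (φ' 1) x v) ≤ B * rnorm x v)
    {r : ℝ} (hr : 0 ≤ r) (hr1 : r ≤ 1) (x : M) (w : E) :
    |α (φ' r x) (tmap E (φ' r) x w) - α x w| ≤ C * (B + 1) * C * r * rnorm x w := by
  rcases hr.eq_or_lt with rfl | hr
  · have h1 : (φ' 0 : M → M) = id := funext fun y => φ'.map_zero_apply y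
    rw [h1, tmap_id]
    simp
  -- The renormalising time: λ^t r = 1, so f_t conjugates φ'_r to φ'_1, whose tangent map is bounded
  -- by B. Here r ≤ 1 makes t nonnegative.
  set t := -Real.logb lam r with ht
  have hlt : lam ^ t * r = 1 := by
    rw [ht, Real.rpow_neg h.lam_pos.le, Real.rpow_logb h.lam_pos h.expanding.one_lt.ne' hr,
      inv_mul_cancel₀ hr.ne']
  have ht0 : 0 ≤ t := by
    rw [ht, Left.nonneg_neg_iff]
    exact Real.logb_nonpos h.expanding.one_lt hr.le hr1
  have hmd : ∀ s y, MDifferentiableAt 𝓘(ℝ, E) 𝓘(ℝ, E) (φ' s) y :=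
    fun s y => h.reparam.c1'.mdifferentiableAt s y
  have hfd : ∀ s y, MDifferentiableAt 𝓘(ℝ, E) 𝓘(ℝ, E) (f s) y :=
    fun s y => h.c1.mdifferentiableAt s y
  have hcomm : ∀ w', tmap E (f t) (φ' r x) (tmap E (φ' r) x w') =
      tmap E (φ' 1) (f t x) (tmap E (f t) x w') := fun w' => by
    rw [← tmap_comp (hfd _ _) (hmd _ _), ← tmap_comp (hmd _ _) (hfd _ _)]
    have h2 : (fun y => f t (φ' r y)) = fun y => φ' 1 (f t y) := funext fun y => by
      rw [h.expanding.commutation, hlt]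
    rw [h2]
  have hpt : f t (φ' r x) = φ' 1 (f t x) := by rw [h.expanding.commutation, hlt]
  set w' := w - α x w • vel E φ' x with hw'
  -- The component along X_φ' drops out: φ' carries X_φ' to itself and α equals 1 on it. Only the
  -- weak stable part w' remains, which f_t does not expand.
  have h1 : α (φ' r x) (tmap E (φ' r) x w) - α x w =
      α (φ' r x) (tmap E (φ' r) x w') - α x w' := by
    rw [hw', map_sub, map_sub, map_sub, map_smul, map_smul, map_smul,
      h.reparam.c1'.tmap_vel_self, hα1, hα1]
    ring
  have h2 : lam ^ t * (α (φ' r x) (tmap E (φ' r) x w') - α x w') =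
      α (φ' 1 (f t x)) (tmap E (φ' 1) (f t x) (tmap E (f t) x w')) -
        α (f t x) (tmap E (f t) x w') := by
    rw [mul_sub, ← hαf, ← hαf, hcomm, hpt]
  -- Since f_t multiplies α by λ^t = 1/r, returning from the unit scale costs a factor r, and this
  -- factor is the Lipschitz bound.
  have h3 : α (φ' r x) (tmap E (φ' r) x w') - α x w' =
      r * (α (φ' 1 (f t x)) (tmap E (φ' 1) (f t x) (tmap E (f t) x w')) -
        α (f t x) (tmap E (f t) x w')) := by
    rw [← h2, ← mul_assoc, mul_comm r, hlt, one_mul]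
  have h4 := hcontr t ht0 x w
  rw [← hw'] at h4
  have h5 := hα (f t x) (tmap E (f t) x w')
  have h6 := (hα (φ' 1 (f t x)) (tmap E (φ' 1) (f t x) (tmap E (f t) x w'))).trans
    (mul_le_mul_of_nonneg_left (hφ' _ _) hC)
  rw [h1, h3, abs_mul, abs_of_pos hr]
  have h7 := (abs_sub _ _).trans (add_le_add h6 h5)
  have h8 : C * (B * rnorm (f t x) (tmap E (f t) x w')) + C * rnorm (f t x) (tmap E (f t) x w') ≤
      C * (B + 1) * (C * rnorm x w) := by
    have := mul_le_mul_of_nonneg_left h4 (show 0 ≤ C * (B + 1) by positivity)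
    linarith
  have h9 := mul_le_mul_of_nonneg_left (h7.trans h8) hr.le
  linarith

variable [IsContMDiffRiemannianBundle 𝓘(ℝ, E) ∞ E (fun x : M => TangentSpace 𝓘(ℝ, E) x)]
  [FiniteDimensional ℝ E] [CompactSpace M]
  {Eu Es : (x : M) → Submodule ℝ (TangentSpace 𝓘(ℝ, E) x)}

/-- The averages `y ↦ ∫₀¹ θ (f_t (φ'_s y)) ds`, `t ≥ 0`, have uniformly bounded derivatives. -/
theorem exists_bound_dirDeriv_average (h : TimeChangeData E f φ φ' lam τ sStar)
    (hA : IsAnosovSplitting E f Eu Es) (hfin : ∀ x, Module.finrank ℝ (Eu x) = 1) {θ : M → ℝ}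
    (hθ : ContMDiff 𝓘(ℝ, E) 𝓘(ℝ, ℝ) 1 θ) : ∃ K, 0 ≤ K ∧ ∀ t, 0 ≤ t → ∀ (y : M) (v : E),
      |dirDeriv E (fun y => ∫ s in (0 : ℝ)..1, θ (f t (φ' s y))) y v| ≤ K * rnorm y v := by
  obtain ⟨α, C, hC, hα, hα1, hαf, hcontr⟩ := h.exists_unstable_functional hA hfin
  obtain ⟨B, hB, hφ'⟩ := exists_bound_tmap (E := E) (Φ := fun s => φ' s) h.reparam.c1'
  obtain ⟨D, hD, hDθ⟩ := exists_bound_dirDeriv hθ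
  obtain ⟨S, hS, hSθ⟩ := exists_bound_of_continuous hθ.continuous
  have hmd : ∀ s y, MDifferentiableAt 𝓘(ℝ, E) 𝓘(ℝ, E) (φ' s) y :=
    fun s y => h.reparam.c1'.mdifferentiableAt s y
  have hfd : ∀ s y, MDifferentiableAt 𝓘(ℝ, E) 𝓘(ℝ, E) (f s) y :=
    fun s y => h.c1.mdifferentiableAt s y
  have hθd : ∀ y, MDifferentiableAt 𝓘(ℝ, E) 𝓘(ℝ, ℝ) θ y :=
    fun y => hθ.mdifferentiable (by norm_num) y
  -- The first term bounds the weak stable contribution. The second is (2A + L)·sup|θ| from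
  -- integration by parts with A = CB and L = C(B+1)CB. Neither depends on t.
  refine ⟨D * (C * B) + (2 * (C * B) + C * (B + 1) * C * B) * S, by positivity,
    fun t ht y v => ?_⟩
  set N := rnorm y v with hN
  have hN0 : 0 ≤ N := rnorm_nonneg _ _
  let z : ℝ → M := fun s => φ' s y
  let w : ℝ → E := fun s => tmap E (φ' s) y v
  let a : ℝ → ℝ := fun s => α (z s) (w s)
  let g : ℝ → ℝ := fun s => θ (f t (z s))
  let G : ℝ → ℝ := fun s => dirDeriv E θ (f t (z s)) (tmap E (f t) (z s) (w s - a s • vel E φ' (z s)))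
  have hw : ∀ s ∈ Icc (0 : ℝ) 1, rnorm (z s) (w s) ≤ B * N := fun s hs => hφ' s hs y v
  have hg : ContDiff ℝ 1 g := by
    have h1 : ContMDiff 𝓘(ℝ, ℝ) 𝓘(ℝ, ℝ) 1 g :=
      (h.contMDiff_comp_flow_phi' hθ t).comp (contMDiff_id.prodMk contMDiff_const)
    exact h1.contDiff
  have hg' : ∀ s, deriv g s = dirDeriv E θ (f t (z s)) (tmap E (f t) (z s) (vel E φ' (z s))) :=
    fun s => (((h.reparam.c1'.hasVelocityAt y s).comp (hfd t _)).hasDerivAt (hθd _)).deriv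
  -- The transported vector is split into its weak stable part, giving G, and a(s)X_φ'.
  -- Differentiating θ∘f_t along X_φ' is differentiating in s, which is what can be integrated by
  -- parts.
  have hsplit : ∀ s, dirDeriv E (fun y => θ (f t (φ' s y))) y v = G s + a s * deriv g s := fun s => by
    have h1 : dirDeriv E (fun y => θ (f t (φ' s y))) y v =
        dirDeriv E θ (f t (z s)) (tmap E (f t) (z s) (w s)) := by
      rw [dirDeriv_comp (ψ := θ) (Φ := fun y => f t (φ' s y)) (hθd _)
        ((hfd t _).comp y (hmd s y)), tmap_comp (hfd t _) (hmd s y)]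
    rw [h1, hg', ← smul_eq_mul, ← map_smul, ← map_smul, ← map_add, ← map_add, sub_add_cancel]
  rw [dirDeriv_intervalIntegral (E := E) (F := fun s y => θ (f t (φ' s y)))
    (h.contMDiff_comp_flow_phi' hθ t)]
  simp only [hsplit]
  have hGb : ∀ s ∈ Icc (0 : ℝ) 1, |G s| ≤ D * (C * (B * N)) := fun s hs => by
    refine (hDθ _ _).trans (mul_le_mul_of_nonneg_left ?_ hD)
    exact (hcontr t ht (z s) (w s)).trans (mul_le_mul_of_nonneg_left (hw s hs) hC)
  have haA : ∀ s ∈ Icc (0 : ℝ) 1, |a s| ≤ C * (B * N) := fun s hs =>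
    (hα _ _).trans (mul_le_mul_of_nonneg_left (hw s hs) hC)
  have haL : ∀ s ∈ Icc (0 : ℝ) 1, ∀ r ∈ Icc (0 : ℝ) 1, s ≤ r →
      |a r - a s| ≤ C * (B + 1) * C * (B * N) * (r - s) := by
    intro s hs r hr hsr
    have h1 := h.abs_functional_sub_le hC hB hα hα1 hαf hcontr
      (hφ' 1 (right_mem_Icc.2 zero_le_one)) (sub_nonneg.2 hsr)
      (by linarith [hs.1, hr.2]) (z s) (w s)
    have h2 : (fun y => φ' (r - s) (φ' s y)) = φ' r := funext fun y => by
      rw [← φ'.map_add, sub_add_cancel]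
    have h3 : φ' (r - s) (z s) = z r := congrFun h2 y
    have h4 : tmap E (φ' (r - s)) (z s) (w s) = w r := by
      rw [← tmap_comp (hmd _ _) (hmd _ _), h2]
    rw [h3, h4] at h1
    have h5 := mul_le_mul_of_nonneg_left (hw s hs)
      (mul_nonneg (show 0 ≤ C * (B + 1) * C by positivity) (sub_nonneg.2 hsr))
    refine h1.trans ?_
    linarith
  have hL0 : 0 ≤ C * (B + 1) * C * (B * N) := by positivity
  have h1 := abs_integral_mul_deriv_le hL0 haA haL hg (fun s => hSθ _)
  have h2 : ‖∫ s in (0 : ℝ)..1, G s‖ ≤ D * (C * (B * N)) * |1 - 0| := by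
    refine intervalIntegral.norm_integral_le_of_norm_le_const fun s hs => ?_
    rw [uIoc_of_le zero_le_one] at hs
    exact hGb s ⟨hs.1.le, hs.2⟩
  rw [sub_zero, abs_one, mul_one, Real.norm_eq_abs] at h2
  have hac : ContinuousOn a (uIcc 0 1) := by
    have : LipschitzOnWith ⟨_, hL0⟩ a (uIcc 0 1) := by
      rw [uIcc_of_le zero_le_one]
      refine LipschitzOnWith.of_dist_le_mul fun s hs r hr => ?_
      rcases le_total s r with hsr | hsr
      · rw [dist_comm, Real.dist_eq, dist_comm, Real.dist_eq, abs_of_nonneg (sub_nonneg.2 hsr)]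
        exact haL s hs r hr hsr
      · rw [Real.dist_eq, Real.dist_eq, abs_of_nonneg (sub_nonneg.2 hsr)]
        exact haL r hr s hs hsr
    exact this.continuousOn
  have hint : IntervalIntegrable (fun s => a s * deriv g s) volume 0 1 :=
    (hac.mul (hg.continuous_deriv le_rfl).continuousOn).intervalIntegrable
  -- No regularity of G in s has been established. If the sum is not integrable its integral is 0 by
  -- convention and the bound is trivial; otherwise G is integrable as a difference.
  by_cases hi : IntervalIntegrable (fun s => G s + a s * deriv g s) volume 0 1
  · have hG : IntervalIntegrable G volume 0 1 := by
      have := hi.sub hint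
      simpa using this
    rw [intervalIntegral.integral_add hG hint]
    refine (abs_add_le _ _).trans ?_
    linarith
  · rw [intervalIntegral.integral_undef hi, abs_zero]
    positivity

/-- The averages `y ↦ ∫₀¹ θ (f_t (φ'_s y)) ds`, `t ≥ 0`, are uniformly Lipschitz. -/
theorem exists_lipschitz_average [IsRiemannianManifold 𝓘(ℝ, E) M]
    (h : TimeChangeData E f φ φ' lam τ sStar)
    (hA : IsAnosovSplitting E f Eu Es) (hfin : ∀ x, Module.finrank ℝ (Eu x) = 1) {θ : M → ℝ}
    (hθ : ContMDiff 𝓘(ℝ, E) 𝓘(ℝ, ℝ) 1 θ) : ∃ K, 0 ≤ K ∧ ∀ t, 0 ≤ t → ∀ x y : M,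
      dist (∫ s in (0 : ℝ)..1, θ (f t (φ' s x))) (∫ s in (0 : ℝ)..1, θ (f t (φ' s y))) ≤
        K * dist x y := by
  obtain ⟨K, hK, hb⟩ := h.exists_bound_dirDeriv_average hA hfin hθ
  exact ⟨K, hK, fun t ht x y => dist_le_of_dirDeriv_le
    (contMDiff_intervalIntegral (F := fun s y => θ (f t (φ' s y)))
      (h.contMDiff_comp_flow_phi' hθ t) 0 1) hK (hb t ht) x y⟩

end TimeChangeData

end AnosovFlow

/-! ## Uniform convergence of ergodic averages -/

section UniformAverage

variable {X : Type*} [MetricSpace X] {ψ : Flow ℝ X} {θ : X → ℝ}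

/-- The integral of `θ` along the orbit segment of length `R` starting at `x`. -/
noncomputable def orbitIntegral (ψ : Flow ℝ X) (θ : X → ℝ) (R : ℝ) (x : X) : ℝ :=
  ∫ s in (0 : ℝ)..R, θ (ψ s x)

theorem continuous_along_orbit (hθ : Continuous θ) (x : X) : Continuous fun s => θ (ψ s x) :=
  hθ.comp (ψ.continuous continuous_id continuous_const)

theorem orbitIntegral_add (hθ : Continuous θ) (R R' : ℝ) (x : X) :
    orbitIntegral ψ θ (R + R') x = orbitIntegral ψ θ R x + orbitIntegral ψ θ R' (ψ R x) := by
  have hc := continuous_along_orbit (ψ := ψ) hθ x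
  rw [orbitIntegral, ← intervalIntegral.integral_add_adjacent_intervals
    (hc.intervalIntegrable 0 R) (hc.intervalIntegrable R (R + R'))]
  congr 1
  have h1 := intervalIntegral.integral_comp_add_right (a := 0) (b := R') (fun s => θ (ψ s x)) R
  rw [zero_add, add_comm R' R] at h1
  rw [← h1, orbitIntegral]
  simp only [ψ.map_add]

theorem orbitIntegral_mul (R : ℝ) (hR : R ≠ 0) (x : X) :
    orbitIntegral ψ θ R x = R * ∫ s in (0 : ℝ)..1, θ (ψ (R * s) x) := by
  rw [intervalIntegral.integral_comp_mul_left (fun s => θ (ψ s x)) hR, mul_zero, mul_one,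
    smul_eq_mul, ← mul_assoc, mul_inv_cancel₀ hR, one_mul, orbitIntegral]

theorem abs_orbitIntegral_le {S : ℝ} (hS : ∀ x, |θ x| ≤ S) {R : ℝ} (hR : 0 ≤ R) (x : X) :
    |orbitIntegral ψ θ R x| ≤ S * R := by
  have h := intervalIntegral.norm_integral_le_of_norm_le_const (a := 0) (b := R)
    (f := fun s => θ (ψ s x)) (C := S) fun s _ => hS _
  rwa [sub_zero, abs_of_nonneg hR] at h

theorem continuous_orbitIntegral [CompactSpace X] (hθ : Continuous θ) (R : ℝ) :
    Continuous (orbitIntegral ψ θ R) :=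
  intervalIntegral.continuous_parametric_intervalIntegral_of_continuous' (f := fun x s => θ (ψ s x))
    (hθ.comp (ψ.continuous continuous_snd continuous_fst)) _ _

/-- The asymptotic maximal average of `θ` along the orbits of `ψ`. -/
theorem exists_maximal_average [CompactSpace X] [Nonempty X] (hθ : Continuous θ) :
    ∃ m : ℝ, (∀ ε > 0, ∃ B, 0 ≤ B ∧ ∀ R, 0 ≤ R → ∀ x, orbitIntegral ψ θ R x ≤ (m + ε) * R + B) ∧
      ∀ R > 0, ∃ x, m * R ≤ orbitIntegral ψ θ R x := by
  obtain ⟨S, hS0, hS⟩ := exists_bound_of_continuous hθ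
  -- The slopes of affine upper bounds for orbit integrals; the maximal average is their infimum.
  let T : Set ℝ := {m | ∃ B, 0 ≤ B ∧ ∀ R, 0 ≤ R → ∀ x, orbitIntegral ψ θ R x ≤ m * R + B}
  have hne : T.Nonempty := ⟨S, 0, le_rfl, fun R hR x => by
    rw [add_zero]
    exact (le_abs_self _).trans (abs_orbitIntegral_le hS hR x)⟩
  have hbdd : BddBelow T := by
    refine ⟨-S, ?_⟩
    rintro m ⟨B, hB, hm⟩
    by_contra! hlt
    obtain ⟨x⟩ := ‹Nonempty X›
    have hd : 0 < -S - m := by linarith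
    set R := (B + 1) / (-S - m) with hR
    have hR0 : 0 ≤ R := by positivity
    have h1 := (abs_le.1 (abs_orbitIntegral_le (ψ := ψ) hS hR0 x)).1.trans (hm R hR0 x)
    have h2 : R * (-S - m) = B + 1 := div_mul_cancel₀ _ hd.ne'
    nlinarith
  refine ⟨sInf T, fun ε hε => ?_, fun R hR => ?_⟩
  · obtain ⟨m, ⟨B, hB, hm⟩, hlt⟩ := exists_lt_of_csInf_lt hne (lt_add_of_pos_right (sInf T) hε)
    exact ⟨B, hB, fun R hR x => (hm R hR x).trans
      (add_le_add_left (mul_le_mul_of_nonneg_right hlt.le hR) _)⟩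
  · obtain ⟨x₀, -, hmax⟩ := isCompact_univ.exists_isMaxOn (univ_nonempty (α := X))
      (continuous_orbitIntegral (ψ := ψ) hθ R).continuousOn
    refine ⟨x₀, ?_⟩
    by_contra! hlt
    -- If the best average over length R lay below the infimum of T, cutting long segments into
    -- pieces of length R would put this smaller slope into T.
    set m := orbitIntegral ψ θ R x₀ / R with hm
    have hmR : m * R = orbitIntegral ψ θ R x₀ := div_mul_cancel₀ _ hR.ne'
    have hle : ∀ x, orbitIntegral ψ θ R x ≤ m * R := fun x => by
      rw [hmR]
      exact hmax (mem_univ x)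
    have hstep : ∀ (k : ℕ) (r : ℝ), 0 ≤ r → r ≤ R → ∀ x,
        orbitIntegral ψ θ (k * R + r) x ≤ m * (k * R) + S * R := by
      intro k r hr hrR
      induction k with
      | zero =>
        intro x
        rw [Nat.cast_zero, zero_mul, zero_add, mul_zero, zero_add]
        exact ((le_abs_self _).trans (abs_orbitIntegral_le hS hr x)).trans
          (mul_le_mul_of_nonneg_left hrR hS0)
      | succ k ih =>
        intro x
        have h1 : ((k + 1 : ℕ) : ℝ) * R + r = R + (k * R + r) := by
          push_cast
          ring
        rw [h1, orbitIntegral_add hθ]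
        have := add_le_add (hle x) (ih (ψ R x))
        refine this.trans (le_of_eq ?_)
        push_cast
        ring
    have hmem : m ∈ T := by
      refine ⟨|m| * R + S * R, by positivity, fun R' hR' x => ?_⟩
      have h1 := Nat.floor_le (div_nonneg hR' hR.le)
      have h2 := (Nat.lt_floor_add_one (R' / R)).le
      rw [le_div_iff₀ hR] at h1
      rw [div_le_iff₀ hR, add_mul, one_mul] at h2
      have h3 := hstep ⌊R' / R⌋₊ (R' - ⌊R' / R⌋₊ * R) (by linarith) (by linarith) x
      rw [add_sub_cancel] at h3
      have h4 : m * (⌊R' / R⌋₊ * R) ≤ m * R' + |m| * R := by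
        have h5 : m * (⌊R' / R⌋₊ * R) = m * R' + (-m) * (R' - ⌊R' / R⌋₊ * R) := by ring
        rw [h5]
        refine add_le_add_right ?_ _
        exact mul_le_mul (neg_le_abs m) (by linarith) (by linarith) (abs_nonneg m)
      linarith
    have h1 := csInf_le hbdd hmem
    have h2 := mul_le_mul_of_nonneg_right h1 hR.le
    linarith

/-- For a fixed time, coming δ-close is an open condition on the pair of points, so compactness of X
× X bounds the time needed. -/
theorem exists_uniform_density [CompactSpace X] (hd : ∀ x, Dense (ψ.orbit x)) {δ : ℝ}
    (hδ : 0 < δ) : ∃ N, 0 ≤ N ∧ ∀ y z : X, ∃ r ∈ Icc (-N) N, dist (ψ r y) z < δ := by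
  obtain ⟨N, hN, h⟩ := exists_bound_of_eventually (X := X × X)
    (P := fun p N => ∃ r ∈ Icc (-N) N, dist (ψ r p.1) p.2 < δ)
    (fun p a b hab ⟨r, hr, hp⟩ => ⟨r, ⟨by linarith [hr.1], hr.2.trans hab⟩, hp⟩)
    (fun p => by
      obtain ⟨_, ⟨r, rfl⟩, hr⟩ := (hd p.1).exists_dist_lt p.2 hδ
      refine ⟨|r|, ?_⟩
      have hc : Continuous fun q : X × X => dist (ψ r q.1) q.2 :=
        (ψ.continuous continuous_const continuous_fst).dist continuous_snd
      rw [dist_comm] at hr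
      filter_upwards [hc.continuousAt.eventually_lt (continuousAt_const (y := δ)) hr] with q hq
      exact ⟨r, ⟨neg_abs_le r, le_abs_self r⟩, hq⟩)
  exact ⟨N, hN, fun y z => h (y, z)⟩

/-- Ergodic averages along a minimal flow converge uniformly to a constant if, after renormalising
by homeomorphisms which expand the flow, they are equicontinuous. -/
theorem exists_uniform_average [CompactSpace X] [Nonempty X] (hd : ∀ x, Dense (ψ.orbit x))
    (hθ : Continuous θ) {K : ℝ} (hK : 0 ≤ K)
    (hren : ∀ R : ℝ, 1 ≤ R → ∃ g : X → X, Function.Surjective g ∧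
      (∀ s x, g (ψ s x) = ψ (R * s) (g x)) ∧
      ∀ x y, dist (∫ s in (0 : ℝ)..1, θ (g (ψ s x))) (∫ s in (0 : ℝ)..1, θ (g (ψ s y))) ≤
        K * dist x y) :
    ∃ m : ℝ, ∀ ε > 0, ∃ R₀, ∀ R ≥ R₀, ∀ x, |orbitIntegral ψ θ R x - m * R| ≤ ε * R := by
  obtain ⟨m, hup, hlow⟩ := exists_maximal_average (ψ := ψ) hθ
  refine ⟨m, fun ε hε => ?_⟩
  -- By the Lipschitz bound, points within this δ have renormalised averages differing by at most
  -- ε/2.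
  obtain ⟨N, hN, hdens⟩ := exists_uniform_density hd (δ := ε / (2 * (K + 1))) (by positivity)
  obtain ⟨B, hB, hupB⟩ := hup (ε / (4 * (2 * N + 1))) (by positivity)
  obtain ⟨B', hB', hupB'⟩ := hup (ε / 2) (by positivity)
  refine ⟨max 1 (max (8 * B / ε) (2 * B' / ε)), fun R hR x => ?_⟩
  have hR1 : 1 ≤ R := (le_max_left _ _).trans hR
  have hRB : 8 * B / ε ≤ R := (le_max_left _ _).trans ((le_max_right _ _).trans hR)
  have hRB' : 2 * B' / ε ≤ R := (le_max_right _ _).trans ((le_max_right _ _).trans hR)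
  rw [div_le_iff₀ hε] at hRB hRB'
  have hR0 : 0 < R := one_pos.trans_le hR1
  rw [abs_le]
  constructor
  swap
  · linarith [hupB' R hR0.le x]
  obtain ⟨g, hg, hgψ, hgK⟩ := hren R hR1
  -- A long segment with average at least m. No part of it can do much better than m, so every
  -- subsegment of length R has average nearly m or more; after renormalisation its starting points
  -- come δ-close to every point.
  obtain ⟨x₀, hx₀⟩ := hlow ((2 * N + 1) * R) (by positivity)
  obtain ⟨y₀, rfl⟩ := hg x₀
  obtain ⟨y, rfl⟩ := hg x
  have hI : ∀ y, orbitIntegral ψ θ R (g y) = R * ∫ s in (0 : ℝ)..1, θ (g (ψ s y)) := fun y => by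
    simp only [hgψ]
    exact orbitIntegral_mul R hR0.ne' _
  obtain ⟨r, hr, hry⟩ := hdens (ψ N y₀) y
  rw [← ψ.map_add] at hry
  have hq0 : 0 ≤ r + N := by linarith [hr.1]
  have hq1 : 0 ≤ N - r := by linarith [hr.2]
  -- The middle piece has length R and starts near x in the renormalised picture. The outer pieces
  -- have total length 2NR and exceed the slope m by at most ε₁·2NR + 2B ≤ (ε/2)R.
  have hsplit : orbitIntegral ψ θ ((2 * N + 1) * R) (g y₀) =
      orbitIntegral ψ θ ((r + N) * R) (g y₀) + (orbitIntegral ψ θ R (g (ψ (r + N) y₀)) +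
        orbitIntegral ψ θ ((N - r) * R) (ψ R (g (ψ (r + N) y₀)))) := by
    have h1 : (2 * N + 1) * R = (r + N) * R + (R + (N - r) * R) := by ring
    rw [h1, orbitIntegral_add hθ, orbitIntegral_add hθ, hgψ, mul_comm R]
  have h2 := hupB ((r + N) * R) (mul_nonneg hq0 hR0.le) (g y₀)
  have h3 := hupB ((N - r) * R) (mul_nonneg hq1 hR0.le) (ψ R (g (ψ (r + N) y₀)))
  rw [hsplit] at hx₀
  set ε₁ := ε / (4 * (2 * N + 1)) with hε₁
  have h4 : ε₁ * (2 * N) ≤ ε / 4 := by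
    rw [hε₁, div_mul_eq_mul_div, div_le_div_iff₀ (by positivity) (by positivity)]
    nlinarith
  have h5 : m * R - ε / 2 * R ≤ orbitIntegral ψ θ R (g (ψ (r + N) y₀)) := by
    have h6 := mul_le_mul_of_nonneg_right h4 hR0.le
    nlinarith
  have h6 := hgK (ψ (r + N) y₀) y
  have h7 : K * dist (ψ (r + N) y₀) y ≤ ε / 2 := by
    have h8 : K * dist (ψ (r + N) y₀) y ≤ (K + 1) * (ε / (2 * (K + 1))) :=
      mul_le_mul (by linarith) hry.le dist_nonneg (by linarith)
    have h9 : (K + 1) * (ε / (2 * (K + 1))) = ε / 2 := by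
      field_simp
    linarith
  have h8 := (abs_le.1 (h6.trans h7)).2
  rw [hI] at h5 ⊢
  have h9 := mul_le_mul_of_nonneg_left h8 hR0.le
  linarith

end UniformAverage

/-! ## Invariant measures and derivatives along flows -/

section DirDerivContinuous

variable {E : Type*} [NormedAddCommGroup E] [NormedSpace ℝ E]
variable {F : Type*} [NormedAddCommGroup F] [NormedSpace ℝ F]
variable {M : Type*} [TopologicalSpace M] [ChartedSpace E M] [IsManifold 𝓘(ℝ, E) ∞ M]

theorem continuous_dirDeriv_section {θ : M → F} (hθ : ContMDiff 𝓘(ℝ, E) 𝓘(ℝ, F) 1 θ) {X : M → E}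
    (hX : Continuous (fun x => (⟨x, X x⟩ : TangentBundle 𝓘(ℝ, E) M))) :
    Continuous fun x => dirDeriv E θ x (X x) := by
  have h1 := (hθ.continuous_tangentMap (by norm_num)).comp hX
  have h2 := (tangentBundleModelSpaceHomeomorph 𝓘(ℝ, F)).continuous.comp h1
  exact continuous_snd.comp h2

end DirDerivContinuous

namespace AnosovFlow

section Integrals

variable {M : Type*} [MetricSpace M] [CompactSpace M] [MeasurableSpace M] [BorelSpace M]
  {μ : Measure M}

theorem integral_comp_of_measurePreserving {F : Type*} [NormedAddCommGroup F] [NormedSpace ℝ F]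
    {T : M → M} (hT : MeasurePreserving T μ μ) {κ : M → F} (hκ : Continuous κ) :
    ∫ x, κ (T x) ∂μ = ∫ x, κ x ∂μ := by
  conv_rhs => rw [← hT.map_eq]
  refine (integral_map hT.aemeasurable ?_).symm
  exact hκ.aestronglyMeasurable

variable [IsFiniteMeasure μ]

theorem integrable_of_continuous {F : Type*} [NormedAddCommGroup F] {κ : M → F}
    (hκ : Continuous κ) : Integrable κ μ :=
  hκ.integrable_of_hasCompactSupport (HasCompactSupport.of_compactSpace κ)

theorem integral_integral_flow_swap {F : Type*} [NormedAddCommGroup F] [NormedSpace ℝ F]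
    {κ : ℝ × M → F} (hκ : Continuous κ) (a b : ℝ) :
    ∫ s in a..b, ∫ x, κ (s, x) ∂μ = ∫ x, (∫ s in a..b, κ (s, x)) ∂μ := by
  refine intervalIntegral_integral_swap (f := fun s x => κ (s, x)) ?_
  have h1 : (volume.restrict (uIoc a b)).prod μ =
      (volume.prod μ).restrict (uIoc a b ×ˢ univ) := by
    rw [← Measure.prod_restrict, Measure.restrict_univ]
  rw [h1]
  have h2 : IntegrableOn κ (uIcc a b ×ˢ univ) (volume.prod μ) :=
    hκ.continuousOn.integrableOn_compact (isCompact_uIcc.prod isCompact_univ)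
  exact h2.mono_set (prod_mono uIoc_subset_uIcc le_rfl)

/-- The weighted integral of an increment along a flow is the integral of the weighted integrals of
the derivative. -/
theorem integral_mul_flow_sub {ψ : Flow ℝ M} {w κ κ' : M → ℝ} (hw : Continuous w)
    (hκ : Continuous κ) (hκ' : Continuous κ')
    (hd : ∀ x s, HasDerivAt (fun s => κ (ψ s x)) (κ' (ψ s x)) s) (R : ℝ) :
    ∫ x, w x * κ (ψ R x) ∂μ - ∫ x, w x * κ x ∂μ =
      ∫ s in (0 : ℝ)..R, ∫ x, w x * κ' (ψ s x) ∂μ := by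
  have hR : Continuous fun x => κ (ψ R x) := hκ.comp (ψ.continuous continuous_const continuous_id)
  have hc : Continuous (fun p : ℝ × M => w p.2 * κ' (ψ p.1 p.2)) :=
    (hw.comp continuous_snd).mul (hκ'.comp (ψ.continuous continuous_fst continuous_snd))
  have h1 : Integrable (fun x => w x * κ (ψ R x)) μ := integrable_of_continuous (hw.mul hR)
  have h2 : Integrable (fun x => w x * κ x) μ := integrable_of_continuous (hw.mul hκ)
  rw [← integral_sub h1 h2, integral_integral_flow_swap hc]
  refine integral_congr_ae (Eventually.of_forall fun x => ?_)
  change w x * κ (ψ R x) - w x * κ x = ∫ s in (0 : ℝ)..R, w x * κ' (ψ s x)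
  rw [intervalIntegral.integral_const_mul,
    intervalIntegral.integral_eq_sub_of_hasDerivAt (fun s _ => hd x s)
      ((continuous_along_orbit hκ' x).intervalIntegrable _ _), ψ.map_zero_apply, mul_sub]

end Integrals

section FlowDeriv

variable {E : Type*} [NormedAddCommGroup E] [NormedSpace ℝ E]
variable {F : Type*} [NormedAddCommGroup F] [NormedSpace ℝ F]
variable {M : Type*} [MetricSpace M] [ChartedSpace E M]

theorem IsC1Flow.hasDerivAt_flow {f : Flow ℝ M} (hf : IsC1Flow E f) {θ : M → F}
    (hθ : ContMDiff 𝓘(ℝ, E) 𝓘(ℝ, F) 1 θ) (x : M) (s : ℝ) :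
    HasDerivAt (fun s => θ (f s x)) (flowDeriv f θ (f s x)) s := by
  rw [hf.flowDeriv_eq hθ]
  exact hf.hasDerivAt_comp hθ x s

theorem flowDeriv_comp_flow (f : Flow ℝ M) (θ : M → F) (s : ℝ) (x : M) :
    flowDeriv f (fun y => θ (f s y)) x = flowDeriv f θ (f s x) := by
  simp only [flowDeriv, ← f.map_add, add_comm]

variable [IsManifold 𝓘(ℝ, E) ∞ M]

theorem IsC1Flow.continuous_flowDeriv {f : Flow ℝ M} (hf : IsC1Flow E f)
    (hX : HasC1VectorField E f) {θ : M → F} (hθ : ContMDiff 𝓘(ℝ, E) 𝓘(ℝ, F) 1 θ) :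
    Continuous (flowDeriv f θ) := by
  have : flowDeriv f θ = fun x => dirDeriv E θ x (vel E f x) :=
    funext fun x => hf.flowDeriv_eq hθ x
  rw [this]
  exact continuous_dirDeriv_section hθ hX.continuous

/-- The increment θ∘φ_1 - θ has integral 0, and it is the time integral of the derivative along the
flow, whose space integral does not depend on time. -/
theorem IsC1Flow.integral_flowDeriv_eq_zero [CompactSpace M] [MeasurableSpace M] [BorelSpace M]
    {μ : Measure M} [IsFiniteMeasure μ] {φ : Flow ℝ M} (hφ : IsC1Flow E φ)
    (hX : HasC1VectorField E φ) (hμ : ∀ s, MeasurePreserving (φ s) μ μ) {θ : M → ℝ}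
    (hθ : ContMDiff 𝓘(ℝ, E) 𝓘(ℝ, ℝ) 1 θ) : ∫ x, flowDeriv φ θ x ∂μ = 0 := by
  have hc := hφ.continuous_flowDeriv hX hθ
  have h1 := integral_mul_flow_sub (μ := μ) (w := fun _ => 1) continuous_const hθ.continuous hc
    (hφ.hasDerivAt_flow hθ) 1
  simp only [one_mul] at h1
  rw [integral_comp_of_measurePreserving (hμ 1) hθ.continuous, sub_self] at h1
  simp only [fun s => integral_comp_of_measurePreserving (hμ s) hc,
    intervalIntegral.integral_const, sub_zero, one_smul] at h1
  exact h1.symm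

end FlowDeriv

/-! ### Unique mean values along `φ'` and invariance of the measure with density `ρ⁻¹` -/

namespace TimeChangeData

variable {E : Type*} [NormedAddCommGroup E] [NormedSpace ℝ E]
variable {M : Type*} [MetricSpace M] [ChartedSpace E M] [IsManifold 𝓘(ℝ, E) ∞ M]
variable {f φ φ' : Flow ℝ M} {lam : ℝ} {τ : M → ℝ → ℝ} {sStar : ℝ → ℝ → M → ℝ}

theorem dense_orbit_phi' (h : TimeChangeData E f φ φ' lam τ sStar) (x : M) :
    Dense (φ'.orbit x) := by
  rw [h.expanding.orbit_eq, ← h.minimal.orbit_eq]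
  exact h.minimal.dense_orbit x

theorem flowDeriv_phi' (h : TimeChangeData E f φ φ' lam τ sStar) {θ : M → ℝ}
    (hθ : ContMDiff 𝓘(ℝ, E) 𝓘(ℝ, ℝ) 1 θ) (x : M) :
    flowDeriv φ' θ x = rho τ x * flowDeriv φ θ x := by
  rw [h.reparam.c1'.flowDeriv_eq hθ, h.reparam.c1.flowDeriv_eq hθ, h.vel_phi'_eq, map_smul,
    smul_eq_mul]

variable [FiniteDimensional ℝ E]

theorem continuous_rho_inv (h : TimeChangeData E f φ φ' lam τ sStar) :
    Continuous fun x => (rho τ x)⁻¹ :=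
  h.continuous_rho.inv₀ fun x => (h.rho_pos x).ne'

variable [CompactSpace M]

section Equidistribution

variable [RiemannianBundle (fun x : M => TangentSpace 𝓘(ℝ, E) x)]
  [IsContMDiffRiemannianBundle 𝓘(ℝ, E) ∞ E (fun x : M => TangentSpace 𝓘(ℝ, E) x)]
  [IsRiemannianManifold 𝓘(ℝ, E) M]
  {Eu Es : (x : M) → Submodule ℝ (TangentSpace 𝓘(ℝ, E) x)}

/-- The renormalising map for length R is f at time log_λ R; equicontinuity is
`exists_lipschitz_average`. -/
theorem exists_uniform_average [Nonempty M] (h : TimeChangeData E f φ φ' lam τ sStar)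
    (hA : IsAnosovSplitting E f Eu Es) (hfin : ∀ x, Module.finrank ℝ (Eu x) = 1) {θ : M → ℝ}
    (hθ : ContMDiff 𝓘(ℝ, E) 𝓘(ℝ, ℝ) 1 θ) :
    ∃ m : ℝ, ∀ ε > 0, ∃ R₀, ∀ R ≥ R₀, ∀ x, |orbitIntegral φ' θ R x - m * R| ≤ ε * R := by
  obtain ⟨K, hK, hlip⟩ := h.exists_lipschitz_average hA hfin hθ
  refine _root_.exists_uniform_average h.dense_orbit_phi' hθ.continuous hK fun R hR => ?_
  have hR0 : 0 < R := one_pos.trans_le hR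
  refine ⟨f (Real.logb lam R), fun x => ⟨f (-Real.logb lam R) x, ?_⟩, fun s x => ?_,
    hlip _ (Real.logb_nonneg h.expanding.one_lt hR)⟩
  · rw [← f.map_add, add_neg_cancel, f.map_zero_apply]
  · rw [h.expanding.commutation, Real.rpow_logb h.lam_pos h.expanding.one_lt.ne' hR0]

end Equidistribution

variable [MeasurableSpace M] [BorelSpace M] {μ : Measure M} [IsFiniteMeasure μ]

/-- The measure with density `ρ⁻¹` is invariant under the uniformly expanding flow. -/
theorem integral_comp_phi' (h : TimeChangeData E f φ φ' lam τ sStar)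
    (hμ : ∀ s, MeasurePreserving (φ s) μ μ) {θ : M → ℝ} (hθ : ContMDiff 𝓘(ℝ, E) 𝓘(ℝ, ℝ) 1 θ)
    (R : ℝ) : ∫ x, (rho τ x)⁻¹ * θ (φ' R x) ∂μ = ∫ x, (rho τ x)⁻¹ * θ x ∂μ := by
  have hc : Continuous (flowDeriv φ' θ) := by
    have : flowDeriv φ' θ = fun x => rho τ x * flowDeriv φ θ x := funext (h.flowDeriv_phi' hθ)
    rw [this]
    exact h.continuous_rho.mul (h.reparam.c1.continuous_flowDeriv h.data.c1_vectorField' hθ)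
  have h1 := integral_mul_flow_sub (μ := μ) h.continuous_rho_inv hθ.continuous hc
    (h.reparam.c1'.hasDerivAt_flow hθ) R
  -- The factor ρ⁻¹ cancels that in X_φ' = ρX_φ, so the integrand is X_φ(θ∘φ'_s), a derivative along
  -- the μ-preserving flow.
  have h2 : ∀ s, ∫ x, (rho τ x)⁻¹ * flowDeriv φ' θ (φ' s x) ∂μ = 0 := fun s => by
    have hθs : ContMDiff 𝓘(ℝ, E) 𝓘(ℝ, ℝ) 1 (fun y => θ (φ' s y)) :=
      hθ.comp (h.reparam.c1'.contMDiff_apply s)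
    rw [← h.reparam.c1.integral_flowDeriv_eq_zero h.data.c1_vectorField' hμ hθs]
    refine integral_congr_ae (Eventually.of_forall fun x => ?_)
    change (rho τ x)⁻¹ * flowDeriv φ' θ (φ' s x) = flowDeriv φ (fun y => θ (φ' s y)) x
    rw [← flowDeriv_comp_flow, h.flowDeriv_phi' hθs, inv_mul_cancel_left₀ (h.rho_pos x).ne']
  simp only [h2, intervalIntegral.integral_zero] at h1
  linarith

theorem integral_orbitIntegral (h : TimeChangeData E f φ φ' lam τ sStar)
    (hμ : ∀ s, MeasurePreserving (φ s) μ μ) {θ : M → ℝ} (hθ : ContMDiff 𝓘(ℝ, E) 𝓘(ℝ, ℝ) 1 θ)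
    (R : ℝ) : ∫ x, (rho τ x)⁻¹ * orbitIntegral φ' θ R x ∂μ = R * ∫ x, (rho τ x)⁻¹ * θ x ∂μ := by
  have hc : Continuous fun p : ℝ × M => (rho τ p.2)⁻¹ * θ (φ' p.1 p.2) :=
    (h.continuous_rho_inv.comp continuous_snd).mul
      (hθ.continuous.comp (φ'.continuous continuous_fst continuous_snd))
  have h1 := integral_integral_flow_swap (μ := μ) hc 0 R
  simp only [h.integral_comp_phi' hμ hθ, intervalIntegral.integral_const,
    intervalIntegral.integral_const_mul, sub_zero, smul_eq_mul] at h1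
  exact h1.symm

variable [RiemannianBundle (fun x : M => TangentSpace 𝓘(ℝ, E) x)]
  [IsContMDiffRiemannianBundle 𝓘(ℝ, E) ∞ E (fun x : M => TangentSpace 𝓘(ℝ, E) x)]
  [IsRiemannianManifold 𝓘(ℝ, E) M]
  {Eu Es : (x : M) → Submodule ℝ (TangentSpace 𝓘(ℝ, E) x)}

/-- The measure with density `ρ⁻¹` is invariant under the Anosov flow. -/
theorem integral_comp_f [Nonempty M] (h : TimeChangeData E f φ φ' lam τ sStar)
    (hA : IsAnosovSplitting E f Eu Es) (hfin : ∀ x, Module.finrank ℝ (Eu x) = 1)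
    (hμ : ∀ s, MeasurePreserving (φ s) μ μ) {θ : M → ℝ} (hθ : ContMDiff 𝓘(ℝ, E) 𝓘(ℝ, ℝ) 1 θ)
    (r : ℝ) : ∫ x, (rho τ x)⁻¹ * θ (f r x) ∂μ = ∫ x, (rho τ x)⁻¹ * θ x ∂μ := by
  obtain ⟨m, hm⟩ := h.exists_uniform_average hA hfin hθ
  set W := ∫ x, (rho τ x)⁻¹ ∂μ with hW
  have hW0 : 0 ≤ W := integral_nonneg fun x => (inv_pos.2 (h.rho_pos x)).le
  -- A uniform average m determines the integral: integrate the uniform estimate against ρ⁻¹μ, which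
  -- φ' preserves. Equality for θ and θ∘f_r then only needs a common m.
  have hkey : ∀ κ : M → ℝ, ContMDiff 𝓘(ℝ, E) 𝓘(ℝ, ℝ) 1 κ →
      (∀ ε > 0, ∃ R₀, ∀ R ≥ R₀, ∀ x, |orbitIntegral φ' κ R x - m * R| ≤ ε * R) →
      ∫ x, (rho τ x)⁻¹ * κ x ∂μ = m * W := by
    intro κ hκ hav
    have hle : ∀ ε > 0, |∫ x, (rho τ x)⁻¹ * κ x ∂μ - m * W| ≤ ε * W := by
      intro ε hε
      obtain ⟨R₀, hR₀⟩ := hav ε hε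
      set R := max R₀ 1
      have hR : 0 < R := one_pos.trans_le (le_max_right _ _)
      have h1 : ∫ x, (rho τ x)⁻¹ * (orbitIntegral φ' κ R x - m * R) ∂μ =
          R * (∫ x, (rho τ x)⁻¹ * κ x ∂μ - m * W) := by
        have hi1 : Integrable (fun x => (rho τ x)⁻¹ * orbitIntegral φ' κ R x) μ :=
          integrable_of_continuous
            (h.continuous_rho_inv.mul (continuous_orbitIntegral hκ.continuous R))
        have hi2 : Integrable (fun x => (rho τ x)⁻¹ * (m * R)) μ :=
          integrable_of_continuous (h.continuous_rho_inv.mul continuous_const)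
        simp only [mul_sub]
        rw [integral_sub hi1 hi2, h.integral_orbitIntegral hμ hκ, integral_mul_const, ← hW]
        ring
      have h2 : |∫ x, (rho τ x)⁻¹ * (orbitIntegral φ' κ R x - m * R) ∂μ| ≤
          ∫ x, (rho τ x)⁻¹ * (ε * R) ∂μ := by
        rw [← Real.norm_eq_abs]
        refine (norm_integral_le_of_norm_le (integrable_of_continuous (μ := μ)
          (h.continuous_rho_inv.mul continuous_const)) (Eventually.of_forall fun x => ?_))
        rw [norm_mul, Real.norm_eq_abs, Real.norm_eq_abs, abs_of_pos (inv_pos.2 (h.rho_pos x))]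
        exact mul_le_mul_of_nonneg_left (hR₀ R (le_max_left _ _) x) (inv_pos.2 (h.rho_pos x)).le
      rw [h1, integral_mul_const, abs_mul, abs_of_pos hR, ← hW] at h2
      refine le_of_mul_le_mul_left ?_ hR
      linarith
    refine sub_eq_zero.1 (abs_nonpos_iff.1 (le_of_forall_pos_le_add fun δ hδ => ?_))
    refine (hle (δ / (W + 1)) (by positivity)).trans ?_
    rw [zero_add, div_mul_eq_mul_div, div_le_iff₀ (by positivity)]
    nlinarith
  rw [hkey θ hθ hm]
  -- By the commutation relation, the orbit integral of θ∘f_r over length R is λ^{-r} times that of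
  -- θ over length λ^r R from f_r(x), so the mean value m is the same.
  refine hkey (fun x => θ (f r x)) (hθ.comp (h.c1.contMDiff_apply r)) fun ε hε => ?_
  have hpos := Real.rpow_pos_of_pos h.lam_pos r
  obtain ⟨R₀, hR₀⟩ := hm ε hε
  refine ⟨R₀ / lam ^ r, fun R hR x => ?_⟩
  have h1 : orbitIntegral φ' (fun x => θ (f r x)) R x =
      (lam ^ r)⁻¹ * orbitIntegral φ' θ (lam ^ r * R) (f r x) := by
    simp only [orbitIntegral, h.expanding.commutation]
    rw [intervalIntegral.integral_comp_mul_left (fun s => θ (φ' s (f r x))) hpos.ne', mul_zero,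
      smul_eq_mul]
  have h2 := hR₀ (lam ^ r * R) (by rwa [ge_iff_le, div_le_iff₀' hpos] at hR) (f r x)
  have h3 : orbitIntegral φ' (fun x => θ (f r x)) R x - m * R =
      (lam ^ r)⁻¹ * (orbitIntegral φ' θ (lam ^ r * R) (f r x) - m * (lam ^ r * R)) := by
    rw [h1, mul_sub]
    field_simp
  rw [h3, abs_mul, abs_of_pos (inv_pos.2 hpos)]
  refine (mul_le_mul_of_nonneg_left h2 (inv_pos.2 hpos).le).trans (le_of_eq ?_)
  field_simp

/-- Uniform approximation by C^1 functions. The extension is needed because the invariance will be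
applied to functions involving ρ and X_f(ρ), which are only continuous. -/
theorem integral_comp_f_of_continuous [Nonempty M] (h : TimeChangeData E f φ φ' lam τ sStar)
    (hA : IsAnosovSplitting E f Eu Es) (hfin : ∀ x, Module.finrank ℝ (Eu x) = 1)
    (hμ : ∀ s, MeasurePreserving (φ s) μ μ) {θ : M → ℝ} (hθ : Continuous θ)
    (r : ℝ) : ∫ x, (rho τ x)⁻¹ * θ (f r x) ∂μ = ∫ x, (rho τ x)⁻¹ * θ x ∂μ := by
  set W := ∫ x, (rho τ x)⁻¹ ∂μ with hW
  have hW0 : 0 ≤ W := integral_nonneg fun x => (inv_pos.2 (h.rho_pos x)).le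
  have hclose : ∀ (κ κ' : M → ℝ) (ε : ℝ), Continuous κ → Continuous κ' →
      (∀ x, |κ x - κ' x| ≤ ε) →
      |∫ x, (rho τ x)⁻¹ * κ x ∂μ - ∫ x, (rho τ x)⁻¹ * κ' x ∂μ| ≤ ε * W := by
    intro κ κ' ε hκ hκ' hε
    have h1 : Integrable (fun x => (rho τ x)⁻¹ * κ x) μ :=
      integrable_of_continuous (h.continuous_rho_inv.mul hκ)
    have h2 : Integrable (fun x => (rho τ x)⁻¹ * κ' x) μ :=
      integrable_of_continuous (h.continuous_rho_inv.mul hκ')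
    rw [← integral_sub h1 h2, mul_comm ε, hW, ← integral_mul_const]
    rw [← Real.norm_eq_abs]
    refine (norm_integral_le_of_norm_le (integrable_of_continuous (μ := μ)
      (h.continuous_rho_inv.mul continuous_const)) (Eventually.of_forall fun x => ?_))
    rw [← mul_sub, norm_mul, Real.norm_eq_abs, Real.norm_eq_abs,
      abs_of_pos (inv_pos.2 (h.rho_pos x))]
    exact mul_le_mul_of_nonneg_left (hε x) (inv_pos.2 (h.rho_pos x)).le
  refine sub_eq_zero.1 (abs_nonpos_iff.1 (le_of_forall_pos_le_add fun δ hδ => ?_))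
  obtain ⟨g, hg, -⟩ := hθ.exists_contMDiff_approx 𝓘(ℝ, E) 1
    (continuous_const (y := δ / (2 * (W + 1)))) (fun _ => by positivity)
  have hgc : ContMDiff 𝓘(ℝ, E) 𝓘(ℝ, ℝ) 1 g := g.contMDiff
  have hfc : Continuous (f r) := f.continuous continuous_const continuous_id
  have h1 := hclose θ g _ hθ hgc.continuous fun x => by
    rw [← Real.dist_eq, dist_comm]
    exact (hg x).le
  have h2 := hclose (fun x => θ (f r x)) (fun x => g (f r x)) _ (hθ.comp hfc)
    (hgc.continuous.comp hfc) fun x => by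
      rw [← Real.dist_eq, dist_comm]
      exact (hg (f r x)).le
  rw [h.integral_comp_f hA hfin hμ hgc] at h2
  have h3 : δ / (2 * (W + 1)) * W ≤ δ / 2 := by
    rw [div_mul_eq_mul_div, div_le_div_iff₀ (by positivity) (by positivity)]
    nlinarith
  rw [abs_le] at h1 h2 ⊢
  constructor <;> linarith [h1.1, h1.2, h2.1, h2.2]

/-- The divergence of the vector field of the Anosov flow with respect to `μ` is `ρ⁻¹ X_f(ρ)`. -/
theorem integral_flowDeriv_f [Nonempty M] (h : TimeChangeData E f φ φ' lam τ sStar)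
    (hA : IsAnosovSplitting E f Eu Es) (hfin : ∀ x, Module.finrank ℝ (Eu x) = 1)
    (hμ : ∀ s, MeasurePreserving (φ s) μ μ) {θ : M → ℝ} (hθ : ContMDiff 𝓘(ℝ, E) 𝓘(ℝ, ℝ) 1 θ) :
    ∫ x, (flowDeriv f θ x + logDerivRho f τ x * θ x) ∂μ = 0 := by
  have hcθ := h.c1.continuous_flowDeriv h.data.c1_vectorField hθ
  -- Invariance of ρ⁻¹μ is applied to ρθ, since ρ⁻¹X_f(ρθ) = X_f(θ) + ρ⁻¹X_f(ρ)θ.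
  let κ : M → ℝ := fun x => rho τ x * θ x
  let κ' : M → ℝ := fun x => flowDeriv f (rho τ) x * θ x + rho τ x * flowDeriv f θ x
  have hκ : Continuous κ := h.continuous_rho.mul hθ.continuous
  have hκ' : Continuous κ' :=
    (h.data.continuous.mul hθ.continuous).add (h.continuous_rho.mul hcθ)
  have h1 := integral_mul_flow_sub (μ := μ) h.continuous_rho_inv hκ hκ'
    (fun x s => (h.hasDerivAt_rho x s).mul (h.c1.hasDerivAt_flow hθ x s)) 1
  rw [h.integral_comp_f_of_continuous hA hfin hμ hκ, sub_self] at h1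
  simp only [h.integral_comp_f_of_continuous hA hfin hμ hκ', intervalIntegral.integral_const,
    sub_zero, one_smul] at h1
  rw [h1]
  refine integral_congr_ae (Eventually.of_forall fun x => ?_)
  have hne := (h.rho_pos x).ne'
  simp only [κ', logDerivRho]
  field_simp
  ring

end TimeChangeData

end AnosovFlow

/-! ## The averaged vector field -/

namespace AnosovFlow

section Averaged

variable {E : Type*} [NormedAddCommGroup E] [NormedSpace ℝ E]
variable {F : Type*} [NormedAddCommGroup F] [NormedSpace ℝ F]
variable {M : Type*} [MetricSpace M] [ChartedSpace E M] [IsManifold 𝓘(ℝ, E) ∞ M]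

/-- The average of `ρ⁻¹ X_f(ρ)` along orbit segments of `φ` of length `t`. -/
noncomputable def avgDiv (f φ : Flow ℝ M) (τ : M → ℝ → ℝ) (t : ℝ) (x : M) : ℝ :=
  1 / t * ∫ s in (0 : ℝ)..t, logDerivRho f τ (φ s x)

/-- The average of the functions `timeShift f φ lam τ s` over `s ∈ [0, t]`. -/
noncomputable def avgShift (f φ : Flow ℝ M) (lam : ℝ) (τ : M → ℝ → ℝ) (t : ℝ) (x : M) : ℝ :=
  1 / t * ∫ s in (0 : ℝ)..t, timeShift f φ lam τ s x

variable (E) in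
/-- The vector field `X_f + g X_φ`, where `g` is the averaged time shift. -/
noncomputable def averagedField (f φ : Flow ℝ M) (lam : ℝ) (τ : M → ℝ → ℝ) (t : ℝ) (x : M) :
    TangentSpace 𝓘(ℝ, E) x :=
  vectorField E f x + avgShift f φ lam τ t x • vectorField E φ x

/-- The derivation-like operator `ψ ↦ X_f(ψ) + g X_φ(ψ) + ½ h ψ`. -/
noncomputable def averagedOp (f φ : Flow ℝ M) (lam : ℝ) (τ : M → ℝ → ℝ) (t : ℝ) (ψ : M → ℂ)
    (x : M) : ℂ :=
  flowDeriv f ψ x + avgShift f φ lam τ t x • flowDeriv φ ψ x + (1 / 2 * avgDiv f φ τ t x) • ψ x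

variable {f φ φ' : Flow ℝ M} {lam : ℝ} {τ : M → ℝ → ℝ} {sStar : ℝ → ℝ → M → ℝ}

namespace TimeChangeData

theorem sStar_time_zero [CompactSpace M] (h : TimeChangeData E f φ φ' lam τ sStar) (s : ℝ) (x : M) :
    sStar 0 s x = s := by
  apply (h.reparam.strictMono x).injective
  have := h.tau_sStar 0 s x
  rwa [f.map_zero_apply, Real.rpow_zero, one_mul] at this

/-- The curve r ↦ φ_{-s} f_r φ_s(x) equals φ_{s*(r,s,x)-s}(f_r x), and its velocity at r = 0 is X_f
plus ∂₁s*(0,s,x) times X_φ. -/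
theorem flowDeriv_conj [FiniteDimensional ℝ E] [CompactSpace M]
    (h : TimeChangeData E f φ φ' lam τ sStar) {ψ : M → F}
    (hψ : ContMDiff 𝓘(ℝ, E) 𝓘(ℝ, F) 1 ψ) (s : ℝ) (x : M) :
    flowDeriv f (fun y => ψ (φ (-s) y)) (φ s x) =
      flowDeriv f ψ x + timeShift f φ lam τ s x • flowDeriv φ ψ x := by
  have hq := (h.hasDerivAt_sStar_zero s x).sub_const s
  have h1 := (h.reparam.c1.hasVelocityAt_comp (γ := fun r => f r x) hq
    (h.c1.hasVelocityAt_zero x)).hasDerivAt (hψ.mdifferentiable (by norm_num) _)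
  have h2 : ∀ r, φ (sStar r s x - s) (f r x) = φ (-s) (f r (φ s x)) := fun r => by
    rw [h.comm, ← φ.map_add, neg_add_eq_sub]
  have hid : (φ 0 : M → M) = id := funext fun y => φ.map_zero_apply y
  have hback : φ (-s) (φ s x) = x := by rw [← φ.map_add, neg_add_cancel, φ.map_zero_apply]
  simp only [h2] at h1
  rw [flowDeriv, h1.deriv, h.sStar_time_zero, sub_self, f.map_zero_apply, hid, tmap_id,
    hback, map_add, map_smul, h.c1.flowDeriv_eq hψ, h.reparam.c1.flowDeriv_eq hψ,
    add_comm]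

theorem continuous_logDerivRho_phi (h : TimeChangeData E f φ φ' lam τ sStar) :
    Continuous fun p : ℝ × M => logDerivRho f τ (φ p.1 p.2) :=
  h.continuous_logDerivRho.comp (φ.continuous continuous_fst continuous_snd)

theorem continuous_shift_rate (h : TimeChangeData E f φ φ' lam τ sStar) (x : M) :
    Continuous fun r => Real.log lam + logDerivRho f τ (φ r x) :=
  continuous_const.add (h.continuous_logDerivRho_phi.comp (continuous_id.prodMk continuous_const))

theorem hasDerivAt_timeShift (h : TimeChangeData E f φ φ' lam τ sStar) (s : ℝ) (x : M) :
    HasDerivAt (fun s => timeShift f φ lam τ s x) (Real.log lam + logDerivRho f τ (φ s x)) s :=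
  ((h.continuous_shift_rate x).integral_hasStrictDerivAt 0 s).hasDerivAt

theorem continuous_timeShift (h : TimeChangeData E f φ φ' lam τ sStar) :
    Continuous fun p : ℝ × M => timeShift f φ lam τ p.1 p.2 :=
  intervalIntegral.continuous_parametric_intervalIntegral_of_continuous
    (f := fun (p : ℝ × M) r => Real.log lam + logDerivRho f τ (φ r p.2))
    (continuous_const.add (h.continuous_logDerivRho.comp
      (φ.continuous continuous_snd (continuous_snd.comp continuous_fst)))) continuous_fst

/-- Reduces the iterated integral to one weighted integral of the C^1 function ρ⁻¹X_f(ρ) along φ,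
from which C^1 regularity can be read off. -/
theorem avgShift_eq (h : TimeChangeData E f φ φ' lam τ sStar) (t : ℝ) (x : M) :
    avgShift f φ lam τ t x =
      1 / t * ∫ s in (0 : ℝ)..t, (t - s) * (Real.log lam + logDerivRho f τ (φ s x)) := by
  have hu := h.continuous_shift_rate x
  have hV : Continuous fun s => timeShift f φ lam τ s x :=
    h.continuous_timeShift.comp (continuous_id.prodMk continuous_const)
  -- The primitive s - t of 1 vanishes at s = t and the shift vanishes at s = 0, so there are no
  -- boundary terms.
  have h1 := intervalIntegral.integral_deriv_mul_eq_sub (a := 0) (b := t)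
    (u := fun s => s - t) (u' := fun _ => 1)
    (fun s _ => (hasDerivAt_id s).sub_const t) (fun s _ => h.hasDerivAt_timeShift s x)
    intervalIntegrable_const (hu.intervalIntegrable _ _)
  have h2 : timeShift f φ lam τ 0 x = 0 := intervalIntegral.integral_same
  rw [sub_self, zero_mul, h2, mul_zero, sub_zero] at h1
  have hi1 : IntervalIntegrable (fun s => 1 * timeShift f φ lam τ s x) volume 0 t :=
    (continuous_const.mul hV).intervalIntegrable _ _
  have hi2 : IntervalIntegrable
      (fun s => (s - t) * (Real.log lam + logDerivRho f τ (φ s x))) volume 0 t :=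
    ((continuous_id.sub continuous_const).mul hu).intervalIntegrable _ _
  rw [intervalIntegral.integral_add hi1 hi2] at h1
  rw [avgShift]
  congr 1
  have h3 : ∫ s in (0 : ℝ)..t, (t - s) * (Real.log lam + logDerivRho f τ (φ s x)) =
      -∫ s in (0 : ℝ)..t, (s - t) * (Real.log lam + logDerivRho f τ (φ s x)) := by
    rw [← intervalIntegral.integral_neg]
    congr 1
    ext s
    ring
  rw [h3]
  simp only [one_mul] at h1
  linarith

theorem contMDiff_logDerivRho_phi (h : TimeChangeData E f φ φ' lam τ sStar) :
    ContMDiff (𝓘(ℝ, ℝ).prod 𝓘(ℝ, E)) 𝓘(ℝ, ℝ) 1 (fun p : ℝ × M => logDerivRho f τ (φ p.1 p.2)) :=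
  ContMDiff.comp (g := logDerivRho f τ) h.data.contMDiff h.reparam.c1

theorem dirDeriv_averagedField (h : TimeChangeData E f φ φ' lam τ sStar) (t : ℝ) {ψ : M → F}
    (hψ : ContMDiff 𝓘(ℝ, E) 𝓘(ℝ, F) 1 ψ) (x : M) :
    dirDeriv E ψ x (averagedField E f φ lam τ t x) =
      flowDeriv f ψ x + avgShift f φ lam τ t x • flowDeriv φ ψ x := by
  rw [h.c1.flowDeriv_eq hψ, h.reparam.c1.flowDeriv_eq hψ, ← map_smul, ← map_add]
  rfl

/-- The shifts form an additive cocycle, V_s(φ_r x) = V_{s+r}(x) - V_r(x). Averaging over s and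
differentiating at r = 0 gives V_t/t - (log λ + ρ⁻¹X_f(ρ)), and log λ cancels. -/
theorem flowDeriv_avgShift (h : TimeChangeData E f φ φ' lam τ sStar) {t : ℝ} (ht : t ≠ 0)
    (x : M) : flowDeriv φ (avgShift f φ lam τ t) x = avgDiv f φ τ t x - logDerivRho f τ x := by
  set V : ℝ → ℝ := fun s => timeShift f φ lam τ s x with hVdef
  have hV : Continuous V := h.continuous_timeShift.comp (continuous_id.prodMk continuous_const)
  have hu := h.continuous_shift_rate x
  have hcoc : ∀ r s, timeShift f φ lam τ s (φ r x) = V (s + r) - V r := fun r s => by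
    have h1 := intervalIntegral.integral_comp_add_right (a := 0) (b := s)
      (fun q => Real.log lam + logDerivRho f τ (φ q x)) r
    rw [zero_add] at h1
    simp only [φ.map_add] at h1
    rw [timeShift, h1]
    have h2 := intervalIntegral.integral_add_adjacent_intervals (hu.intervalIntegrable 0 r)
      (hu.intervalIntegrable (μ := volume) r (s + r))
    simp only [hVdef, timeShift]
    linarith
  set P : ℝ → ℝ := fun a => ∫ s in (0 : ℝ)..a, V s with hP
  have hPd : ∀ a, HasDerivAt P (V a) a := fun a => (hV.integral_hasStrictDerivAt 0 a).hasDerivAt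
  have hg : ∀ r, avgShift f φ lam τ t (φ r x) = 1 / t * (P (t + r) - P r - t * V r) := fun r => by
    have h1 := intervalIntegral.integral_comp_add_right (a := 0) (b := t) V r
    rw [zero_add] at h1
    have h2 := intervalIntegral.integral_add_adjacent_intervals (hV.intervalIntegrable 0 r)
      (hV.intervalIntegrable (μ := volume) r (t + r))
    have hVr : Continuous fun s => V (s + r) := hV.comp (continuous_id.add continuous_const)
    simp only [avgShift, hcoc]
    rw [intervalIntegral.integral_sub (hVr.intervalIntegrable _ _) intervalIntegrable_const, h1,
      intervalIntegral.integral_const, sub_zero, smul_eq_mul]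
    simp only [hP]
    rw [← h2]
    ring
  have hP0 : HasDerivAt (fun r => P (t + r)) (V t) 0 := by
    have := hPd (t + 0)
    rw [add_zero] at this
    exact HasDerivAt.comp_const_add t 0 (by rwa [add_zero])
  have hV0 : HasDerivAt V (Real.log lam + logDerivRho f τ x) 0 := by
    have := h.hasDerivAt_timeShift 0 x
    rwa [φ.map_zero_apply] at this
  have hd := ((hP0.sub (hPd 0)).sub (hV0.const_mul t)).const_mul (1 / t)
  have hVz : V 0 = 0 := intervalIntegral.integral_same
  have hVt : V t = t * Real.log lam + ∫ s in (0 : ℝ)..t, logDerivRho f τ (φ s x) := by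
    have hc : Continuous fun s => logDerivRho f τ (φ s x) :=
      h.continuous_logDerivRho_phi.comp (continuous_id.prodMk continuous_const)
    simp only [hVdef, timeShift]
    rw [intervalIntegral.integral_add intervalIntegrable_const (hc.intervalIntegrable _ _),
      intervalIntegral.integral_const, sub_zero, smul_eq_mul]
  rw [flowDeriv, funext hg]
  refine (HasDerivAt.deriv hd).trans ?_
  rw [hVz, hVt, avgDiv]
  field_simp
  ring

variable [FiniteDimensional ℝ E]

theorem contMDiff_avgDiv (h : TimeChangeData E f φ φ' lam τ sStar) (t : ℝ) :
    ContMDiff 𝓘(ℝ, E) 𝓘(ℝ, ℝ) 1 (avgDiv f φ τ t) :=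
  contMDiff_const.mul (contMDiff_intervalIntegral (F := fun s x => logDerivRho f τ (φ s x))
    h.contMDiff_logDerivRho_phi 0 t)

theorem contMDiff_avgShift (h : TimeChangeData E f φ φ' lam τ sStar) (t : ℝ) :
    ContMDiff 𝓘(ℝ, E) 𝓘(ℝ, ℝ) 1 (avgShift f φ lam τ t) := by
  rw [funext (h.avgShift_eq t)]
  refine contMDiff_const.mul (contMDiff_intervalIntegral
    (F := fun s x => (t - s) * (Real.log lam + logDerivRho f τ (φ s x))) ?_ 0 t)
  have h1 : ContMDiff 𝓘(ℝ, ℝ) 𝓘(ℝ, ℝ) 1 (fun s : ℝ => t - s) :=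
    (contDiff_const.sub contDiff_id).contMDiff
  exact (h1.comp contMDiff_fst).mul (contMDiff_const.add h.contMDiff_logDerivRho_phi)

theorem contMDiff_averagedField (h : TimeChangeData E f φ φ' lam τ sStar) (t : ℝ) :
    ContMDiff 𝓘(ℝ, E) 𝓘(ℝ, E).tangent 1
      (fun x => (⟨x, averagedField E f φ lam τ t x⟩ : TangentBundle 𝓘(ℝ, E) M)) :=
  ContMDiff.add_section (V := fun x : M => TangentSpace 𝓘(ℝ, E) x) h.data.c1_vectorField
    (ContMDiff.smul_section (V := fun x : M => TangentSpace 𝓘(ℝ, E) x) (h.contMDiff_avgShift t)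
      h.data.c1_vectorField')

end TimeChangeData

end Averaged

namespace TimeChangeData

variable {E : Type*} [NormedAddCommGroup E] [NormedSpace ℝ E] [FiniteDimensional ℝ E]
variable {M : Type*} [MetricSpace M] [ChartedSpace E M] [IsManifold 𝓘(ℝ, E) ∞ M]
  [CompactSpace M] [Nonempty M] [MeasurableSpace M] [BorelSpace M] {μ : Measure M}
  [IsFiniteMeasure μ]
variable {f φ φ' : Flow ℝ M} {lam : ℝ} {τ : M → ℝ → ℝ} {sStar : ℝ → ℝ → M → ℝ}
  [RiemannianBundle (fun x : M => TangentSpace 𝓘(ℝ, E) x)]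
  [IsContMDiffRiemannianBundle 𝓘(ℝ, E) ∞ E (fun x : M => TangentSpace 𝓘(ℝ, E) x)]
  [IsRiemannianManifold 𝓘(ℝ, E) M]
  {Eu Es : (x : M) → Submodule ℝ (TangentSpace 𝓘(ℝ, E) x)}

/-- The divergence of the averaged vector field with respect to `μ`. -/
theorem integral_averagedField (h : TimeChangeData E f φ φ' lam τ sStar)
    (hA : IsAnosovSplitting E f Eu Es) (hfin : ∀ x, Module.finrank ℝ (Eu x) = 1)
    (hμ : ∀ s, MeasurePreserving (φ s) μ μ) {t : ℝ} (ht : t ≠ 0) {θ : M → ℝ}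
    (hθ : ContMDiff 𝓘(ℝ, E) 𝓘(ℝ, ℝ) 1 θ) :
    ∫ x, (dirDeriv E θ x (averagedField E f φ lam τ t x) + avgDiv f φ τ t x * θ x) ∂μ = 0 := by
  have hg := h.contMDiff_avgShift t
  have h1 := h.integral_flowDeriv_f hA hfin hμ hθ
  -- Applied to gθ: the term X_φ(g)θ turns the divergence ρ⁻¹X_f(ρ) of X_f into the averaged
  -- function h.
  have h2 := h.reparam.c1.integral_flowDeriv_eq_zero h.data.c1_vectorField' hμ (hg.mul hθ)
  have hprod : ∀ x, flowDeriv φ (fun x => avgShift f φ lam τ t x * θ x) x =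
      (avgDiv f φ τ t x - logDerivRho f τ x) * θ x +
        avgShift f φ lam τ t x * flowDeriv φ θ x := fun x => by
    have h3 := (h.reparam.c1.hasDerivAt_flow hg x 0).mul (h.reparam.c1.hasDerivAt_flow hθ x 0)
    rw [φ.map_zero_apply, h.flowDeriv_avgShift ht] at h3
    exact h3.deriv
  have hi1 : Integrable (fun x => flowDeriv f θ x + logDerivRho f τ x * θ x) μ :=
    integrable_of_continuous ((h.c1.continuous_flowDeriv h.data.c1_vectorField hθ).add
      (h.continuous_logDerivRho.mul hθ.continuous))
  have hi2 : Integrable (flowDeriv φ (fun x => avgShift f φ lam τ t x * θ x)) μ :=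
    integrable_of_continuous (h.reparam.c1.continuous_flowDeriv h.data.c1_vectorField' (hg.mul hθ))
  have h4 := integral_add hi1 hi2
  change _ = _ + ∫ x, flowDeriv φ (avgShift f φ lam τ t * θ) x ∂μ at h4
  rw [h1, h2, add_zero] at h4
  rw [← h4]
  refine integral_congr_ae (Eventually.of_forall fun x => ?_)
  change _ = flowDeriv f θ x + logDerivRho f τ x * θ x +
    flowDeriv φ (fun x => avgShift f φ lam τ t x * θ x) x
  rw [hprod]
  change dirDeriv E θ x (averagedField E f φ lam τ t x) + avgDiv f φ τ t x * θ x = _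
  rw [h.dirDeriv_averagedField t hθ, smul_eq_mul]
  ring

end TimeChangeData

end AnosovFlow

/-! ## The conjugate operator -/

namespace AnosovFlow

section

variable {E : Type*} [NormedAddCommGroup E] [NormedSpace ℝ E]
variable {M : Type*} [MetricSpace M] [ChartedSpace E M]

variable (E M) in
/-- The complex-valued functions of class `C^1`. -/
noncomputable def c1Functions : Submodule ℂ C(M, ℂ) where
  carrier := {ψ | ContMDiff 𝓘(ℝ, E) 𝓘(ℝ, ℂ) 1 ψ}
  add_mem' h1 h2 := h1.add h2
  zero_mem' := contMDiff_const
  smul_mem' c _ h := by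
    have h1 : ContMDiff 𝓘(ℝ, ℂ) 𝓘(ℝ, ℂ) 1 (fun z : ℂ => c * z) :=
      ((contDiff_const (c := c)).mul contDiff_id).contMDiff
    exact h1.comp h

theorem dense_c1Functions [FiniteDimensional ℝ E] [CompactSpace M] [IsManifold 𝓘(ℝ, E) ∞ M] :
    Dense (c1Functions E M : Set C(M, ℂ)) := by
  intro ψ
  rw [Metric.mem_closure_iff]
  intro ε hε
  obtain ⟨g, hg, -⟩ := ψ.continuous.exists_contMDiff_approx 𝓘(ℝ, E) 1
    (continuous_const (y := ε / 2)) (fun _ => by positivity)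
  have hgc : ContMDiff 𝓘(ℝ, E) 𝓘(ℝ, ℂ) 1 g := g.contMDiff
  refine ⟨⟨g, hgc.continuous⟩, hgc, ?_⟩
  refine lt_of_le_of_lt ((ContinuousMap.dist_le (by positivity)).2 fun x => ?_) (half_lt_self hε)
  rw [dist_comm]
  exact (hg x).le

theorem flowDeriv_add {f : Flow ℝ M} (hf : IsC1Flow E f) {ψ χ : M → ℂ}
    (hψ : ContMDiff 𝓘(ℝ, E) 𝓘(ℝ, ℂ) 1 ψ) (hχ : ContMDiff 𝓘(ℝ, E) 𝓘(ℝ, ℂ) 1 χ) (x : M) :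
    flowDeriv f (fun y => ψ y + χ y) x = flowDeriv f ψ x + flowDeriv f χ x := by
  have h := (hf.hasDerivAt_flow hψ x 0).add (hf.hasDerivAt_flow hχ x 0)
  rw [f.map_zero_apply] at h
  exact h.deriv

theorem flowDeriv_const_mul {f : Flow ℝ M} (hf : IsC1Flow E f) (c : ℂ) {ψ : M → ℂ}
    (hψ : ContMDiff 𝓘(ℝ, E) 𝓘(ℝ, ℂ) 1 ψ) (x : M) :
    flowDeriv f (fun y => c * ψ y) x = c * flowDeriv f ψ x := by
  have h := (hf.hasDerivAt_flow hψ x 0).const_mul c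
  rw [f.map_zero_apply] at h
  exact h.deriv

/-- A measure with full mass invariant under a minimal flow has full support. -/
theorem isOpenPosMeasure_of_dense_orbit [CompactSpace M] [MeasurableSpace M] [BorelSpace M]
    {μ : Measure M} [NeZero μ] {φ : Flow ℝ M} (hd : ∀ x, Dense (φ.orbit x))
    (hμ : ∀ s, MeasurePreserving (φ s) μ μ) : μ.IsOpenPosMeasure := by
  refine ⟨fun U hU hne h0 => NeZero.ne μ (Measure.measure_univ_eq_zero.1 ?_)⟩
  have hcover : (univ : Set M) ⊆ ⋃ s : ℝ, φ s ⁻¹' U := fun x _ => by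
    obtain ⟨_, ⟨s, rfl⟩, hs⟩ := (hd x).exists_mem_open hU hne |>.imp fun _ h => h
    exact mem_iUnion.2 ⟨s, hs⟩
  have hc : ∀ s, Continuous (φ s) := fun s => φ.continuous continuous_const continuous_id
  obtain ⟨t, ht⟩ := isCompact_univ.elim_finite_subcover _ (fun s => hU.preimage (hc s)) hcover
  refine measure_mono_null ht ((measure_biUnion_null_iff t.countable_toSet).2 fun s _ => ?_)
  rw [(hμ s).measure_preimage hU.measurableSet.nullMeasurableSet, h0]

end

namespace TimeChangeData

variable {E : Type*} [NormedAddCommGroup E] [NormedSpace ℝ E]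
variable {M : Type*} [MetricSpace M] [ChartedSpace E M] [IsManifold 𝓘(ℝ, E) ∞ M]
variable {f φ φ' : Flow ℝ M} {lam : ℝ} {τ : M → ℝ → ℝ} {sStar : ℝ → ℝ → M → ℝ}

variable [FiniteDimensional ℝ E]

theorem continuous_averagedOp (h : TimeChangeData E f φ φ' lam τ sStar) (t : ℝ) {ψ : M → ℂ}
    (hψ : ContMDiff 𝓘(ℝ, E) 𝓘(ℝ, ℂ) 1 ψ) : Continuous (averagedOp f φ lam τ t ψ) :=
  ((h.c1.continuous_flowDeriv h.data.c1_vectorField hψ).add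
    ((h.contMDiff_avgShift t).continuous.smul
      (h.reparam.c1.continuous_flowDeriv h.data.c1_vectorField' hψ))).add
    ((continuous_const.mul (h.contMDiff_avgDiv t).continuous).smul hψ.continuous)

/-- The operator `2 i (X_f + g X_φ + ½ h)` from `C^1` functions to continuous functions. -/
noncomputable def conjugateOp (h : TimeChangeData E f φ φ' lam τ sStar) (t : ℝ) :
    c1Functions E M →ₗ[ℂ] C(M, ℂ) where
  toFun ψ := ⟨fun x => 2 * Complex.I * averagedOp f φ lam τ t (ψ : C(M, ℂ)) x,
    continuous_const.mul (h.continuous_averagedOp t ψ.2)⟩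
  map_add' ψ χ := by
    ext x
    have h1 := flowDeriv_add h.c1 ψ.2 χ.2 x
    have h2 := flowDeriv_add h.reparam.c1 ψ.2 χ.2 x
    change 2 * Complex.I * (flowDeriv f (fun y => (ψ : C(M, ℂ)) y + (χ : C(M, ℂ)) y) x +
      avgShift f φ lam τ t x • flowDeriv φ (fun y => (ψ : C(M, ℂ)) y + (χ : C(M, ℂ)) y) x +
      (1 / 2 * avgDiv f φ τ t x) • ((ψ : C(M, ℂ)) x + (χ : C(M, ℂ)) x)) =
      2 * Complex.I * averagedOp f φ lam τ t (ψ : C(M, ℂ)) x +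
      2 * Complex.I * averagedOp f φ lam τ t (χ : C(M, ℂ)) x
    rw [h1, h2, averagedOp, averagedOp, smul_add, smul_add]
    ring
  map_smul' c ψ := by
    ext x
    have h1 := flowDeriv_const_mul h.c1 c ψ.2 x
    have h2 := flowDeriv_const_mul h.reparam.c1 c ψ.2 x
    change 2 * Complex.I * (flowDeriv f (fun y => c * (ψ : C(M, ℂ)) y) x +
      avgShift f φ lam τ t x • flowDeriv φ (fun y => c * (ψ : C(M, ℂ)) y) x +
      (1 / 2 * avgDiv f φ τ t x) • (c * (ψ : C(M, ℂ)) x)) =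
      c * (2 * Complex.I * averagedOp f φ lam τ t (ψ : C(M, ℂ)) x)
    rw [h1, h2, averagedOp, ← mul_smul_comm, ← mul_smul_comm]
    ring

theorem conjugateOp_apply (h : TimeChangeData E f φ φ' lam τ sStar) (t : ℝ)
    (ψ : c1Functions E M) (x : M) :
    h.conjugateOp t ψ x = 2 * Complex.I * averagedOp f φ lam τ t (ψ : C(M, ℂ)) x := rfl

variable [CompactSpace M]

/-- Conjugation by U_s adds V_s X_φ to the first-order part and translates the zero-order
coefficient along φ. -/
theorem pullback_generatorSum (h : TimeChangeData E f φ φ' lam τ sStar) {ψ : M → ℂ}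
    (hψ : ContMDiff 𝓘(ℝ, E) 𝓘(ℝ, ℂ) 1 ψ) (s : ℝ) (x : M) :
    pullback φ s (generatorSum f (rho τ) (pullback φ (-s) ψ)) x =
      2 * Complex.I * (flowDeriv f ψ x + timeShift f φ lam τ s x • flowDeriv φ ψ x) +
        Complex.I * (logDerivRho f τ (φ s x) : ℂ) * ψ x := by
  have h1 := h.flowDeriv_conj hψ s x
  have hback : φ (-s) (φ s x) = x := by rw [← φ.map_add, neg_add_cancel, φ.map_zero_apply]
  change 2 * Complex.I * flowDeriv f (fun y => ψ (φ (-s) y)) (φ s x) +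
    Complex.I * (logDerivRho f τ (φ s x) : ℂ) * ψ (φ (-s) (φ s x)) = _
  rw [h1, hback]

variable [MeasurableSpace M] [BorelSpace M] {μ : Measure M} [IsFiniteMeasure μ]

/-- The Birkhoff average of a `C^1` function is given by the conjugate operator. -/
theorem isBirkhoffAverage (h : TimeChangeData E f φ φ' lam τ sStar) {t : ℝ} (ht : t ≠ 0)
    (ψ : c1Functions E M) :
    IsBirkhoffAverage f φ (rho τ) μ t (ψ : C(M, ℂ))
      (ContinuousMap.toLp 2 μ ℂ (h.conjugateOp t ψ)) := by
  have hψ : ContMDiff 𝓘(ℝ, E) 𝓘(ℝ, ℂ) 1 (ψ : C(M, ℂ)) := ψ.2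
  have hc1 := h.c1.continuous_flowDeriv h.data.c1_vectorField hψ
  have hc2 := h.reparam.c1.continuous_flowDeriv h.data.c1_vectorField' hψ
  let W : C(ℝ × M, ℂ) := ⟨fun p =>
    2 * Complex.I * (flowDeriv f (ψ : C(M, ℂ)) p.2 +
      timeShift f φ lam τ p.1 p.2 • flowDeriv φ (ψ : C(M, ℂ)) p.2) +
        Complex.I * (logDerivRho f τ (φ p.1 p.2) : ℂ) * (ψ : C(M, ℂ)) p.2, by
    refine (continuous_const.mul ((hc1.comp continuous_snd).add
      (h.continuous_timeShift.smul (hc2.comp continuous_snd)))).add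
      ((continuous_const.mul (Complex.continuous_ofReal.comp h.continuous_logDerivRho_phi)).mul
        (hψ.continuous.comp continuous_snd))⟩
  -- The integrand is a continuous curve in `C(M, ℂ)`. Integrating there allows evaluation at
  -- points, and the continuous inclusion into L² carries the result over.
  have hW : Continuous fun s => W.curry s := W.curry.continuous
  have hWi : IntervalIntegrable (fun s => W.curry s) volume 0 t := hW.intervalIntegrable _ _
  let L : C(M, ℂ) →L[ℂ] Lp ℂ 2 μ := ContinuousMap.toLp 2 μ ℂ
  refine ⟨fun s => L (W.curry s), fun s => ?_,
    (L.continuous.comp hW).intervalIntegrable _ _, ?_⟩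
  · filter_upwards [ContinuousMap.coeFn_toLp (p := 2) (𝕜 := ℂ) μ (W.curry s)] with x hx
    rw [hx, h.pullback_generatorSum hψ]
    rfl
  · rw [ContinuousLinearMap.intervalIntegral_comp_comm L hWi]
    change L _ = _
    rw [← map_smul]
    congr 1
    ext x
    have h1 : (∫ s in (0 : ℝ)..t, W.curry s) x = ∫ s in (0 : ℝ)..t, W (s, x) :=
      (ContinuousLinearMap.intervalIntegral_comp_comm
        (ContinuousMap.evalCLM ℂ x : C(M, ℂ) →L[ℂ] ℂ) hWi).symm
    have hTc : Continuous fun s => timeShift f φ lam τ s x :=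
      h.continuous_timeShift.comp (continuous_id.prodMk continuous_const)
    have hLc : Continuous fun s => logDerivRho f τ (φ s x) :=
      h.continuous_logDerivRho_phi.comp (continuous_id.prodMk continuous_const)
    have h2 : ∫ s in (0 : ℝ)..t, W (s, x) =
        2 * Complex.I * (t * flowDeriv f (ψ : C(M, ℂ)) x +
          (∫ s in (0 : ℝ)..t, timeShift f φ lam τ s x : ℝ) * flowDeriv φ (ψ : C(M, ℂ)) x) +
        Complex.I * (∫ s in (0 : ℝ)..t, logDerivRho f τ (φ s x) : ℝ) * (ψ : C(M, ℂ)) x := by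
      have hW2 : ∀ s, W (s, x) = 2 * Complex.I * flowDeriv f (ψ : C(M, ℂ)) x +
          ((timeShift f φ lam τ s x : ℝ) : ℂ) * (2 * Complex.I * flowDeriv φ (ψ : C(M, ℂ)) x) +
          ((logDerivRho f τ (φ s x) : ℝ) : ℂ) * (Complex.I * (ψ : C(M, ℂ)) x) := fun s => by
        change 2 * Complex.I * (flowDeriv f (ψ : C(M, ℂ)) x +
          timeShift f φ lam τ s x • flowDeriv φ (ψ : C(M, ℂ)) x) +
          Complex.I * (logDerivRho f τ (φ s x) : ℂ) * (ψ : C(M, ℂ)) x = _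
        rw [Complex.real_smul]
        ring
      simp only [hW2]
      have hi1 : IntervalIntegrable (fun s => ((timeShift f φ lam τ s x : ℝ) : ℂ) *
          (2 * Complex.I * flowDeriv φ (ψ : C(M, ℂ)) x)) volume 0 t :=
        ((Complex.continuous_ofReal.comp hTc).mul continuous_const).intervalIntegrable _ _
      have hi2 : IntervalIntegrable (fun s => ((logDerivRho f τ (φ s x) : ℝ) : ℂ) *
          (Complex.I * (ψ : C(M, ℂ)) x)) volume 0 t :=
        ((Complex.continuous_ofReal.comp hLc).mul continuous_const).intervalIntegrable _ _
      rw [intervalIntegral.integral_add (intervalIntegrable_const.add hi1) hi2,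
        intervalIntegral.integral_add intervalIntegrable_const hi1,
        intervalIntegral.integral_const, intervalIntegral.integral_mul_const,
        intervalIntegral.integral_mul_const, intervalIntegral.integral_ofReal,
        intervalIntegral.integral_ofReal, sub_zero, Complex.real_smul]
      ring
    rw [ContinuousMap.smul_apply, h1, h2, h.conjugateOp_apply, averagedOp, avgShift, avgDiv,
      smul_eq_mul, Complex.real_smul, Complex.real_smul]
    have ht' : (t : ℂ) ≠ 0 := Complex.ofReal_ne_zero.2 ht
    push_cast
    field_simp

/-- The conjugate operator in `L²(M, μ)`. -/
noncomputable def conjugateOperator [μ.IsOpenPosMeasure]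
    (h : TimeChangeData E f φ φ' lam τ sStar) (t : ℝ) : Lp ℂ 2 μ →ₗ.[ℂ] Lp ℂ 2 μ where
  domain := (c1Functions E M).map (ContinuousMap.toLp 2 μ ℂ : C(M, ℂ) →L[ℂ] Lp ℂ 2 μ).toLinearMap
  toFun := ((ContinuousMap.toLp 2 μ ℂ : C(M, ℂ) →L[ℂ] Lp ℂ 2 μ).toLinearMap ∘ₗ
    h.conjugateOp t) ∘ₗ (Submodule.equivMapOfInjective _
      (ContinuousMap.toLp_injective (p := 2) (𝕜 := ℂ) μ) (c1Functions E M)).symm.toLinearMap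

end TimeChangeData

end AnosovFlow

/-! ## Symmetry of the conjugate operator -/

namespace AnosovFlow

section

variable {E : Type*} [NormedAddCommGroup E] [NormedSpace ℝ E]
variable {M : Type*} [MetricSpace M] [ChartedSpace E M]

theorem flowDeriv_clm_comp {F G : Type*} [NormedAddCommGroup F] [NormedSpace ℝ F]
    [NormedAddCommGroup G] [NormedSpace ℝ G] {f : Flow ℝ M} (hf : IsC1Flow E f) (L : F →L[ℝ] G)
    {ψ : M → F} (hψ : ContMDiff 𝓘(ℝ, E) 𝓘(ℝ, F) 1 ψ) (x : M) :
    flowDeriv f (fun y => L (ψ y)) x = L (flowDeriv f ψ x) := by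
  have h := L.hasFDerivAt.comp_hasDerivAt (0 : ℝ) (hf.hasDerivAt_flow hψ x 0)
  rw [f.map_zero_apply] at h
  exact h.deriv

theorem flowDeriv_mul {f : Flow ℝ M} (hf : IsC1Flow E f) {ψ χ : M → ℂ}
    (hψ : ContMDiff 𝓘(ℝ, E) 𝓘(ℝ, ℂ) 1 ψ) (hχ : ContMDiff 𝓘(ℝ, E) 𝓘(ℝ, ℂ) 1 χ) (x : M) :
    flowDeriv f (fun y => ψ y * χ y) x = flowDeriv f ψ x * χ x + ψ x * flowDeriv f χ x := by
  have h := (hf.hasDerivAt_flow hψ x 0).mul (hf.hasDerivAt_flow hχ x 0)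
  rw [f.map_zero_apply] at h
  exact h.deriv

theorem contMDiff_conj {ψ : M → ℂ} (hψ : ContMDiff 𝓘(ℝ, E) 𝓘(ℝ, ℂ) 1 ψ) :
    ContMDiff 𝓘(ℝ, E) 𝓘(ℝ, ℂ) 1 fun x => starRingEnd ℂ (ψ x) :=
  Complex.conjCLE.contDiff.contMDiff.comp hψ

theorem contMDiff_complex_mul {ψ χ : M → ℂ} (hψ : ContMDiff 𝓘(ℝ, E) 𝓘(ℝ, ℂ) 1 ψ)
    (hχ : ContMDiff 𝓘(ℝ, E) 𝓘(ℝ, ℂ) 1 χ) : ContMDiff 𝓘(ℝ, E) 𝓘(ℝ, ℂ) 1 fun x => ψ x * χ x := by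
  have h : ContMDiff 𝓘(ℝ, ℂ × ℂ) 𝓘(ℝ, ℂ) 1 (fun z : ℂ × ℂ => z.1 * z.2) :=
    (contDiff_fst.mul contDiff_snd).contMDiff
  exact h.comp (hψ.prodMk_space hχ)

end

namespace TimeChangeData

variable {E : Type*} [NormedAddCommGroup E] [NormedSpace ℝ E] [FiniteDimensional ℝ E]
variable {M : Type*} [MetricSpace M] [ChartedSpace E M] [IsManifold 𝓘(ℝ, E) ∞ M]
  [CompactSpace M] [MeasurableSpace M] [BorelSpace M] {μ : Measure M} [IsFiniteMeasure μ]
variable {f φ φ' : Flow ℝ M} {lam : ℝ} {τ : M → ℝ → ℝ} {sStar : ℝ → ℝ → M → ℝ}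

/-! ### Domain and values of the conjugate operator -/

section Domain

variable [μ.IsOpenPosMeasure]

theorem toLp_mem_domain (h : TimeChangeData E f φ φ' lam τ sStar) (t : ℝ) (ψ : c1Functions E M) :
    ContinuousMap.toLp 2 μ ℂ (ψ : C(M, ℂ)) ∈ (h.conjugateOperator (μ := μ) t).domain :=
  Submodule.mem_map_of_mem ψ.2

theorem exists_of_mem_domain (h : TimeChangeData E f φ φ' lam τ sStar) {t : ℝ}
    (u : (h.conjugateOperator (μ := μ) t).domain) : ∃ ψ : c1Functions E M,
      u = ⟨ContinuousMap.toLp 2 μ ℂ (ψ : C(M, ℂ)), h.toLp_mem_domain t ψ⟩ := by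
  obtain ⟨ψ, hψ, hu⟩ := Submodule.mem_map.1 u.2
  exact ⟨⟨ψ, hψ⟩, Subtype.ext hu.symm⟩

theorem conjugateOperator_toLp (h : TimeChangeData E f φ φ' lam τ sStar) (t : ℝ)
    (ψ : c1Functions E M) :
    h.conjugateOperator (μ := μ) t ⟨_, h.toLp_mem_domain t ψ⟩ =
      ContinuousMap.toLp 2 μ ℂ (h.conjugateOp t ψ) := by
  change ContinuousMap.toLp 2 μ ℂ (h.conjugateOp t ((Submodule.equivMapOfInjective _
      (ContinuousMap.toLp_injective (p := 2) (𝕜 := ℂ) μ) (c1Functions E M)).symm _)) = _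
  congr 2
  exact (Submodule.equivMapOfInjective _ (ContinuousMap.toLp_injective (p := 2) (𝕜 := ℂ) μ)
    (c1Functions E M)).symm_apply_apply ψ

theorem dense_domain_conjugateOperator (h : TimeChangeData E f φ φ' lam τ sStar) (t : ℝ) :
    Dense ((h.conjugateOperator (μ := μ) t).domain : Set (Lp ℂ 2 μ)) := by
  have h1 : DenseRange (ContinuousMap.toLp 2 μ ℂ : C(M, ℂ) →L[ℂ] Lp ℂ 2 μ) :=
    ContinuousMap.toLp_denseRange ℂ μ ℂ (by norm_num)
  exact h1.dense_image (ContinuousMap.toLp 2 μ ℂ : C(M, ℂ) →L[ℂ] Lp ℂ 2 μ).continuous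
    dense_c1Functions

theorem isConjugateOperator (h : TimeChangeData E f φ φ' lam τ sStar) {t : ℝ} (ht : t ≠ 0) :
    IsConjugateOperator E f φ (rho τ) μ t (h.conjugateOperator (μ := μ) t) where
  mem_domain_iff u := by
    constructor
    · intro hu
      obtain ⟨ψ, hψ⟩ := h.exists_of_mem_domain ⟨u, hu⟩
      have hu' : u = ContinuousMap.toLp 2 μ ℂ (ψ : C(M, ℂ)) := congrArg Subtype.val hψ
      exact ⟨(ψ : C(M, ℂ)), ψ.2, hu' ▸ ContinuousMap.coeFn_toLp μ (ψ : C(M, ℂ))⟩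
    · rintro ⟨ψ, hψ, hu⟩
      have hu' : u = ContinuousMap.toLp 2 μ ℂ (⟨ψ, hψ.continuous⟩ : C(M, ℂ)) :=
        Lp.ext (hu.trans (ContinuousMap.coeFn_toLp μ (⟨ψ, hψ.continuous⟩ : C(M, ℂ))).symm)
      rw [hu']
      exact h.toLp_mem_domain t ⟨⟨ψ, hψ.continuous⟩, hψ⟩
  apply_eq u ψ hψ hu := by
    obtain ⟨χ, rfl⟩ := h.exists_of_mem_domain u
    -- Because μ has full support, an L² class has at most one continuous representative, so the
    -- value does not depend on the chosen function.
    have h1 : ((χ : C(M, ℂ)) : M → ℂ) = ψ := Measure.eq_of_ae_eq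
      ((ContinuousMap.coeFn_toLp (p := 2) (𝕜 := ℂ) μ (χ : C(M, ℂ))).symm.trans hu)
      (χ : C(M, ℂ)).continuous hψ.continuous
    rw [← h1, h.conjugateOperator_toLp]
    exact h.isBirkhoffAverage ht χ

end Domain

variable [Nonempty M]
  [RiemannianBundle (fun x : M => TangentSpace 𝓘(ℝ, E) x)]
  [IsContMDiffRiemannianBundle 𝓘(ℝ, E) ∞ E (fun x : M => TangentSpace 𝓘(ℝ, E) x)]
  [IsRiemannianManifold 𝓘(ℝ, E) M]
  {Eu Es : (x : M) → Submodule ℝ (TangentSpace 𝓘(ℝ, E) x)}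

theorem integral_averagedField_complex (h : TimeChangeData E f φ φ' lam τ sStar)
    (hA : IsAnosovSplitting E f Eu Es) (hfin : ∀ x, Module.finrank ℝ (Eu x) = 1)
    (hμ : ∀ s, MeasurePreserving (φ s) μ μ) {t : ℝ} (ht : t ≠ 0) {θ : M → ℂ}
    (hθ : ContMDiff 𝓘(ℝ, E) 𝓘(ℝ, ℂ) 1 θ) :
    ∫ x, (flowDeriv f θ x + avgShift f φ lam τ t x • flowDeriv φ θ x +
      avgDiv f φ τ t x • θ x) ∂μ = 0 := by
  have hi : Integrable (fun x => flowDeriv f θ x + avgShift f φ lam τ t x • flowDeriv φ θ x +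
      avgDiv f φ τ t x • θ x) μ := integrable_of_continuous
    (((h.c1.continuous_flowDeriv h.data.c1_vectorField hθ).add
    ((h.contMDiff_avgShift t).continuous.smul
      (h.reparam.c1.continuous_flowDeriv h.data.c1_vectorField' hθ))).add
    ((h.contMDiff_avgDiv t).continuous.smul hθ.continuous))
  have key : ∀ L : ℂ →L[ℝ] ℝ, L (∫ x, (flowDeriv f θ x +
      avgShift f φ lam τ t x • flowDeriv φ θ x + avgDiv f φ τ t x • θ x) ∂μ) = 0 := fun L => by
    have hL : ContMDiff 𝓘(ℝ, E) 𝓘(ℝ, ℝ) 1 fun x => L (θ x) := L.contDiff.contMDiff.comp hθ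
    rw [← L.integral_comp_comm hi, ← h.integral_averagedField hA hfin hμ ht hL]
    refine integral_congr_ae (Eventually.of_forall fun x => ?_)
    change L _ = _ + _
    rw [h.dirDeriv_averagedField t hL, flowDeriv_clm_comp h.c1 L hθ,
      flowDeriv_clm_comp h.reparam.c1 L hθ, map_add, map_add, map_smul, map_smul, smul_eq_mul,
      smul_eq_mul]
  exact Complex.ext (key Complex.reCLM) (key Complex.imCLM)

/-- By Leibniz's rule the integrand is Y(ψχ̄) + hψχ̄, since the two halves of h add up; it has
integral 0 because h is the divergence of Y. So Y + h/2 is skew-symmetric. -/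
theorem integral_mul_conj_averagedOp (h : TimeChangeData E f φ φ' lam τ sStar)
    (hA : IsAnosovSplitting E f Eu Es) (hfin : ∀ x, Module.finrank ℝ (Eu x) = 1)
    (hμ : ∀ s, MeasurePreserving (φ s) μ μ) {t : ℝ} (ht : t ≠ 0) {ψ χ : M → ℂ}
    (hψ : ContMDiff 𝓘(ℝ, E) 𝓘(ℝ, ℂ) 1 ψ) (hχ : ContMDiff 𝓘(ℝ, E) 𝓘(ℝ, ℂ) 1 χ) :
    ∫ x, (averagedOp f φ lam τ t ψ x * starRingEnd ℂ (χ x) +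
      ψ x * starRingEnd ℂ (averagedOp f φ lam τ t χ x)) ∂μ = 0 := by
  have hχ' := contMDiff_conj hχ
  rw [← h.integral_averagedField_complex hA hfin hμ ht (contMDiff_complex_mul hψ hχ')]
  refine integral_congr_ae (Eventually.of_forall fun x => ?_)
  have h1 : flowDeriv f (fun x => starRingEnd ℂ (χ x)) x = starRingEnd ℂ (flowDeriv f χ x) :=
    flowDeriv_clm_comp h.c1 (Complex.conjCLE : ℂ →L[ℝ] ℂ) hχ x
  have h2 : flowDeriv φ (fun x => starRingEnd ℂ (χ x)) x = starRingEnd ℂ (flowDeriv φ χ x) :=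
    flowDeriv_clm_comp h.reparam.c1 (Complex.conjCLE : ℂ →L[ℝ] ℂ) hχ x
  change averagedOp f φ lam τ t ψ x * starRingEnd ℂ (χ x) +
      ψ x * starRingEnd ℂ (averagedOp f φ lam τ t χ x) = flowDeriv f _ x + _ • flowDeriv φ _ x + _
  rw [flowDeriv_mul h.c1 hψ hχ', flowDeriv_mul h.reparam.c1 hψ hχ', h1, h2]
  simp only [averagedOp, Complex.real_smul, map_add, map_mul, Complex.conj_ofReal]
  push_cast
  ring

theorem isFormalAdjoint_conjugateOperator [μ.IsOpenPosMeasure]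
    (h : TimeChangeData E f φ φ' lam τ sStar)
    (hA : IsAnosovSplitting E f Eu Es) (hfin : ∀ x, Module.finrank ℝ (Eu x) = 1)
    (hμ : ∀ s, MeasurePreserving (φ s) μ μ) {t : ℝ} (ht : t ≠ 0) :
    (h.conjugateOperator (μ := μ) t).IsFormalAdjoint (h.conjugateOperator t) := by
  intro u v
  obtain ⟨χ, rfl⟩ := h.exists_of_mem_domain u
  obtain ⟨ψ, rfl⟩ := h.exists_of_mem_domain v
  rw [h.conjugateOperator_toLp, h.conjugateOperator_toLp, ContinuousMap.inner_toLp,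
    ContinuousMap.inner_toLp, ← sub_eq_zero]
  have hcont : ∀ κ₁ κ₂ : C(M, ℂ), Integrable (fun x => κ₁ x * starRingEnd ℂ (κ₂ x)) μ :=
    fun κ₁ κ₂ => integrable_of_continuous
      (κ₁.continuous.mul (Complex.continuous_conj.comp κ₂.continuous))
  rw [← integral_sub (hcont _ _) (hcont _ _)]
  -- The inner product is conjugate linear in the first argument, so 2i comes out of ⟨Aχ, ψ⟩ as -2i.
  have h1 := congrArg (fun z => -(2 * Complex.I) * z)
    (h.integral_mul_conj_averagedOp hA hfin hμ ht ψ.2 χ.2)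
  simp only [mul_zero] at h1
  rw [← integral_const_mul] at h1
  rw [← h1]
  refine integral_congr_ae (Eventually.of_forall fun x => ?_)
  simp only [h.conjugateOp_apply, map_mul, Complex.conj_I, map_ofNat]
  ring

end TimeChangeData

end AnosovFlow

/-! ## Transport along the averaged vector field and deficiency spaces -/

/-- A bounded solution of `m' = c m` with a real constant `c ≠ 0` vanishes. -/
theorem eq_zero_of_hasDerivAt_const_mul_of_bounded {m : ℝ → ℂ} {c C : ℝ} (hc : c ≠ 0)
    (hm : ∀ r, HasDerivAt m (c * m r) r) (hC : ∀ r, ‖m r‖ ≤ C) : m 0 = 0 := by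
  have hd : ∀ r, HasDerivAt (fun r => (Real.exp (-c * r) : ℂ) * m r) 0 r := fun r => by
    have h1 : HasDerivAt (fun r : ℝ => Real.exp (-c * r)) (Real.exp (-c * r) * -c) r := by
      simpa using ((hasDerivAt_id r).const_mul (-c)).exp
    have h2 := h1.ofReal_comp.mul (hm r)
    refine h2.congr_deriv ?_
    push_cast
    ring
  have hconst : ∀ r, (Real.exp (-c * r) : ℂ) * m r = m 0 := fun r => by
    have := is_const_of_deriv_eq_zero (fun r => (hd r).differentiableAt)
      (fun r => (hd r).deriv) r 0
    simpa using this
  -- Evaluating at r = n/c handles both signs of c: it moves in the direction in which a nonzero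
  -- solution would grow.
  have hle : ∀ n : ℝ, ‖m 0‖ ≤ Real.exp (-n) * C := fun n => by
    have h1 := hconst (n / c)
    have h2 : -c * (n / c) = -n := by field_simp
    rw [h2] at h1
    rw [← h1, norm_mul, Complex.norm_real, Real.norm_of_nonneg (Real.exp_pos _).le]
    exact mul_le_mul_of_nonneg_left (hC _) (Real.exp_pos _).le
  have hlim : Tendsto (fun n : ℝ => Real.exp (-n) * C) atTop (𝓝 (0 * C)) :=
    (Real.tendsto_exp_neg_atTop_nhds_zero).mul_const C
  rw [zero_mul] at hlim
  exact norm_le_zero_iff.1 (ge_of_tendsto' hlim hle)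

namespace AnosovFlow.TimeChangeData

variable {E : Type*} [NormedAddCommGroup E] [NormedSpace ℝ E] [FiniteDimensional ℝ E]
variable {M : Type*} [MetricSpace M] [ChartedSpace E M] [IsManifold 𝓘(ℝ, E) ∞ M]
variable {f φ φ' : Flow ℝ M} {lam : ℝ} {τ : M → ℝ → ℝ} {sStar : ℝ → ℝ → M → ℝ}

section

variable [MeasurableSpace M] [BorelSpace M] {μ : Measure M}

/-- Differentiation under the integral, against a factor that is merely integrable: it will be the
conjugate of a vector in a deficiency space. -/
theorem hasDerivAt_integral_transport (h : TimeChangeData E f φ φ' lam τ sStar) {t : ℝ}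
    {u : ℝ → c1Functions E M}
    (hu : ∀ r x, HasDerivAt (fun r => (u r : C(M, ℂ)) x)
        (averagedOp f φ lam τ t (u r : C(M, ℂ)) x) r)
    (hb : ∀ R, ∃ C, ∀ r, |r| ≤ R → ∀ x, ‖(u r : C(M, ℂ)) x‖ ≤ C ∧
        ‖averagedOp f φ lam τ t (u r : C(M, ℂ)) x‖ ≤ C) {κ : M → ℂ} (hκ : Integrable κ μ) (r : ℝ) :
    HasDerivAt (fun r => ∫ x, (u r : C(M, ℂ)) x * κ x ∂μ)
      (∫ x, averagedOp f φ lam τ t (u r : C(M, ℂ)) x * κ x ∂μ) r := by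
  obtain ⟨C, hC⟩ := hb (|r| + 1)
  have hR : ∀ s ∈ Metric.ball r 1, |s| ≤ |r| + 1 := fun s hs => by
    rw [Metric.mem_ball, Real.dist_eq] at hs
    have := abs_sub_abs_le_abs_sub s r
    linarith
  have hm : ∀ s, AEStronglyMeasurable (fun x => (u s : C(M, ℂ)) x * κ x) μ := fun s =>
    (u s : C(M, ℂ)).continuous.aestronglyMeasurable.mul hκ.aestronglyMeasurable
  have hrr := hR r (Metric.mem_ball_self one_pos)
  refine (hasDerivAt_integral_of_dominated_loc_of_deriv_le (bound := fun x => C * ‖κ x‖)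
    (F' := fun s x => averagedOp f φ lam τ t (u s : C(M, ℂ)) x * κ x)
    (Metric.ball_mem_nhds r one_pos) (Eventually.of_forall hm) ?_ ?_
    (Eventually.of_forall fun x s hs => ?_) (hκ.norm.const_mul C)
    (Eventually.of_forall fun x s _ => (hu s x).mul_const (κ x))).2
  · exact hκ.bdd_mul (u r : C(M, ℂ)).continuous.aestronglyMeasurable
      (Eventually.of_forall fun x => (hC r hrr x).1)
  · exact (h.continuous_averagedOp t (u r).2).aestronglyMeasurable.mul hκ.aestronglyMeasurable
  · rw [norm_mul]
    exact mul_le_mul_of_nonneg_right (hC s (hR s hs) x).2 (norm_nonneg _)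

end

variable [CompactSpace M]

/-- The transport equation `∂ᵣ u = X_f(u) + g X_φ(u) + ½ h u` has a solution of class `C^1` in the
space variable, for every initial value of class `C^1`. -/
theorem exists_transport (h : TimeChangeData E f φ φ' lam τ sStar) (t : ℝ)
    (ψ : c1Functions E M) : ∃ u : ℝ → c1Functions E M, u 0 = ψ ∧
      (∀ r x, HasDerivAt (fun r => (u r : C(M, ℂ)) x)
        (averagedOp f φ lam τ t (u r : C(M, ℂ)) x) r) ∧
      ∀ R, ∃ C, ∀ r, |r| ≤ R → ∀ x, ‖(u r : C(M, ℂ)) x‖ ≤ C ∧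
        ‖averagedOp f φ lam τ t (u r : C(M, ℂ)) x‖ ≤ C := by
  obtain ⟨Φ, w, hΦ0, hw0, hΦ, hw, hint, hwd, hΦc, hwc⟩ :=
    exists_globalFlow_of_contMDiff (h.contMDiff_averagedField t) (h.contMDiff_avgDiv t)
  have hΨc : ∀ (χ : M → ℂ), ContMDiff 𝓘(ℝ, E) 𝓘(ℝ, ℂ) 1 χ → ∀ r,
      ContMDiff 𝓘(ℝ, E) 𝓘(ℝ, ℂ) 1 fun x => Complex.exp ((1 / 2 * w r x : ℝ) : ℂ) * χ (Φ r x) :=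
    fun χ hχ r => by
      have he : ContMDiff 𝓘(ℝ, ℝ) 𝓘(ℝ, ℂ) 1
          (fun a : ℝ => Complex.exp ((1 / 2 * a : ℝ) : ℂ)) :=
        (Complex.ofRealCLM.contDiff.comp (contDiff_const.mul contDiff_id)).cexp.contMDiff
      exact contMDiff_complex_mul (he.comp (hwc r)) (hχ.comp (hΦc r))
  have hΨd : ∀ (χ : M → ℂ), ContMDiff 𝓘(ℝ, E) 𝓘(ℝ, ℂ) 1 χ → ∀ r x,
      HasDerivAt (fun r => Complex.exp ((1 / 2 * w r x : ℝ) : ℂ) * χ (Φ r x))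
        (Complex.exp ((1 / 2 * w r x : ℝ) : ℂ) * averagedOp f φ lam τ t χ (Φ r x)) r :=
    fun χ hχ r x => by
      have hv : HasVelocityAt (E := E) (fun r => Φ r x) r (averagedField E f φ lam τ t (Φ r x)) :=
        hint x r
      have h1 := hv.hasDerivAt (hχ.mdifferentiable (by norm_num) _)
      rw [h.dirDeriv_averagedField t hχ] at h1
      have h2 := ((hwd r x).const_mul (1 / 2)).ofReal_comp.cexp
      refine (h2.mul h1).congr_deriv ?_
      simp only [averagedOp, Complex.real_smul]
      push_cast
      ring
  -- The weight exp(w_r/2) is the square root of the Jacobian factor of the flow with divergence h,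
  -- which makes the transport isometric in L².
  let u : ℝ → c1Functions E M := fun r =>
    ⟨⟨fun x => Complex.exp ((1 / 2 * w r x : ℝ) : ℂ) * (ψ : C(M, ℂ)) (Φ r x),
      (hΨc _ ψ.2 r).continuous⟩, hΨc _ ψ.2 r⟩
  -- The generator commutes with the transport. This follows by differentiating the group law at ε =
  -- 0 in two ways, so no second derivatives of the flow are needed.
  have hop : ∀ r x, averagedOp f φ lam τ t (u r : C(M, ℂ)) x =
      Complex.exp ((1 / 2 * w r x : ℝ) : ℂ) *
        averagedOp f φ lam τ t (ψ : C(M, ℂ)) (Φ r x) := fun r x => by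
    have h1 := hΨd _ (u r).2 0 x
    rw [hw0, hΦ0, mul_zero, Complex.ofReal_zero, Complex.exp_zero, one_mul] at h1
    have h2 : HasDerivAt (fun ε => (u (r + ε) : C(M, ℂ)) x)
        (Complex.exp ((1 / 2 * w r x : ℝ) : ℂ) *
          averagedOp f φ lam τ t (ψ : C(M, ℂ)) (Φ r x)) 0 := by
      refine HasDerivAt.comp_const_add r 0 (f := fun r => (u r : C(M, ℂ)) x) ?_
      rw [add_zero]
      exact hΨd _ ψ.2 r x
    refine h1.unique (h2.congr_of_eventuallyEq (Eventually.of_forall fun ε => ?_))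
    change Complex.exp ((1 / 2 * w ε x : ℝ) : ℂ) *
      (Complex.exp ((1 / 2 * w r (Φ ε x) : ℝ) : ℂ) * (ψ : C(M, ℂ)) (Φ r (Φ ε x))) =
      Complex.exp ((1 / 2 * w (r + ε) x : ℝ) : ℂ) * (ψ : C(M, ℂ)) (Φ (r + ε) x)
    rw [← mul_assoc, ← Complex.exp_add, hw, hΦ]
    push_cast
    ring_nf
  refine ⟨u, ?_, fun r x => ?_, fun R => ?_⟩
  · ext x
    change Complex.exp ((1 / 2 * w 0 x : ℝ) : ℂ) * (ψ : C(M, ℂ)) (Φ 0 x) = (ψ : C(M, ℂ)) x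
    rw [hw0, hΦ0, mul_zero, Complex.ofReal_zero, Complex.exp_zero, one_mul]
  · rw [hop]
    exact hΨd _ ψ.2 r x
  · let H : C(M, ℝ) := ⟨avgDiv f φ τ t, (h.contMDiff_avgDiv t).continuous⟩
    let B : C(M, ℂ) := ⟨_, h.continuous_averagedOp t ψ.2⟩
    have hwb : ∀ r x, w r x ≤ ‖H‖ * |r| := fun r x => by
      have h1 := (convex_univ (𝕜 := ℝ) (E := ℝ)).norm_image_sub_le_of_norm_hasDerivWithin_le
        (f := fun r => w r x) (x := 0) (y := r)
        (fun s _ => (hwd s x).hasDerivWithinAt) (fun s _ => H.norm_coe_le_norm (Φ s x))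
        (mem_univ _) (mem_univ _)
      rw [hw0, sub_zero, sub_zero] at h1
      exact (le_abs_self _).trans h1
    refine ⟨Real.exp (1 / 2 * (‖H‖ * R)) * max ‖(ψ : C(M, ℂ))‖ ‖B‖, fun r hr x => ?_⟩
    have he : ‖Complex.exp ((1 / 2 * w r x : ℝ) : ℂ)‖ ≤ Real.exp (1 / 2 * (‖H‖ * R)) := by
      rw [Complex.norm_exp, Complex.ofReal_re]
      refine Real.exp_le_exp.2 (mul_le_mul_of_nonneg_left ((hwb r x).trans ?_) (by norm_num))
      exact mul_le_mul_of_nonneg_left hr (norm_nonneg _)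
    rw [hop]
    change ‖Complex.exp ((1 / 2 * w r x : ℝ) : ℂ) * (ψ : C(M, ℂ)) (Φ r x)‖ ≤ _ ∧ _
    rw [norm_mul, norm_mul]
    exact ⟨mul_le_mul he (((ψ : C(M, ℂ)).norm_coe_le_norm _).trans (le_max_left _ _))
        (norm_nonneg _) (Real.exp_pos _).le,
      mul_le_mul he ((B.norm_coe_le_norm _).trans (le_max_right _ _))
        (norm_nonneg _) (Real.exp_pos _).le⟩

variable [MeasurableSpace M] [BorelSpace M] {μ : Measure M} [IsFiniteMeasure μ]

theorem inner_toLp_eq_integral (v : Lp ℂ 2 μ) (κ : C(M, ℂ)) :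
    inner ℂ v (ContinuousMap.toLp 2 μ ℂ κ) = ∫ x, κ x * starRingEnd ℂ (v x) ∂μ := by
  rw [L2.inner_def]
  refine integral_congr_ae ?_
  filter_upwards [ContinuousMap.coeFn_toLp (p := 2) (𝕜 := ℂ) μ κ] with x hx
  rw [hx, RCLike.inner_apply]

variable [Nonempty M]
  [RiemannianBundle (fun x : M => TangentSpace 𝓘(ℝ, E) x)]
  [IsContMDiffRiemannianBundle 𝓘(ℝ, E) ∞ E (fun x : M => TangentSpace 𝓘(ℝ, E) x)]
  [IsRiemannianManifold 𝓘(ℝ, E) M]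
  {Eu Es : (x : M) → Submodule ℝ (TangentSpace 𝓘(ℝ, E) x)}

/-- The derivative of ‖u_r‖² is the integral of Du·ū + u·conj(Du) with D = Y + h/2, which is zero by
skew-symmetry. -/
theorem norm_toLp_transport (h : TimeChangeData E f φ φ' lam τ sStar)
    (hA : IsAnosovSplitting E f Eu Es) (hfin : ∀ x, Module.finrank ℝ (Eu x) = 1)
    (hμ : ∀ s, MeasurePreserving (φ s) μ μ) {t : ℝ} (ht : t ≠ 0)
    {u : ℝ → c1Functions E M}
    (hu : ∀ r x, HasDerivAt (fun r => (u r : C(M, ℂ)) x)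
        (averagedOp f φ lam τ t (u r : C(M, ℂ)) x) r)
    (hb : ∀ R, ∃ C, ∀ r, |r| ≤ R → ∀ x, ‖(u r : C(M, ℂ)) x‖ ≤ C ∧
        ‖averagedOp f φ lam τ t (u r : C(M, ℂ)) x‖ ≤ C) (r : ℝ) :
    ‖(ContinuousMap.toLp 2 μ ℂ (u r : C(M, ℂ)) : Lp ℂ 2 μ)‖ =
      ‖(ContinuousMap.toLp 2 μ ℂ (u 0 : C(M, ℂ)) : Lp ℂ 2 μ)‖ := by
  have hd : ∀ r, HasDerivAt
      (fun r => ∫ x, (u r : C(M, ℂ)) x * starRingEnd ℂ ((u r : C(M, ℂ)) x) ∂μ) 0 r := fun r => by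
    obtain ⟨C, hC⟩ := hb (|r| + 1)
    have hR : ∀ s ∈ Metric.ball r 1, |s| ≤ |r| + 1 := fun s hs => by
      rw [Metric.mem_ball, Real.dist_eq] at hs
      have := abs_sub_abs_le_abs_sub s r
      linarith
    have hc : ∀ s, Continuous fun x => (u s : C(M, ℂ)) x * starRingEnd ℂ ((u s : C(M, ℂ)) x) :=
      fun s => (u s : C(M, ℂ)).continuous.mul
        (Complex.continuous_conj.comp (u s : C(M, ℂ)).continuous)
    have hB := h.continuous_averagedOp t (u r).2
    have h1 := (hasDerivAt_integral_of_dominated_loc_of_deriv_le (μ := μ)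
      (bound := fun _ => C * C + C * C)
      (F := fun s x => (u s : C(M, ℂ)) x * starRingEnd ℂ ((u s : C(M, ℂ)) x))
      (F' := fun s x => averagedOp f φ lam τ t (u s : C(M, ℂ)) x *
        starRingEnd ℂ ((u s : C(M, ℂ)) x) + (u s : C(M, ℂ)) x *
          starRingEnd ℂ (averagedOp f φ lam τ t (u s : C(M, ℂ)) x))
      (Metric.ball_mem_nhds r one_pos)
      (Eventually.of_forall fun s => (hc s).aestronglyMeasurable)
      (integrable_of_continuous (hc r))
      ((hB.mul (Complex.continuous_conj.comp (u r : C(M, ℂ)).continuous)).add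
        ((u r : C(M, ℂ)).continuous.mul
          (Complex.continuous_conj.comp hB))).aestronglyMeasurable
      (Eventually.of_forall fun x s hs => ?_) (integrable_const _)
      (Eventually.of_forall fun x s _ => ?_)).2
    · rwa [h.integral_mul_conj_averagedOp hA hfin hμ ht (u r).2 (u r).2] at h1
    · obtain ⟨h2, h3⟩ := hC s (hR s hs) x
      have hC0 : 0 ≤ C := (norm_nonneg _).trans h2
      refine (norm_add_le _ _).trans (add_le_add ?_ ?_)
      · rw [norm_mul, RCLike.norm_conj]
        exact mul_le_mul h3 h2 (norm_nonneg _) hC0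
      · rw [norm_mul, RCLike.norm_conj]
        exact mul_le_mul h2 h3 (norm_nonneg _) hC0
    · exact (hu s x).mul (Complex.conjCLE.toContinuousLinearMap.hasFDerivAt.comp_hasDerivAt s
        (hu s x))
  have h1 := is_const_of_deriv_eq_zero (fun r => (hd r).differentiableAt)
      (fun r => (hd r).deriv) r 0
  rw [← ContinuousMap.inner_toLp, ← ContinuousMap.inner_toLp, inner_self_eq_norm_sq_to_K,
    inner_self_eq_norm_sq_to_K] at h1
  have h2 : ‖(ContinuousMap.toLp 2 μ ℂ (u r : C(M, ℂ)) : Lp ℂ 2 μ)‖ ^ 2 =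
      ‖(ContinuousMap.toLp 2 μ ℂ (u 0 : C(M, ℂ)) : Lp ℂ 2 μ)‖ ^ 2 := by exact_mod_cast h1
  exact (pow_left_inj₀ (norm_nonneg _) (norm_nonneg _) two_ne_zero).1 h2

/-- The deficiency spaces of the conjugate operator are trivial. -/
theorem eq_zero_of_orthogonal_range [μ.IsOpenPosMeasure]
    (h : TimeChangeData E f φ φ' lam τ sStar)
    (hA : IsAnosovSplitting E f Eu Es) (hfin : ∀ x, Module.finrank ℝ (Eu x) = 1)
    (hμ : ∀ s, MeasurePreserving (φ s) μ μ) {t : ℝ} (ht : t ≠ 0) {c : ℝ} (hc : c ≠ 0)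
    {v : Lp ℂ 2 μ}
    (hv : ∀ x : (h.conjugateOperator (μ := μ) t).domain, inner ℂ v (h.conjugateOperator t x) =
      2 * Complex.I * c * inner ℂ v (x : Lp ℂ 2 μ)) : v = 0 := by
  refine (h.dense_domain_conjugateOperator (μ := μ) t).eq_zero_of_inner_left ℂ
    fun y hy => ?_
  obtain ⟨ψ, hψ⟩ := h.exists_of_mem_domain ⟨y, hy⟩
  obtain rfl : y = ContinuousMap.toLp 2 μ ℂ (ψ : C(M, ℂ)) := congrArg Subtype.val hψ
  obtain ⟨u, hu0, hu, hb⟩ := h.exists_transport t ψ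
  have hκ : Integrable (fun x => starRingEnd ℂ (v x)) μ := by
    have : Integrable v μ := (Lp.memLp v).integrable (by norm_num)
    exact Complex.conjCLE.toContinuousLinearMap.integrable_comp this
  -- The solution stays in the domain, so the orthogonality relation can be tested on every u_r and
  -- becomes a scalar differential equation.
  have hd : ∀ r, HasDerivAt
      (fun r => inner ℂ v (ContinuousMap.toLp 2 μ ℂ (u r : C(M, ℂ))))
      (c * inner ℂ v (ContinuousMap.toLp 2 μ ℂ (u r : C(M, ℂ)))) r := fun r => by
    have h1 := h.hasDerivAt_integral_transport hu hb hκ r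
    have h2 := hv ⟨_, h.toLp_mem_domain t (u r)⟩
    rw [h.conjugateOperator_toLp, inner_toLp_eq_integral] at h2
    simp only [h.conjugateOp_apply, mul_assoc (2 * Complex.I)] at h2
    rw [integral_const_mul] at h2
    have h3 := mul_left_cancel₀ (mul_ne_zero two_ne_zero Complex.I_ne_zero) h2
    rw [h3] at h1
    simpa only [inner_toLp_eq_integral] using h1
  have h0 := eq_zero_of_hasDerivAt_const_mul_of_bounded hc hd
    (C := ‖v‖ * ‖(ContinuousMap.toLp 2 μ ℂ (u 0 : C(M, ℂ)) : Lp ℂ 2 μ)‖) fun r => by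
      rw [← h.norm_toLp_transport hA hfin hμ ht hu hb r]
      exact norm_inner_le_norm _ _
  rwa [hu0] at h0

theorem isEssentiallySelfAdjoint_conjugateOperator [μ.IsOpenPosMeasure]
    (h : TimeChangeData E f φ φ' lam τ sStar)
    (hA : IsAnosovSplitting E f Eu Es) (hfin : ∀ x, Module.finrank ℝ (Eu x) = 1)
    (hμ : ∀ s, MeasurePreserving (φ s) μ μ) {t : ℝ} (ht : t ≠ 0) :
    IsEssentiallySelfAdjoint (h.conjugateOperator (μ := μ) t) := by
  -- Since the operator is 2i(Y + h/2), the values ±i correspond to 2ic with c = ±1/2.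
  refine LinearPMap.isEssentiallySelfAdjoint_of_orthogonal_range_eq_zero
    (h.dense_domain_conjugateOperator t) (h.isFormalAdjoint_conjugateOperator hA hfin hμ ht)
    (fun v hv => h.eq_zero_of_orthogonal_range hA hfin hμ ht (c := 1 / 2) (by norm_num)
      fun x => ?_)
    (fun v hv => h.eq_zero_of_orthogonal_range hA hfin hμ ht (c := -1 / 2) (by norm_num)
      fun x => ?_)
  · have h1 := hv x
    rw [inner_sub_right, inner_smul_right, sub_eq_zero] at h1
    rw [h1]
    push_cast
    ring
  · have h1 := hv x
    rw [inner_add_right, inner_smul_right, add_eq_zero_iff_eq_neg] at h1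
    rw [h1]
    push_cast
    ring

end AnosovFlow.TimeChangeData

theorem mainTheorem4
    {E : Type*} [NormedAddCommGroup E] [NormedSpace ℝ E] [FiniteDimensional ℝ E]
    {M : Type*} [MetricSpace M] [ChartedSpace E M] [IsManifold 𝓘(ℝ, E) ∞ M]
    [RiemannianBundle (fun x : M => TangentSpace 𝓘(ℝ, E) x)]
    [IsContMDiffRiemannianBundle 𝓘(ℝ, E) ∞ E (fun x : M => TangentSpace 𝓘(ℝ, E) x)]
    [IsRiemannianManifold 𝓘(ℝ, E) M]
    [CompactSpace M] [ConnectedSpace M] [MeasurableSpace M] [BorelSpace M]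
    (f φ φ' : Flow ℝ M) (lam : ℝ) (τ : M → ℝ → ℝ) (sStar : ℝ → ℝ → M → ℝ)
    (μ : Measure M) [IsProbabilityMeasure μ]
    (hf : AnosovFlow.IsCodimensionOneAnosovFlow E f)
    (hφ : AnosovFlow.IsMinimalUnstableFlow f φ)
    (hμ : ∀ s : ℝ, MeasurePreserving (φ s) μ μ)
    (hφ' : AnosovFlow.IsUniformlyExpanding f φ' lam)
    (hτ : AnosovFlow.IsC1Reparametrisation E φ φ' τ)
    (hcomm : ∀ (t s : ℝ) (x : M), f t (φ s x) = φ (sStar t s x) (f t x))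
    (hs : AnosovFlow.HasContinuousMixedDeriv sStar)
    (hρ : AnosovFlow.HasC1Data E f φ (AnosovFlow.rho τ))
    (t : ℝ) (ht : 0 < t) :
    ∃ A : Lp ℂ 2 μ →ₗ.[ℂ] Lp ℂ 2 μ,
      AnosovFlow.IsConjugateOperator E f φ (AnosovFlow.rho τ) μ t A ∧
        AnosovFlow.IsEssentiallySelfAdjoint A := by
  obtain ⟨Eu, Es, hA, hfin⟩ := hf.2
  have h : AnosovFlow.TimeChangeData E f φ φ' lam τ sStar :=
    ⟨hf.1.1, hA.vectorField_ne_zero, hφ, hφ', hτ, hcomm, hs, hρ⟩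
  have := AnosovFlow.isOpenPosMeasure_of_dense_orbit hφ.dense_orbit hμ
  exact ⟨h.conjugateOperator t, h.isConjugateOperator ht.ne',
    h.isEssentiallySelfAdjoint_conjugateOperator hA hfin hμ ht.ne'⟩
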